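/- **Theorem 1.3 (Existence of minimizers).** *Generic immersions, Arnold invariants, compartments.* Consider closed $C^1$-immersed plane curves $\gamma:\mathbb R/\mathbb Z\to\mathbb R^2$ (so $\gamma'\neq 0$ everywhere). Such a curve is *generic* if all its self-intersections are transverse double points. The winding number $W(\gamma)$ is the degree of $\gamma'/|\gamma'|$. A *regular homotopy* is a path of $C^1$-immersions that is continuous in the $C^1$-topology. A *generic path* is a regular homotopy consisting of generic immersions except at finitely many interior times. At each of these the curve is generic up to exactly one degeneracy, namely a direct self-tangency (of two branches whose tangent vectors point in the same direction), an inverse self-tangency (opposite directions), or a transverse triple point, and the path crosses the corresponding stratum: at a tangency the number of double points changes by $\pm2$ and the crossing is positive if it increases; at a triple point the small triangle formed by the three branches vanishes and is replaced by one of opposite sign, and the crossing is positive if the newborn triangle has sign $+1$. (The curve visits the three sides of the triangle in a cyclic order, which orients the triangle; the sign of the triangle is $(-1)^k$, where $k$ is the number of sides on which this orientation agrees with that of the curve.) Let $\gamma_R^\omega$ be Arnold's representative curve with winding number $\omega$: the figure eight for $\omega=0$, and a circle with $|\omega|-1$ small inner loops, traversed in the direction given by the sign of $\omega$, for $\omega\ne0$.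 The Arnold invariants $J^+,J^-,\mathrm{St}$ of a generic immersion $\gamma$ with $W(\gamma)=\omega$ are obtained by following a generic path from $\gamma_R^\omega$ to $\gamma$. They start with the values $(0,-1,0)$ if $\omega=0$ and $(-2(|\omega|-1),\,-3(|\omega|-1),\,|\omega|-1)$ if $\omega\neq0$. A positive (negative) crossing at a direct tangency changes $J^+$ by $+2$ ($-2$), one at an inverse tangency changes $J^-$ by $-2$ ($+2$), one at a triple point changes $\mathrm{St}$ by $+1$ ($-1$), and no other changes occur. For $j_+,j_-,s,\omega\in\mathbb Z$, a *non-empty $(j_\pm,s,\omega)$-compartment* $\mathcal C$ is a path component, with respect to regular homotopy, of the set of generic immersions with $J^+=j_+$, $J^-=j_-$, $\mathrm{St}=s$, $W=\omega$. *Admissible curves.* For a generic immersion $\gamma$ let $S(\gamma)=\{(u,v):u<v,\ \gamma(u)=\gamma(v)\}$ (with parameters represented in $[0,1)$), let $T(\gamma)$ be the set of all parameters that occur in $S(\gamma)$, let $d_\gamma$ be the intrinsic distance of parameters along the curve, and let $\Lambda(\gamma)=\min\{d_\gamma(a,b):a,b\in T(\gamma),\ a\ne b\}$ ($=\infty$ if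 $T(\gamma)=\emptyset$). For $\eta\in(0,1)$ let $\mathcal F(\eta,j_\pm,s,\omega)$ be the set of all generic immersions $\gamma\in C^1(\mathbb R/\mathbb Z,\mathbb R^2)$ with $|\gamma'|\equiv1$, $J^+(\gamma)=j_+$, $J^-(\gamma)=j_-$, $\mathrm{St}(\gamma)=s$, $W(\gamma)=\omega$ and $\Lambda(\gamma)\ge2\eta$ that are affine linear on the open ball $B_\eta(u)$ for every $u\in T(\gamma)$. *Energy.* For $q>2$ and $0<\delta<\Lambda(\gamma)/2$ set $$\mathrm{TP}_{q,\delta}(\gamma)=\iint_{(\mathbb R/\mathbb Z)^2\setminus Y_\delta(\gamma)}\left(\frac{2\,\mathrm{dist}(\ell(t),\gamma(s))}{|\gamma(t)-\gamma(s)|^2}\right)^q|\gamma'(s)||\gamma'(t)|\,ds\,dt\ \in[0,\infty],$$ where $\ell(t)=\gamma(t)+\mathbb R\gamma'(t)$ and $Y_\delta(\gamma)$ is the set of all $(x,y)$ such that, for some $(u,v)\in S(\gamma)$, either $d_\gamma(x,u)<\delta$ and $d_\gamma(y,v)<\delta$, or $d_\gamma(x,v)<\delta$ and $d_\gamma(y,u)<\delta$.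 *Claim.* Let $\mathcal C$ be a non-empty $(j_\pm,s,\omega)$-compartment. There is an $\eta_0\in(0,1)$ such that $$\mathcal F(\eta,j_\pm,s,\omega)\cap\mathcal C\cap C^{1,1}(\mathbb R/\mathbb Z,\mathbb R^2)\neq\emptyset\quad\text{for all }\eta\in(0,\eta_0].\tag{$*$}$$ For every $\eta_0=\eta_0(\mathcal C)\in(0,1)$ with property $(*)$, all $\eta\in(0,\eta_0]$, $\delta\in(0,\eta/2]$ and $q>2$, there is a curve $\gamma_\delta^\eta\in\mathcal F(\eta,j_\pm,s,\omega)\cap W^{2-1/q,q}(\mathbb R/\mathbb Z,\mathbb R^2)\cap\mathcal C$ such that $$\mathrm{TP}_{q,\delta}(\gamma_\delta^\eta)\le\mathrm{TP}_{q,\delta}(\gamma)\quad\text{for all }\gamma\in\mathcal F(\eta,j_\pm,s,\omega)\cap\mathcal C.$$ -/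

import Mathlib

open Set Filter Topology MeasureTheory
open scoped ENNReal

/-! Closed plane curves are functions on `ℝ` of period `1`, that is, functions on `ℝ/ℤ`; the
Euclidean plane is `ℂ` with its usual norm.  Points of `ℝ/ℤ` are represented by `[0,1)`. -/

namespace PlaneCurve

/-- The oriented area `a ∧ b`; it vanishes exactly when `a` and `b` are parallel. -/
def cross (a b : ℂ) : ℝ := a.re * b.im - a.im * b.re

/-- Closed immersed plane curves of class `C¹`. -/
structure IsImmersion (γ : ℝ → ℂ) : Prop where
  contDiff : ContDiff ℝ 1 γ
  periodic : Function.Periodic γ 1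
  deriv_ne_zero : ∀ x, deriv γ x ≠ 0

/-- `S(γ)`: the parameter pairs `u < v` of self-intersections. -/
def doublePairs (γ : ℝ → ℂ) : Set (ℝ × ℝ) :=
  {p | p.1 ∈ Ico (0 : ℝ) 1 ∧ p.2 ∈ Ico (0 : ℝ) 1 ∧ p.1 < p.2 ∧ γ p.1 = γ p.2}

/-- `T(γ)`: all parameters that occur in `S(γ)`. -/
def doubleParams (γ : ℝ → ℂ) : Set ℝ :=
  {u | ∃ p ∈ doublePairs γ, u = p.1 ∨ u = p.2}

/-- `x < y < z` are parameters of a common point of the curve. -/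
def IsTriple (γ : ℝ → ℂ) (x y z : ℝ) : Prop :=
  0 ≤ x ∧ x < y ∧ y < z ∧ z < 1 ∧ γ x = γ y ∧ γ y = γ z

/-- The two branches at a pair of parameters have independent tangents. -/
def TransverseAt (γ : ℝ → ℂ) (p : ℝ × ℝ) : Prop :=
  cross (deriv γ p.1) (deriv γ p.2) ≠ 0

/-- Generic immersions: all self-intersections are transverse double points. -/
structure IsGeneric (γ : ℝ → ℂ) : Prop where
  immersion : IsImmersion γ
  transverse : ∀ p ∈ doublePairs γ, TransverseAt γ p
  no_triple : ∀ x y z, ¬ IsTriple γ x y z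

/-- The winding number `W(γ) = ω`: the degree of `γ'/|γ'|`, through a continuous angle. -/
def HasWindingNumber (γ : ℝ → ℂ) (ω : ℤ) : Prop :=
  ∃ θ : ℝ → ℝ, Continuous θ ∧
    (∀ x, deriv γ x = (‖deriv γ x‖ : ℂ) * Complex.exp (θ x * Complex.I)) ∧
    θ 1 - θ 0 = 2 * Real.pi * ω

/-- Regular homotopies: paths `t ↦ H t`, `t ∈ [0,1]`, of closed immersions that are continuous
in the `C¹` topology. -/
structure IsRegularHomotopy (H : ℝ → ℝ → ℂ) : Prop where
  immersion : ∀ t ∈ Icc (0 : ℝ) 1, IsImmersion (H t)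
  continuousOn : ContinuousOn (fun p : ℝ × ℝ => H p.1 p.2) (Icc (0 : ℝ) 1 ×ˢ univ)
  continuousOn_deriv :
    ContinuousOn (fun p : ℝ × ℝ => deriv (H p.1) p.2) (Icc (0 : ℝ) 1 ×ˢ univ)

/-! ### The three codimension one strata of the discriminant and the signs of crossings -/

/-- A curve that is generic up to a single tangency of two branches, at the pair `p`. -/
structure IsSelfTangency (γ : ℝ → ℂ) (p : ℝ × ℝ) : Prop where
  immersion : IsImmersion γ
  finite : (doublePairs γ).Finite
  mem : p ∈ doublePairs γ
  tangent : cross (deriv γ p.1) (deriv γ p.2) = 0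
  transverse : ∀ p' ∈ doublePairs γ, p' ≠ p → TransverseAt γ p'
  no_triple : ∀ x y z, ¬ IsTriple γ x y z

/-- The tangent vectors point in the same direction. -/
def IsDirectTangency (γ : ℝ → ℂ) : Prop :=
  ∃ p, IsSelfTangency γ p ∧ SameRay ℝ (deriv γ p.1) (deriv γ p.2)

/-- The tangent vectors point in opposite directions. -/
def IsInverseTangency (γ : ℝ → ℂ) : Prop :=
  ∃ p, IsSelfTangency γ p ∧ SameRay ℝ (deriv γ p.1) (-deriv γ p.2)

/-- A curve that is generic up to a single transverse triple point, with the parameters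
`u₁ < u₂ < u₃`. -/
structure IsTriplePoint (γ : ℝ → ℂ) (u₁ u₂ u₃ : ℝ) : Prop where
  immersion : IsImmersion γ
  triple : IsTriple γ u₁ u₂ u₃
  unique : ∀ x y z, IsTriple γ x y z → x = u₁ ∧ y = u₂ ∧ z = u₃
  transverse : ∀ p ∈ doublePairs γ, TransverseAt γ p

/-- At time `t₀` the number of double points jumps by `2 ε`, where `ε = 1` (a pair is born) or
`ε = -1` (a pair dies). -/
def DoublePointJump (H : ℝ → ℝ → ℂ) (t₀ : ℝ) (ε : ℤ) : Prop :=
  (ε = 1 ∨ ε = -1) ∧ ∃ n : ℤ,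
    (∀ᶠ t in 𝓝[<] t₀, ((doublePairs (H t)).ncard : ℤ) = n) ∧
    (∀ᶠ t in 𝓝[>] t₀, ((doublePairs (H t)).ncard : ℤ) = n + 2 * ε)

/-- The path `H` crosses the stratum of direct self-tangencies with sign `ε`. -/
def DirectCrossing (H : ℝ → ℝ → ℂ) (t₀ : ℝ) (ε : ℤ) : Prop :=
  IsDirectTangency (H t₀) ∧ DoublePointJump H t₀ ε

/-- The path `H` crosses the stratum of inverse self-tangencies with sign `ε`. -/
def InverseCrossing (H : ℝ → ℝ → ℂ) (t₀ : ℝ) (ε : ℤ) : Prop :=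
  IsInverseTangency (H t₀) ∧ DoublePointJump H t₀ ε

open Classical in
/-- The branches of `γ` near the parameters `u₁ < u₂ < u₃` form a small triangle of sign `ε`.
Its vertices are `γ x₁ = γ x₂`, `γ y₂ = γ y₃` and `γ z₃ = γ z₁` (the index is that of the
branch).  The curve visits the three sides in the cyclic order `1, 2, 3`, which orients the
triangle: side `1` from `z₁` to `x₁`, side `2` from `x₂` to `y₂`, side `3` from `y₃` to `z₃`.
The sign is `(-1)^k`, where `k` counts the sides on which this orientation agrees with the
orientation of the curve. -/
def HasTriangle (γ : ℝ → ℂ) (u₁ u₂ u₃ r : ℝ) (ε : ℤ) : Prop :=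
  ∃ x₁ z₁ x₂ y₂ y₃ z₃ : ℝ,
    x₁ ∈ Ioo (u₁ - r) (u₁ + r) ∧ z₁ ∈ Ioo (u₁ - r) (u₁ + r) ∧
    x₂ ∈ Ioo (u₂ - r) (u₂ + r) ∧ y₂ ∈ Ioo (u₂ - r) (u₂ + r) ∧
    y₃ ∈ Ioo (u₃ - r) (u₃ + r) ∧ z₃ ∈ Ioo (u₃ - r) (u₃ + r) ∧
    γ x₁ = γ x₂ ∧ γ y₂ = γ y₃ ∧ γ z₃ = γ z₁ ∧
    ε = (-1) ^ ((if z₁ < x₁ then 1 else 0) + (if x₂ < y₂ then 1 else 0) +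
      (if y₃ < z₃ then 1 else 0) : ℕ)

/-- The path `H` crosses the stratum of transverse triple points with sign `ε`: the newborn
triangle has sign `ε` and the vanishing one has sign `-ε`. -/
def TripleCrossing (H : ℝ → ℝ → ℂ) (t₀ : ℝ) (ε : ℤ) : Prop :=
  (ε = 1 ∨ ε = -1) ∧ ∃ u₁ u₂ u₃ : ℝ, IsTriplePoint (H t₀) u₁ u₂ u₃ ∧
    ∀ r > 0, (∀ᶠ t in 𝓝[<] t₀, HasTriangle (H t) u₁ u₂ u₃ r (-ε)) ∧
      (∀ᶠ t in 𝓝[>] t₀, HasTriangle (H t) u₁ u₂ u₃ r ε)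

/-- Generic paths: `H t` is generic except at finitely many times `t ∈ (0,1)`, at which `H`
crosses one of the three strata (at the times in `D`, `I`, `T`, respectively), with sign `ε t`. -/
structure IsGenericPath (H : ℝ → ℝ → ℂ) (D I T : Finset ℝ) (ε : ℝ → ℤ) : Prop where
  homotopy : IsRegularHomotopy H
  times : ∀ t ∈ D ∪ I ∪ T, t ∈ Ioo (0 : ℝ) 1
  generic : ∀ t ∈ Icc (0 : ℝ) 1, t ∉ D ∪ I ∪ T → IsGeneric (H t)
  direct : ∀ t ∈ D, DirectCrossing H t (ε t)
  inverse : ∀ t ∈ I, InverseCrossing H t (ε t)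
  triple : ∀ t ∈ T, TripleCrossing H t (ε t)

/-! ### Arnold's invariants -/

/-- Arnold's representative of winding number `ω`: the figure eight for `ω = 0`, and for
`ω ≠ 0` a circle with `|ω| - 1` small inner loops (a circle if `|ω| = 1`), traversed
counterclockwise for `ω > 0` and clockwise for `ω < 0`. -/
noncomputable def representative (ω : ℤ) (x : ℝ) : ℂ :=
  if ω = 0 then
    (Real.sin (2 * Real.pi * x) : ℂ) + (Real.sin (4 * Real.pi * x) : ℂ) * Complex.I
  else
    Complex.exp (2 * Real.pi * (ω.sign : ℂ) * x * Complex.I) +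
      (2 / (ω.natAbs : ℂ)) * Complex.exp (2 * Real.pi * (ω : ℂ) * x * Complex.I)

/-- The prescribed value of `J⁺` on the representative. -/
def baseJPlus (ω : ℤ) : ℤ := if ω = 0 then 0 else -2 * (|ω| - 1)

/-- The prescribed value of `J⁻` on the representative. -/
def baseJMinus (ω : ℤ) : ℤ := if ω = 0 then -1 else -3 * (|ω| - 1)

/-- The prescribed value of `St` on the representative. -/
def baseSt (ω : ℤ) : ℤ := if ω = 0 then 0 else |ω| - 1

/-- `J⁺(γ) = jp`, `J⁻(γ) = jm` and `St(γ) = s`: these are the values obtained by following a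
generic path from the representative with the winding number of `γ` to `γ`.  A positive crossing
of the strata of direct tangencies, inverse tangencies and triple points adds `2` to `J⁺`,
`-2` to `J⁻` and `1` to `St`, respectively. -/
def HasArnoldInvariants (γ : ℝ → ℂ) (jp jm s : ℤ) : Prop :=
  ∃ ω : ℤ, HasWindingNumber γ ω ∧
    ∃ (H : ℝ → ℝ → ℂ) (D I T : Finset ℝ) (ε : ℝ → ℤ),
      IsGenericPath H D I T ε ∧ H 0 = representative ω ∧ H 1 = γ ∧
      jp = baseJPlus ω + ∑ t ∈ D, 2 * ε t ∧
      jm = baseJMinus ω + ∑ t ∈ I, -2 * ε t ∧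
      s = baseSt ω + ∑ t ∈ T, ε t

/-- The generic immersions with given Arnold invariants and winding number. -/
def genericClass (jp jm s ω : ℤ) : Set (ℝ → ℂ) :=
  {γ | IsGeneric γ ∧ HasArnoldInvariants γ jp jm s ∧ HasWindingNumber γ ω}

/-- `γ₀` and `γ₁` are joined by a regular homotopy inside the set `G` of curves. -/
def JoinedWithin (G : Set (ℝ → ℂ)) (γ₀ γ₁ : ℝ → ℂ) : Prop :=
  ∃ H : ℝ → ℝ → ℂ, IsRegularHomotopy H ∧ (∀ t ∈ Icc (0 : ℝ) 1, H t ∈ G) ∧ H 0 = γ₀ ∧ H 1 = γ₁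

/-- `C` is a non-empty compartment: a path component of `genericClass jp jm s ω` with respect
to regular homotopy. -/
def IsCompartment (jp jm s ω : ℤ) (C : Set (ℝ → ℂ)) : Prop :=
  ∃ γ₀ ∈ genericClass jp jm s ω, C = {γ | JoinedWithin (genericClass jp jm s ω) γ₀ γ}

/-! ### Admissible curves -/

/-- The intrinsic distance `d_γ` of two parameters of a closed curve: the length of the shortest
of the arcs between them. -/
noncomputable def arcDist (γ : ℝ → ℂ) (x y : ℝ) : ℝ :=
  ⨅ k : ℤ, |∫ t in x..(y + k), ‖deriv γ t‖|

/-- `Λ(γ)`: the least intrinsic distance of two distinct elements of `T(γ)` (`∞` if `T(γ)` is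
empty). -/
noncomputable def minGap (γ : ℝ → ℂ) : ℝ≥0∞ :=
  ⨅ (a ∈ doubleParams γ) (b ∈ doubleParams γ) (_ : a ≠ b), ENNReal.ofReal (arcDist γ a b)

/-- The class `F(η, j±, s, ω)`. -/
structure IsAdmissible (η : ℝ) (jp jm s ω : ℤ) (γ : ℝ → ℂ) : Prop where
  mem_class : γ ∈ genericClass jp jm s ω
  arclength : ∀ x, ‖deriv γ x‖ = 1
  gap : ENNReal.ofReal (2 * η) ≤ minGap γ
  straight : ∀ u ∈ doubleParams γ, ∃ a b : ℂ, ∀ x ∈ Ioo (u - η) (u + η), γ x = a + (x : ℂ) * b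

/-- The class `F(η, j±, s, ω)` as a set of curves. -/
def admissible (η : ℝ) (jp jm s ω : ℤ) : Set (ℝ → ℂ) := {γ | IsAdmissible η jp jm s ω γ}

/-- Curves of class `C^{1,1}`. -/
def C11 : Set (ℝ → ℂ) := {γ | ContDiff ℝ 1 γ ∧ ∃ K, LipschitzWith K (deriv γ)}

/-- `η₀` is a threshold below which the compartment `C` contains admissible curves of class
`C^{1,1}`. -/
def IsThreshold (jp jm s ω : ℤ) (C : Set (ℝ → ℂ)) (η₀ : ℝ) : Prop :=
  0 < η₀ ∧ η₀ < 1 ∧ ∀ η ∈ Ioc 0 η₀, (admissible η jp jm s ω ∩ C ∩ C11).Nonempty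

/-! ### The truncated tangent-point energy -/

/-- `Y_δ(γ)`: the part of the domain that is cut out around the double points. -/
def cutOut (γ : ℝ → ℂ) (δ : ℝ) : Set (ℝ × ℝ) :=
  {z | ∃ p ∈ doublePairs γ,
    (arcDist γ z.1 p.1 < δ ∧ arcDist γ z.2 p.2 < δ) ∨
    (arcDist γ z.1 p.2 < δ ∧ arcDist γ z.2 p.1 < δ)}

/-- The affine tangent line at the parameter `t`. -/
def tangentLine (γ : ℝ → ℂ) (t : ℝ) : Set ℂ := range fun r : ℝ => γ t + (r : ℂ) * deriv γ t

/-- The inverse of the tangent-point radius: `2 dist(ℓ(t), γ(s)) / |γ(t) - γ(s)|²`. -/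
noncomputable def invTangentPointRadius (γ : ℝ → ℂ) (t s : ℝ) : ℝ :=
  2 * Metric.infDist (γ s) (tangentLine γ t) / ‖γ t - γ s‖ ^ 2

/-- The truncated tangent-point energy `TP_{q,δ}`, with values in `[0,∞]`. -/
noncomputable def truncatedTP (q δ : ℝ) (γ : ℝ → ℂ) : ℝ≥0∞ :=
  ∫⁻ z in (Ico (0 : ℝ) 1 ×ˢ Ico (0 : ℝ) 1) \ cutOut γ δ,
    ENNReal.ofReal (invTangentPointRadius γ z.2 z.1 ^ q * (‖deriv γ z.1‖ * ‖deriv γ z.2‖))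

/-! ### Periodic fractional Sobolev spaces -/

/-- `g` is the weak derivative of `f` on `ℝ/ℤ`. -/
def IsWeakDeriv (f g : ℝ → ℂ) : Prop :=
  ∀ φ : ℝ → ℝ, ContDiff ℝ (⊤ : ℕ∞) φ → Function.Periodic φ 1 →
    ∫ x in (0 : ℝ)..1, deriv φ x • f x = - ∫ x in (0 : ℝ)..1, φ x • g x

/-- The `q`-th power of the periodic Gagliardo seminorm of order `σ`. -/
noncomputable def gagliardo (σ q : ℝ) (g : ℝ → ℂ) : ℝ≥0∞ :=
  ∫⁻ x in Ioc (0 : ℝ) 1, ∫⁻ w in Ioc (-(1 / 2) : ℝ) (1 / 2),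
    ENNReal.ofReal (‖g (x + w) - g x‖ ^ q / |w| ^ (1 + σ * q))

/-- The space `W^{1+σ,q}(ℝ/ℤ, ℝ²)` for `0 < σ < 1`: functions in `L^q` with a weak derivative
in `L^q` whose Gagliardo seminorm of order `σ` is finite. -/
def fractionalSobolev (σ q : ℝ) : Set (ℝ → ℂ) :=
  {f | Function.Periodic f 1 ∧
    MemLp f (ENNReal.ofReal q) (volume.restrict (Ioc (0 : ℝ) 1)) ∧
    ∃ g : ℝ → ℂ, Function.Periodic g 1 ∧
      MemLp g (ENNReal.ofReal q) (volume.restrict (Ioc (0 : ℝ) 1)) ∧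
      IsWeakDeriv f g ∧ gagliardo σ q g < ∞}

end PlaneCurve

/-!
The first half says that every generic immersion can be deformed, through generic immersions, into
one of class `C^{1,1}` and unit speed that is straight near its double points.  The derivative is
replaced by a Lipschitz approximation which is frozen to a constant within distance `ρ` of each
double parameter, and corrected to have mean zero.  This is a small change in `C¹`, so genericity
survives along the whole segment of curves (`IsGeneric.eventually_segment`).  In the uniform norm
the change is even `o(ρ)`, because the derivative is changed substantially on a set of measure
`O(ρ)` only; by transversality the double parameters then move by `o(ρ)`
(`IsGeneric.eventually_near`) and stay inside the straight pieces.  Reparametrising by arclength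
gives the admissible curves.  Winding number and Arnold invariants are constant along homotopies of
generic immersions, since these extend a generic path without adding crossings
(`HasArnoldInvariants.of_joined`); hence compartments absorb everything that is joined to them in
this way (`IsCompartment.mem_of_joined`).

The second half is the direct method.  Two tangents of a short arc differ by at most the length of
the arc times the two inverse tangent-point radii (`norm_deriv_sub_le`).  For `q > 2` a Morrey
estimate on dyadically shrinking intervals turns an energy bound into a uniform Hölder modulus of
the tangent (`exists_modulus`), and minimizing sequences, translated to start at the origin,
subconverge in `C¹` by Arzelà–Ascoli (`exists_C1_limit`).  The same pointwise bound gives the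
fractional Sobolev regularity (`mem_fractionalSobolev_of_energy`).

It remains to see that the limit is admissible and in the compartment.  Two branches at a small
distance `l` that are not cut out cost energy at least of the order `l ^ (2 - q)`, because the
shortest chord from a point is perpendicular to the tangent at its other end (`exists_separation`).
So every double point of the limit is a limit of double points; transversality cannot be lost
either, as parallel segments would overlap beyond the cut-out set, of radius `δ ≤ η / 2 < η`
(`IsEnergyBoundedLimit.cross_ne`, `IsEnergyBoundedLimit.exists_seq`).  Consequently the gap
condition and straightness pass to the limit and the limit is generic.  As genericity is an open
condition in `C¹`, the segment from a late curve of the sequence to the limit stays generic, and the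
limit is in the compartment.  The integrands converge off the diagonal, the other coincidences and
a null set, and Fatou's lemma shows that the limit is a minimizer.
-/

namespace PlaneCurve

/-! ### Distances on the circle and periodised double points -/

/-- The distance of a real number to the nearest integer, that is, the norm of its class
in `ℝ/ℤ`. -/
noncomputable def circ (z : ℝ) : ℝ := ‖(z : UnitAddCircle)‖

lemma circ_eq (z : ℝ) : circ z = |z - round z| := UnitAddCircle.norm_eq

lemma circ_nonneg (z : ℝ) : 0 ≤ circ z := norm_nonneg _

lemma circ_neg (z : ℝ) : circ (-z) = circ z := by
  unfold circ; rw [AddCircle.coe_neg, norm_neg]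

lemma circ_sub_comm (x y : ℝ) : circ (x - y) = circ (y - x) := by
  rw [← circ_neg, neg_sub]

lemma circ_add_int (z : ℝ) (k : ℤ) : circ (z + k) = circ z := by
  rw [circ_eq, circ_eq, round_add_intCast]; push_cast; congr 1; ring

lemma circ_sub_int (z : ℝ) (k : ℤ) : circ (z - k) = circ z := by
  have := circ_add_int z (-k); push_cast at this; rwa [← sub_eq_add_neg] at this

lemma circ_le_abs_sub (z : ℝ) (k : ℤ) : circ z ≤ |z - k| := by
  rw [circ_eq]; exact round_le z k

lemma circ_le_abs (z : ℝ) : circ z ≤ |z| := by simpa using circ_le_abs_sub z 0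

lemma circ_le_half (z : ℝ) : circ z ≤ 1 / 2 := by
  rw [circ_eq]; exact abs_sub_round z

lemma circ_eq_abs {z : ℝ} (h : |z| ≤ 1 / 2) : circ z = |z| := by
  unfold circ
  rw [AddCircle.norm_coe_eq_abs_iff 1 one_ne_zero]; simpa using h

lemma exists_circ_eq (z : ℝ) : ∃ k : ℤ, circ z = |z - k| := ⟨_, circ_eq z⟩

lemma circ_add_le (x y : ℝ) : circ (x + y) ≤ circ x + circ y := by
  unfold circ; rw [AddCircle.coe_add]; exact norm_add_le _ _

lemma circ_triangle (x y z : ℝ) : circ (x - z) ≤ circ (x - y) + circ (y - z) := by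
  have := circ_add_le (x - y) (y - z); simpa using this

lemma continuous_circ : Continuous circ := by
  unfold circ; exact continuous_norm.comp (AddCircle.continuous_mk' 1)

lemma circ_pos {z : ℝ} (h : ∀ k : ℤ, z ≠ k) : 0 < circ z := by
  rw [circ_eq, abs_pos, sub_ne_zero]; exact h _

lemma ne_int_of_circ_pos {z : ℝ} (h : 0 < circ z) (k : ℤ) : z ≠ k := by
  rintro rfl
  have := circ_le_abs_sub (k : ℝ) k
  simp at this; linarith

lemma iInf_abs_sub_int (z : ℝ) : ⨅ k : ℤ, |z - k| = circ z := by
  have hb : BddBelow (range fun k : ℤ => |z - k|) := ⟨0, by rintro _ ⟨k, rfl⟩; positivity⟩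
  refine le_antisymm ?_ (le_ciInf fun k => circ_le_abs_sub z k)
  rw [circ_eq]; exact ciInf_le hb (round z)

lemma circ_zero : circ 0 = 0 := by simp [circ]

lemma tendsto_circ {ι : Type*} {l : Filter ι} {f : ι → ℝ} {a : ℝ} (h : Tendsto f l (𝓝 a)) :
    Tendsto (fun i => circ (f i)) l (𝓝 (circ a)) := (continuous_circ.tendsto a).comp h

/-- `x` and `y` represent distinct parameters on `ℝ/ℤ` of a common point of `γ`. -/
def IsDouble (γ : ℝ → ℂ) (x y : ℝ) : Prop := γ x = γ y ∧ ∀ k : ℤ, x - y ≠ k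

section Basic

variable {γ : ℝ → ℂ}

lemma periodic_add_int (h : Function.Periodic γ 1) (x : ℝ) (k : ℤ) : γ (x + k) = γ x := by
  simpa using h.int_mul k x

lemma periodic_sub_int (h : Function.Periodic γ 1) (x : ℝ) (k : ℤ) : γ (x - k) = γ x := by
  have := periodic_add_int h (x - k) k; simpa using this.symm

lemma periodic_fract {α : Type*} {f : ℝ → α} (h : Function.Periodic f 1) (x : ℝ) :
    f (Int.fract x) = f x := by
  have := h.sub_int_mul_eq (x := x) ⌊x⌋
  simpa using this

lemma periodic_deriv (h : Function.Periodic γ 1) : Function.Periodic (deriv γ) 1 := by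
  intro x
  have h1 : (fun y => γ (y + 1)) = γ := funext h
  rw [← deriv_comp_add_const, h1]

lemma IsDouble.symm {x y : ℝ} (h : IsDouble γ x y) : IsDouble γ y x :=
  ⟨h.1.symm, fun k hk => h.2 (-k) (by push_cast; linarith)⟩

lemma IsDouble.add_int (hp : Function.Periodic γ 1) {x y : ℝ} (h : IsDouble γ x y) (k l : ℤ) :
    IsDouble γ (x + k) (y + l) := by
  refine ⟨by rw [periodic_add_int hp, periodic_add_int hp, h.1], fun m hm => ?_⟩
  exact h.2 (m - k + l) (by push_cast; linarith)

lemma IsDouble.fract (hp : Function.Periodic γ 1) {x y : ℝ} (h : IsDouble γ x y) :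
    IsDouble γ (Int.fract x) (Int.fract y) := by
  have := h.add_int hp (-⌊x⌋) (-⌊y⌋)
  push_cast at this
  simpa only [← sub_eq_add_neg, Int.self_sub_floor] using this

lemma sub_ne_int_of_mem_Ico {x y : ℝ} (hx : x ∈ Ico (0 : ℝ) 1) (hy : y ∈ Ico (0 : ℝ) 1)
    (h : x ≠ y) (k : ℤ) : x - y ≠ k := by
  intro hk
  have h1 : (k : ℝ) < 1 := by linarith [hx.2, hy.1]
  have h2 : (-1 : ℝ) < k := by linarith [hx.1, hy.2]
  have h3 : k < 1 := by exact_mod_cast h1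
  have h4 : -1 < k := by exact_mod_cast h2
  have : k = 0 := by omega
  subst this
  exact h (by simpa [sub_eq_zero] using hk)

lemma isDouble_of_mem {p : ℝ × ℝ} (h : p ∈ doublePairs γ) : IsDouble γ p.1 p.2 :=
  ⟨h.2.2.2, sub_ne_int_of_mem_Ico h.1 h.2.1 h.2.2.1.ne⟩

lemma IsDouble.ne {x y : ℝ} (h : IsDouble γ x y) : x ≠ y := by
  rintro rfl; exact h.2 0 (by simp)

lemma fract_mem_Ico (x : ℝ) : Int.fract x ∈ Ico (0 : ℝ) 1 :=
  ⟨Int.fract_nonneg x, Int.fract_lt_one x⟩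

lemma IsDouble.mem_or (hp : Function.Periodic γ 1) {x y : ℝ} (h : IsDouble γ x y) :
    (Int.fract x, Int.fract y) ∈ doublePairs γ ∨ (Int.fract y, Int.fract x) ∈ doublePairs γ := by
  have h' := h.fract hp
  rcases lt_or_gt_of_ne h'.ne with hlt | hlt
  · exact Or.inl ⟨fract_mem_Ico _, fract_mem_Ico _, hlt, h'.1⟩
  · exact Or.inr ⟨fract_mem_Ico _, fract_mem_Ico _, hlt, h'.1.symm⟩

lemma mem_doubleParams_iff (hp : Function.Periodic γ 1) {u : ℝ} :
    u ∈ doubleParams γ ↔ u ∈ Ico (0 : ℝ) 1 ∧ ∃ v, IsDouble γ u v := by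
  constructor
  · rintro ⟨p, hpm, rfl | rfl⟩
    · exact ⟨hpm.1, p.2, isDouble_of_mem hpm⟩
    · exact ⟨hpm.2.1, p.1, (isDouble_of_mem hpm).symm⟩
  · rintro ⟨hu, v, hv⟩
    have hf : Int.fract u = u := Int.fract_eq_self.2 hu
    rcases hv.mem_or hp with h | h
    · exact ⟨_, h, Or.inl hf.symm⟩
    · exact ⟨_, h, Or.inr hf.symm⟩

lemma cross_swap (a b : ℂ) : cross a b = -cross b a := by unfold cross; ring

lemma circ_sub_fract (a b : ℝ) : circ (a - Int.fract b) = circ (a - b) := by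
  rw [← circ_sub_int _ ⌊b⌋]; congr 1; unfold Int.fract; ring

/-- Genericity in terms of all real parameters instead of representatives in `[0,1)`. -/
lemma isGeneric_iff : IsGeneric γ ↔ IsImmersion γ ∧
    (∀ x y, IsDouble γ x y → cross (deriv γ x) (deriv γ y) ≠ 0) ∧
    (∀ x y z, IsDouble γ x y → IsDouble γ y z → ¬ IsDouble γ x z) := by
  constructor
  · intro h
    have hp := h.immersion.periodic
    have hp' := periodic_deriv hp
    refine ⟨h.immersion, fun x y hxy => ?_, fun x y z hxy hyz hxz => ?_⟩
    · rcases hxy.mem_or hp with h1 | h1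
      · have := h.transverse _ h1
        simpa only [TransverseAt, periodic_fract hp'] using this
      · have := h.transverse _ h1
        simp only [TransverseAt, periodic_fract hp'] at this
        rw [cross_swap]; exact neg_ne_zero.2 this
    · have hT : ∀ a b c, IsDouble γ a b → IsDouble γ b c → Int.fract a < Int.fract b →
          Int.fract b < Int.fract c → False := fun a b c hab hbc h1 h2 =>
        h.no_triple _ _ _ ⟨Int.fract_nonneg a, h1, h2, Int.fract_lt_one c,
          (hab.fract hp).1, (hbc.fract hp).1⟩
      have n1 := (hxy.fract hp).ne
      have n2 := (hyz.fract hp).ne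
      have n3 := (hxz.fract hp).ne
      rcases lt_or_gt_of_ne n1 with a | a <;> rcases lt_or_gt_of_ne n2 with b | b <;>
        rcases lt_or_gt_of_ne n3 with c | c
      · exact hT _ _ _ hxy hyz a b
      · linarith
      · exact hT _ _ _ hxz hyz.symm c b
      · exact hT _ _ _ hxz.symm hxy c a
      · exact hT _ _ _ hxy.symm hxz a c
      · exact hT _ _ _ hyz hxz.symm b c
      · linarith
      · exact hT _ _ _ hyz.symm hxy.symm b a
  · rintro ⟨him, ht, h3⟩
    refine ⟨him, fun p hpm => ht _ _ (isDouble_of_mem hpm), ?_⟩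
    rintro x y z ⟨h0, hxy, hyz, h1, e1, e2⟩
    have mx : x ∈ Ico (0 : ℝ) 1 := ⟨h0, by linarith⟩
    have my : y ∈ Ico (0 : ℝ) 1 := ⟨by linarith, by linarith⟩
    have mz : z ∈ Ico (0 : ℝ) 1 := ⟨by linarith, h1⟩
    exact h3 x y z ⟨e1, sub_ne_int_of_mem_Ico mx my hxy.ne⟩
      ⟨e2, sub_ne_int_of_mem_Ico my mz hyz.ne⟩
      ⟨e1.trans e2, sub_ne_int_of_mem_Ico mx mz (hxy.trans hyz).ne⟩

/-- The double points of `γ` are transverse. -/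
lemma IsGeneric.cross_ne (h : IsGeneric γ) {x y : ℝ} (hxy : IsDouble γ x y) :
    cross (deriv γ x) (deriv γ y) ≠ 0 := (isGeneric_iff.1 h).2.1 x y hxy

lemma IsGeneric.not_isDouble (h : IsGeneric γ) {x y z : ℝ} (hxy : IsDouble γ x y)
    (hyz : IsDouble γ y z) : ¬ IsDouble γ x z := (isGeneric_iff.1 h).2.2 x y z hxy hyz

/-- Two partners of the same double parameter agree on `ℝ/ℤ`. -/
lemma IsGeneric.partner_unique (h : IsGeneric γ) {x y z : ℝ} (hxy : IsDouble γ x y)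
    (hxz : IsDouble γ x z) : ∃ k : ℤ, y - z = k := by
  by_contra hk
  push Not at hk
  exact h.not_isDouble hxy.symm hxz ⟨hxy.1.symm.trans hxz.1, hk⟩

/-! ### Admissibility and the cut-out set for curves of unit speed -/

lemma IsImmersion.differentiable (h : IsImmersion γ) : Differentiable ℝ γ :=
  h.contDiff.differentiable one_ne_zero

lemma IsImmersion.continuous_deriv (h : IsImmersion γ) : Continuous (deriv γ) :=
  h.contDiff.continuous_deriv le_rfl

lemma arcDist_eq (hs : ∀ x, ‖deriv γ x‖ = 1) (x y : ℝ) : arcDist γ x y = circ (x - y) := by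
  unfold arcDist
  rw [← iInf_abs_sub_int]
  refine iInf_congr fun k => ?_
  simp only [hs, intervalIntegral.integral_const, smul_eq_mul, mul_one]
  rw [← abs_neg]; congr 1; ring

lemma le_minGap_iff (hp : Function.Periodic γ 1) (hs : ∀ x, ‖deriv γ x‖ = 1) {r : ℝ} :
    ENNReal.ofReal r ≤ minGap γ ↔ ∀ a b a' b', IsDouble γ a a' → IsDouble γ b b' →
      (∀ k : ℤ, a - b ≠ k) → r ≤ circ (a - b) := by
  unfold minGap
  simp only [le_iInf_iff, arcDist_eq hs]
  constructor
  · intro h a b a' b' ha hb hab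
    have hfa := (mem_doubleParams_iff hp).2 ⟨fract_mem_Ico a, _, ha.fract hp⟩
    have hfb := (mem_doubleParams_iff hp).2 ⟨fract_mem_Ico b, _, hb.fract hp⟩
    have hne : Int.fract a ≠ Int.fract b := by
      intro e
      obtain ⟨k, hk⟩ := Int.fract_eq_fract.1 e
      exact hab k hk
    have := h _ hfa _ hfb hne
    rw [ENNReal.ofReal_le_ofReal_iff (circ_nonneg _)] at this
    refine this.trans_eq ?_
    have e : Int.fract a - Int.fract b = a - b + ((⌊b⌋ - ⌊a⌋ : ℤ) : ℝ) := by
      push_cast; unfold Int.fract; ring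
    rw [e, circ_add_int]
  · intro h a ha b hb hne
    obtain ⟨ha1, a', ha'⟩ := (mem_doubleParams_iff hp).1 ha
    obtain ⟨hb1, b', hb'⟩ := (mem_doubleParams_iff hp).1 hb
    exact ENNReal.ofReal_le_ofReal (h a b a' b' ha' hb' (sub_ne_int_of_mem_Ico ha1 hb1 hne))

lemma mem_cutOut_iff (hp : Function.Periodic γ 1) (hs : ∀ x, ‖deriv γ x‖ = 1) {δ : ℝ}
    {z : ℝ × ℝ} : z ∈ cutOut γ δ ↔
      ∃ u v, IsDouble γ u v ∧ circ (z.1 - u) < δ ∧ circ (z.2 - v) < δ := by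
  unfold cutOut
  simp only [mem_ofPred_eq, arcDist_eq hs]
  constructor
  · rintro ⟨p, hpm, h | h⟩
    · exact ⟨p.1, p.2, isDouble_of_mem hpm, h⟩
    · exact ⟨p.2, p.1, (isDouble_of_mem hpm).symm, h⟩
  · rintro ⟨u, v, huv, h1, h2⟩
    rcases huv.mem_or hp with h | h
    · exact ⟨_, h, Or.inl (by simpa only [circ_sub_fract] using ⟨h1, h2⟩)⟩
    · exact ⟨_, h, Or.inr (by simpa only [circ_sub_fract] using ⟨h1, h2⟩)⟩

lemma straight_iff (hi : IsImmersion γ) {η : ℝ} (hη : 0 < η) :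
    (∀ u ∈ doubleParams γ, ∃ a b : ℂ, ∀ x ∈ Ioo (u - η) (u + η), γ x = a + (x : ℂ) * b) ↔
    ∀ u v, IsDouble γ u v → ∀ x, |x - u| < η → γ x = γ u + ((x - u : ℝ) : ℂ) * deriv γ u := by
  have hp := hi.periodic
  constructor
  · intro h u v huv x hx
    obtain ⟨a, b, hab⟩ := h _ ((mem_doubleParams_iff hp).2 ⟨fract_mem_Ico u, _, huv.fract hp⟩)
    have hev : ∀ y, |y - u| < η → γ y = (a - ⌊u⌋ * b) + (y : ℂ) * b := by
      intro y hy
      rw [abs_lt] at hy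
      have := hab (y - ⌊u⌋) (by unfold Int.fract; constructor <;> linarith)
      rw [periodic_sub_int hp] at this
      rw [this]; push_cast; ring
    have hd : deriv γ u = b := by
      have h1 : γ =ᶠ[𝓝 u] fun y : ℝ => (a - ⌊u⌋ * b) + (y : ℂ) * b := by
        filter_upwards [Metric.ball_mem_nhds u hη] with y hy
        exact hev y (by simpa [Real.dist_eq] using hy)
      rw [h1.deriv_eq]
      have h2 : HasDerivAt (fun y : ℝ => (a - ⌊u⌋ * b) + (y : ℂ) * b) (1 * b) u :=
        ((HasDerivAt.ofReal_comp (hasDerivAt_id u)).mul_const b).const_add _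
      simpa using h2.deriv
    rw [hev x hx, hev u (by simpa using hη), hd]; push_cast; ring
  · intro h u hu
    obtain ⟨_, v, huv⟩ := (mem_doubleParams_iff hp).1 hu
    refine ⟨γ u - u * deriv γ u, deriv γ u, fun x hx => ?_⟩
    rw [h u v huv x (by rw [abs_lt]; constructor <;> linarith [hx.1, hx.2])]
    push_cast; ring

end Basic

/-! ### Convergence in `C¹` and stability of double points -/

/-- Uniform convergence of a sequence of curves together with their derivatives. -/
structure C1Tendsto (β : ℕ → ℝ → ℂ) (γ : ℝ → ℂ) : Prop where
  unif : TendstoUniformly β γ atTop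
  unif_deriv : TendstoUniformly (fun n => deriv (β n)) (deriv γ) atTop

section Convergence

variable {γ : ℝ → ℂ} {β : ℕ → ℝ → ℂ}

lemma C1Tendsto.subseq (h : C1Tendsto β γ) {φ : ℕ → ℕ} (hφ : Tendsto φ atTop atTop) :
    C1Tendsto (fun n => β (φ n)) γ :=
  ⟨fun u hu => hφ.eventually (h.unif u hu), fun u hu => hφ.eventually (h.unif_deriv u hu)⟩

lemma C1Tendsto.const (γ : ℝ → ℂ) : C1Tendsto (fun _ => γ) γ :=
  ⟨fun _ hu => Eventually.of_forall fun _ _ => refl_mem_uniformity hu,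
    fun _ hu => Eventually.of_forall fun _ _ => refl_mem_uniformity hu⟩

lemma C1Tendsto.slope (h : C1Tendsto β γ) (hβ : ∀ n, Differentiable ℝ (β n))
    (hc : Continuous (deriv γ)) {X Y : ℕ → ℝ} {x : ℝ} (hX : Tendsto X atTop (𝓝 x))
    (hY : Tendsto Y atTop (𝓝 x)) {ε : ℝ} (hε : 0 < ε) :
    ∀ᶠ n in atTop, ‖β n (X n) - β n (Y n) - ((X n - Y n : ℝ) : ℂ) * deriv γ x‖
      ≤ ε * |X n - Y n| := by
  obtain ⟨r, hr, hr'⟩ := Metric.continuousAt_iff.1 (hc.continuousAt (x := x)) (ε / 2)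
    (by positivity)
  have h1 := Metric.tendstoUniformly_iff.1 h.unif_deriv (ε / 2) (by positivity)
  filter_upwards [h1, hX (Metric.ball_mem_nhds x hr), hY (Metric.ball_mem_nhds x hr)]
    with n hn hXn hYn
  have hd : ∀ z ∈ Metric.ball x r, HasDerivWithinAt (fun z : ℝ => β n z - (z : ℂ) * deriv γ x)
      (deriv (β n) z - 1 * deriv γ x) (Metric.ball x r) z := fun z _ =>
    ((hβ n z).hasDerivAt.sub
      ((HasDerivAt.ofReal_comp (hasDerivAt_id z)).mul_const _)).hasDerivWithinAt
  have hb : ∀ z ∈ Metric.ball x r, ‖deriv (β n) z - 1 * deriv γ x‖ ≤ ε := by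
    intro z hz
    have a1 := hn z
    have a2 := hr' hz
    rw [dist_comm, dist_eq_norm] at a1
    rw [dist_eq_norm] at a2
    calc ‖deriv (β n) z - 1 * deriv γ x‖
        = ‖(deriv (β n) z - deriv γ z) + (deriv γ z - deriv γ x)‖ := by congr 1; ring
      _ ≤ _ := norm_add_le _ _
      _ ≤ ε := by linarith
  have := Convex.norm_image_sub_le_of_norm_hasDerivWithin_le hd hb (convex_ball x r) hYn hXn
  rw [Real.norm_eq_abs] at this
  refine le_trans (le_of_eq ?_) this
  congr 1; push_cast; ring

/-- Limits of distinct parameters of a common point cannot coincide. -/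
lemma C1Tendsto.eventually_eq (h : C1Tendsto β γ) (hβ : ∀ n, Differentiable ℝ (β n))
    (hγ : IsImmersion γ) {X Y : ℕ → ℝ} {x : ℝ} (hX : Tendsto X atTop (𝓝 x))
    (hY : Tendsto Y atTop (𝓝 x)) (he : ∀ n, β n (X n) = β n (Y n)) :
    ∀ᶠ n in atTop, X n = Y n := by
  have hpos : 0 < ‖deriv γ x‖ := norm_pos_iff.2 (hγ.deriv_ne_zero x)
  filter_upwards [h.slope hβ hγ.continuous_deriv hX hY (half_pos hpos)] with n hn
  rw [he n, sub_self, zero_sub, norm_neg, norm_mul, Complex.norm_real, Real.norm_eq_abs] at hn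
  have : |X n - Y n| ≤ 0 := by nlinarith [abs_nonneg (X n - Y n)]
  exact sub_eq_zero.1 (abs_nonpos_iff.1 this)

lemma norm_cross_le (a b : ℂ) : |cross a b| ≤ ‖a‖ * ‖b‖ := by
  have h : cross a b = ((starRingEnd ℂ) a * b).im := by
    unfold cross; simp [Complex.mul_im]; ring
  rw [h, ← Complex.norm_conj a, ← norm_mul]
  exact Complex.abs_im_le_norm _

lemma exists_le_norm_sub_of_cross_ne {e f : ℂ} (h : cross e f ≠ 0) :
    ∃ c > 0, ∀ a b : ℝ, c * (|a| + |b|) ≤ ‖(a : ℂ) * e - (b : ℂ) * f‖ := by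
  have he : 0 < ‖e‖ := norm_pos_iff.2 (by rintro rfl; simp [cross] at h)
  have hf : 0 < ‖f‖ := norm_pos_iff.2 (by rintro rfl; simp [cross] at h)
  have hc : 0 < |cross e f| := abs_pos.2 h
  refine ⟨|cross e f| / (‖e‖ + ‖f‖), by positivity, fun a b => ?_⟩
  have h1 : |a| * |cross e f| ≤ ‖(a : ℂ) * e - (b : ℂ) * f‖ * ‖f‖ := by
    rw [← abs_mul]
    refine le_trans (le_of_eq ?_) (norm_cross_le _ _)
    congr 1; unfold cross; simp; ring
  have h2 : |b| * |cross e f| ≤ ‖(a : ℂ) * e - (b : ℂ) * f‖ * ‖e‖ := by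
    rw [← abs_mul]
    refine le_trans (le_of_eq ?_) (norm_cross_le _ _)
    congr 1; unfold cross; simp; ring
  rw [div_mul_eq_mul_div, div_le_iff₀ (by positivity)]
  nlinarith

/-- Two transverse branches separate linearly, uniformly along a `C¹`-convergent sequence. -/
lemma C1Tendsto.two_branches (h : C1Tendsto β γ) (hβ : ∀ n, Differentiable ℝ (β n))
    (hc : Continuous (deriv γ)) {X X' Y Y' : ℕ → ℝ} {x y : ℝ}
    (hX : Tendsto X atTop (𝓝 x)) (hX' : Tendsto X' atTop (𝓝 x))
    (hY : Tendsto Y atTop (𝓝 y)) (hY' : Tendsto Y' atTop (𝓝 y))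
    (ht : cross (deriv γ x) (deriv γ y) ≠ 0) :
    ∃ c > 0, ∀ᶠ n in atTop, c * (|X n - X' n| + |Y n - Y' n|) ≤
      ‖(β n (X n) - β n (X' n)) - (β n (Y n) - β n (Y' n))‖ := by
  obtain ⟨c, hc0, hcb⟩ := exists_le_norm_sub_of_cross_ne ht
  refine ⟨c / 2, by positivity, ?_⟩
  filter_upwards [h.slope hβ hc hX hX' (half_pos hc0), h.slope hβ hc hY hY' (half_pos hc0)]
    with n h1 h2
  have h3 := hcb (X n - X' n) (Y n - Y' n)
  set A := β n (X n) - β n (X' n)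
  set B := β n (Y n) - β n (Y' n)
  set P := ((X n - X' n : ℝ) : ℂ) * deriv γ x
  set Q := ((Y n - Y' n : ℝ) : ℂ) * deriv γ y
  have h4 : ‖P - Q‖ ≤ ‖A - B‖ + ‖A - P‖ + ‖B - Q‖ := by
    have : P - Q = (A - B) - (A - P) + (B - Q) := by ring
    rw [this]
    exact (norm_add_le _ _).trans (by gcongr; exact norm_sub_le _ _)
  linarith

lemma C1Tendsto.isDouble_of_tendsto (h : C1Tendsto β γ) (hβ : ∀ n, IsImmersion (β n))
    (hγ : IsImmersion γ) {X Y : ℕ → ℝ} {x y : ℝ} (hX : Tendsto X atTop (𝓝 x))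
    (hY : Tendsto Y atTop (𝓝 y)) (hd : ∀ n, IsDouble (β n) (X n) (Y n)) : IsDouble γ x y := by
  have hcont := hγ.differentiable.continuous
  refine ⟨tendsto_nhds_unique (h.unif.tendsto_comp hcont.continuousAt hX)
    ((h.unif.tendsto_comp hcont.continuousAt hY).congr fun n => (hd n).1.symm), fun k hk => ?_⟩
  have hY2 : Tendsto (fun n => Y n + (k : ℝ)) atTop (𝓝 x) := by
    have := hY.add_const (k : ℝ); rwa [show y + (k : ℝ) = x by linarith] at this
  have he : ∀ n, β n (X n) = β n (Y n + k) := fun n => by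
    rw [periodic_add_int (hβ n).periodic, (hd n).1]
  obtain ⟨n, hn⟩ := (h.eventually_eq (fun n => (hβ n).differentiable) hγ hX hY2 he).exists
  exact (hd n).2 k (by rw [hn]; ring)

lemma exists_subseq_fract (X : ℕ → ℝ) :
    ∃ x, ∃ φ : ℕ → ℕ, StrictMono φ ∧ Tendsto (fun n => Int.fract (X (φ n))) atTop (𝓝 x) := by
  obtain ⟨x, -, φ, hφ, hx⟩ := (isCompact_Icc (a := (0 : ℝ)) (b := 1)).tendsto_subseq
    (x := fun n => Int.fract (X n))
    (fun n => ⟨Int.fract_nonneg _, (Int.fract_lt_one _).le⟩)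
  exact ⟨x, φ, hφ, hx⟩

/-- Double points subconverge, modulo integers, to a double point of the limit. -/
lemma C1Tendsto.exists_subseq (h : C1Tendsto β γ) (hβ : ∀ n, IsImmersion (β n))
    (hγ : IsImmersion γ) {X Y : ℕ → ℝ} (hd : ∀ n, IsDouble (β n) (X n) (Y n)) :
    ∃ x y, ∃ φ : ℕ → ℕ, StrictMono φ ∧ IsDouble γ x y ∧
      Tendsto (fun n => Int.fract (X (φ n))) atTop (𝓝 x) ∧
      Tendsto (fun n => Int.fract (Y (φ n))) atTop (𝓝 y) := by
  obtain ⟨x, φ, hφ, hx⟩ := exists_subseq_fract X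
  obtain ⟨y, ψ, hψ, hy⟩ := exists_subseq_fract fun n => Y (φ n)
  have hx' := hx.comp hψ.tendsto_atTop
  exact ⟨x, y, φ ∘ ψ, hφ.comp hψ, (h.subseq (hφ.comp hψ).tendsto_atTop).isDouble_of_tendsto
    (fun n => hβ _) hγ hx' hy (fun n => (hd _).fract (hβ _).periodic), hx', hy⟩

lemma continuous_cross : Continuous fun p : ℂ × ℂ => cross p.1 p.2 := by
  unfold cross; fun_prop

/-- Genericity is an open condition in `C¹`. -/
theorem IsGeneric.eventually (hγ : IsGeneric γ) (h : C1Tendsto β γ)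
    (hβ : ∀ n, IsImmersion (β n)) : ∀ᶠ n in atTop, IsGeneric (β n) := by
  have hi := hγ.immersion
  have hc := hi.continuous_deriv
  have h1 : ∀ᶠ n in atTop, ∀ x y, IsDouble (β n) x y →
      cross (deriv (β n) x) (deriv (β n) y) ≠ 0 := by
    by_contra hcon
    obtain ⟨φ, hφ, hbad⟩ := extraction_of_frequently_atTop (not_eventually.1 hcon)
    push Not at hbad
    choose X Y hd hX using hbad
    have hφ' := h.subseq hφ.tendsto_atTop
    obtain ⟨x, y, ψ, hψ, hxy, hx, hy⟩ := hφ'.exists_subseq (fun n => hβ _) hi hd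
    have h2 := hφ'.subseq hψ.tendsto_atTop
    have l1 := h2.unif_deriv.tendsto_comp hc.continuousAt hx
    have l2 := h2.unif_deriv.tendsto_comp hc.continuousAt hy
    have l3 := (continuous_cross.tendsto _).comp (l1.prodMk_nhds l2)
    refine hγ.cross_ne hxy (tendsto_nhds_unique l3 (tendsto_const_nhds.congr fun n => ?_))
    have hp := periodic_deriv (hβ (φ (ψ n))).periodic
    simp only [Function.comp, periodic_fract hp]
    exact (hX _).symm
  have h2 : ∀ᶠ n in atTop, ∀ x y z, IsDouble (β n) x y → IsDouble (β n) y z →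
      ¬ IsDouble (β n) x z := by
    by_contra hcon
    obtain ⟨φ, hφ, hbad⟩ := extraction_of_frequently_atTop (not_eventually.1 hcon)
    push Not at hbad
    choose X Y Z hXY hYZ hXZ using hbad
    have hφ' := h.subseq hφ.tendsto_atTop
    obtain ⟨x, y, ψ, hψ, hxy, hx, hy⟩ := hφ'.exists_subseq (fun n => hβ _) hi hXY
    obtain ⟨z, χ, hχ, hz⟩ := exists_subseq_fract fun n => Z (ψ n)
    have h3 := (hφ'.subseq hψ.tendsto_atTop).subseq hχ.tendsto_atTop
    have hx' := hx.comp hχ.tendsto_atTop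
    have hy' := hy.comp hχ.tendsto_atTop
    exact hγ.not_isDouble hxy
      (h3.isDouble_of_tendsto (fun n => hβ _) hi hy' hz fun n => (hYZ _).fract (hβ _).periodic)
      (h3.isDouble_of_tendsto (fun n => hβ _) hi hx' hz fun n => (hXZ _).fract (hβ _).periodic)
  filter_upwards [h1, h2] with n a b
  exact isGeneric_iff.2 ⟨hβ n, a, b⟩

lemma IsImmersion.exists_le_norm_deriv (hγ : IsImmersion γ) :
    ∃ m > 0, ∀ x, m ≤ ‖deriv γ x‖ := by
  obtain ⟨x, -, hx⟩ := (isCompact_Icc (a := (0 : ℝ)) (b := 1)).exists_isMinOn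
    (by simp) hγ.continuous_deriv.norm.continuousOn
  refine ⟨‖deriv γ x‖, norm_pos_iff.2 (hγ.deriv_ne_zero x), fun y => ?_⟩
  rw [← periodic_fract (periodic_deriv hγ.periodic) y]
  exact hx ⟨Int.fract_nonneg _, (Int.fract_lt_one _).le⟩

/-- The segment from `α` to `β` in the space of curves. -/
noncomputable def segment (α β : ℝ → ℂ) (t : ℝ) (x : ℝ) : ℂ := (1 - t : ℝ) • α x + t • β x

lemma hasDerivAt_segment {α β : ℝ → ℂ} (hα : Differentiable ℝ α) (hβ : Differentiable ℝ β)
    (t x : ℝ) : HasDerivAt (segment α β t) ((1 - t : ℝ) • deriv α x + t • deriv β x) x :=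
  ((hα x).hasDerivAt.const_smul (1 - t)).add ((hβ x).hasDerivAt.const_smul t)

lemma deriv_segment {α β : ℝ → ℂ} (hα : Differentiable ℝ α) (hβ : Differentiable ℝ β)
    (t : ℝ) : deriv (segment α β t) = segment (deriv α) (deriv β) t :=
  funext fun x => (hasDerivAt_segment hα hβ t x).deriv

lemma norm_segment_sub_le {α β : ℝ → ℂ} {t : ℝ} (ht : t ∈ Icc (0 : ℝ) 1) (x : ℝ) :
    ‖segment α β t x - β x‖ ≤ ‖α x - β x‖ := by
  have : segment α β t x - β x = (1 - t : ℝ) • (α x - β x) := by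
    unfold segment; simp only [Complex.real_smul]; push_cast; ring
  rw [this, norm_smul, Real.norm_eq_abs, abs_of_nonneg (by linarith [ht.2])]
  exact mul_le_of_le_one_left (norm_nonneg _) (by linarith [ht.1])

lemma contDiff_segment {α β : ℝ → ℂ} (hα : ContDiff ℝ 1 α) (hβ : ContDiff ℝ 1 β) (t : ℝ) :
    ContDiff ℝ 1 (segment α β t) := by
  unfold segment; fun_prop

/-- Near a generic immersion the straight homotopy runs through generic immersions. -/
theorem IsGeneric.eventually_segment (hγ : IsGeneric γ) (h : C1Tendsto β γ)
    (hβ : ∀ n, ContDiff ℝ 1 (β n)) (hp : ∀ n, Function.Periodic (β n) 1) :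
    ∀ᶠ n in atTop, ∀ t ∈ Icc (0 : ℝ) 1, IsGeneric (segment (β n) γ t) := by
  have hi := hγ.immersion
  obtain ⟨m, hm, hmle⟩ := hi.exists_le_norm_deriv
  have hd : ∀ n, Differentiable ℝ (β n) := fun n => (hβ n).differentiable one_ne_zero
  have himm : ∀ᶠ n in atTop, ∀ t ∈ Icc (0 : ℝ) 1, IsImmersion (segment (β n) γ t) := by
    filter_upwards [Metric.tendstoUniformly_iff.1 h.unif_deriv m hm] with n hn t ht
    refine ⟨contDiff_segment (hβ n) hi.contDiff t, fun x => ?_, fun x h0 => ?_⟩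
    · simp only [segment, hp n x, hi.periodic x]
    · rw [deriv_segment (hd n) hi.differentiable] at h0
      have h1 := norm_segment_sub_le (α := deriv (β n)) (β := deriv γ) ht x
      have h2 := hn x
      rw [dist_comm, dist_eq_norm] at h2
      rw [h0, zero_sub, norm_neg] at h1
      linarith [hmle x]
  by_contra hcon
  obtain ⟨φ, hφ, hbad⟩ := extraction_of_frequently_atTop
    ((not_eventually.1 hcon).and_eventually himm)
  have hbad1 : ∀ n, ∃ t ∈ Icc (0 : ℝ) 1, ¬ IsGeneric (segment (β (φ n)) γ t) := fun n => by
    have := (hbad n).1; push Not at this; exact this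
  choose t ht htb using hbad1
  have hs := h.subseq hφ.tendsto_atTop
  have hconv : C1Tendsto (fun n => segment (β (φ n)) γ (t n)) γ := by
    refine ⟨Metric.tendstoUniformly_iff.2 fun ε hε => ?_,
      Metric.tendstoUniformly_iff.2 fun ε hε => ?_⟩
    · filter_upwards [Metric.tendstoUniformly_iff.1 hs.unif ε hε] with n hn x
      have h2 := hn x
      rw [dist_comm, dist_eq_norm] at h2 ⊢
      exact (norm_segment_sub_le (ht n) x).trans_lt h2
    · filter_upwards [Metric.tendstoUniformly_iff.1 hs.unif_deriv ε hε] with n hn x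
      have h2 := hn x
      rw [dist_comm, dist_eq_norm] at h2 ⊢
      rw [deriv_segment (hd _) hi.differentiable]
      exact (norm_segment_sub_le (ht n) x).trans_lt h2
  obtain ⟨n, hn⟩ := (hγ.eventually hconv fun n => (hbad n).2 _ (ht n)).exists
  exact htb n hn

/-- The double parameters of a generic immersion are separated. -/
theorem IsGeneric.exists_gap (hγ : IsGeneric γ) : ∃ g > 0, ∀ a b a' b', IsDouble γ a a' →
    IsDouble γ b b' → (∀ k : ℤ, a - b ≠ k) → g ≤ circ (a - b) := by
  by_contra hcon
  push Not at hcon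
  have hi := hγ.immersion
  have hp := hi.periodic
  -- otherwise distinct double parameters `A n`, `B n` approach each other; by uniqueness of the
  -- partner, so do the partners `A' n`, `B' n`, which contradicts transversality
  choose A B A' B' hA hB hAB hlt using fun n : ℕ => hcon (1 / ((n : ℝ) + 1)) (by positivity)
  have hcst := C1Tendsto.const γ
  obtain ⟨x, y, φ, hφ, hxy, hx, hy⟩ := hcst.exists_subseq (fun _ => hi) hi hA
  obtain ⟨z, ψ, hψ, hz⟩ := exists_subseq_fract fun n => B' (φ n)
  choose k hk using fun n : ℕ => exists_circ_eq (Int.fract (A (φ (ψ n))) - B (φ (ψ n)))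
  have hcirc : ∀ n, circ (Int.fract (A n) - B n) = circ (A n - B n) := fun n => by
    rw [← circ_sub_int (A n - B n) ⌊A n⌋]; congr 1; unfold Int.fract; ring
  have hx' : Tendsto (fun n => Int.fract (A (φ (ψ n)))) atTop (𝓝 x) := hx.comp hψ.tendsto_atTop
  have hy' : Tendsto (fun n => Int.fract (A' (φ (ψ n)))) atTop (𝓝 y) := hy.comp hψ.tendsto_atTop
  have hbx : Tendsto (fun n => B (φ (ψ n)) + k n) atTop (𝓝 x) := by
    have h0 : Tendsto (fun n => Int.fract (A (φ (ψ n))) - (B (φ (ψ n)) + k n)) atTop (𝓝 0) := by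
      refine squeeze_zero_norm (fun n => ?_)
        (tendsto_one_div_add_atTop_nhds_zero_nat.comp (hφ.comp hψ).tendsto_atTop)
      rw [Real.norm_eq_abs, ← sub_sub, ← hk n, hcirc]
      exact (hlt _).le
    have := hx'.sub h0
    simpa using this
  have hB2 : ∀ n, IsDouble γ (B (φ (ψ n)) + k n) (Int.fract (B' (φ (ψ n)))) := fun n => by
    have := (hB (φ (ψ n))).add_int hp (k n) (-⌊B' (φ (ψ n))⌋)
    push_cast at this
    simpa only [← sub_eq_add_neg, Int.self_sub_floor] using this
  have hxz : IsDouble γ x z := hcst.isDouble_of_tendsto (fun _ => hi) hi hbx hz hB2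
  obtain ⟨l, hl⟩ := hγ.partner_unique hxy hxz
  have hz' : Tendsto (fun n => Int.fract (B' (φ (ψ n))) + (l : ℝ)) atTop (𝓝 y) := by
    have := hz.add_const (l : ℝ); rwa [show z + (l : ℝ) = y by linarith] at this
  obtain ⟨c, hc, hev⟩ := hcst.two_branches (fun _ => hi.differentiable) hi.continuous_deriv
    hx' hbx hy' hz' (hγ.cross_ne hxy)
  obtain ⟨n, hn⟩ := hev.exists
  have e1 : γ (Int.fract (A (φ (ψ n)))) = γ (Int.fract (A' (φ (ψ n)))) := ((hA _).fract hp).1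
  have e2 : γ (B (φ (ψ n)) + k n) = γ (Int.fract (B' (φ (ψ n))) + l) := by
    rw [periodic_add_int hp (Int.fract _) l]; exact (hB2 n).1
  rw [e1, e2, sub_self, norm_zero] at hn
  have h0 : |Int.fract (A (φ (ψ n))) - (B (φ (ψ n)) + k n)| = 0 := by
    have n1 := abs_nonneg (Int.fract (A (φ (ψ n))) - (B (φ (ψ n)) + k n))
    have n2 := abs_nonneg (Int.fract (A' (φ (ψ n))) - (Int.fract (B' (φ (ψ n))) + l))
    nlinarith
  rw [← sub_sub, ← hk n, hcirc] at h0
  have := circ_pos (hAB (φ (ψ n)))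
  linarith

/-- Under `C¹`-convergence the displacement of the double points is controlled by the uniform
distance of the curves alone. -/
theorem IsGeneric.eventually_near (hγ : IsGeneric γ) (h : C1Tendsto β γ)
    (hβ : ∀ n, IsImmersion (β n)) {E R : ℕ → ℝ} (hE : ∀ n x, ‖β n x - γ x‖ ≤ E n)
    (hR : ∀ n, 0 < R n) (hER : Tendsto (fun n => E n / R n) atTop (𝓝 0)) :
    ∀ᶠ n in atTop, ∀ x y, IsDouble (β n) x y → ∃ u v, IsDouble γ u v ∧ |x - u| ≤ R n := by
  by_contra hcon
  obtain ⟨φ, hφ, hbad⟩ := extraction_of_frequently_atTop (not_eventually.1 hcon)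
  push Not at hbad
  have hi := hγ.immersion
  have hp := hi.periodic
  choose X Y hd hX using hbad
  obtain ⟨x, y, ψ, hψ, hxy, hx, hy⟩ :=
    (h.subseq hφ.tendsto_atTop).exists_subseq (fun n => hβ _) hi hd
  obtain ⟨c, hc, hev⟩ := (C1Tendsto.const γ).two_branches (fun _ => hi.differentiable)
    hi.continuous_deriv hx tendsto_const_nhds hy tendsto_const_nhds (hγ.cross_ne hxy)
  have hER' := (hER.comp (hφ.comp hψ).tendsto_atTop).eventually_lt_const (half_pos hc)
  obtain ⟨n, hn1, hn2⟩ := (hev.and hER').exists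
  set N := φ (ψ n)
  set a := Int.fract (X (ψ n))
  set b := Int.fract (Y (ψ n))
  -- at a double point of `β N` the two branches of `γ` are within `2 E N` of each other
  have hab : β N a = β N b := ((hd (ψ n)).fract (hβ _).periodic).1
  have h1 : ‖(γ a - γ x) - (γ b - γ y)‖ ≤ 2 * E N := by
    have : (γ a - γ x) - (γ b - γ y) = (β N b - γ b) - (β N a - γ a) := by
      rw [hab, hxy.1]; ring
    rw [this]
    refine (norm_sub_le _ _).trans ?_
    linarith [hE N a, hE N b]
  have h2 : E N / R N < c / 2 := hn2
  rw [div_lt_iff₀ (hR N)] at h2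
  have h3 : |a - x| ≤ R N := by nlinarith [abs_nonneg (b - y), abs_nonneg (a - x)]
  have := hX (ψ n) (x + ⌊X (ψ n)⌋) y (by simpa using hxy.add_int hp ⌊X (ψ n)⌋ 0)
  refine absurd h3 (not_le.2 ?_)
  have e : a - x = X (ψ n) - (x + ⌊X (ψ n)⌋) := by
    simp only [a]; unfold Int.fract; ring
  rw [e]; exact this

end Convergence

/-! ### Regular homotopies, winding numbers and compartments -/

lemma IsRegularHomotopy.comp {H : ℝ → ℝ → ℂ} (hH : IsRegularHomotopy H) {τ : ℝ → ℝ}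
    (hτ : Continuous τ) (hm : ∀ t ∈ Icc (0 : ℝ) 1, τ t ∈ Icc (0 : ℝ) 1) :
    IsRegularHomotopy fun t => H (τ t) := by
  have hc : ContinuousOn (fun p : ℝ × ℝ => (τ p.1, p.2)) (Icc (0 : ℝ) 1 ×ˢ univ) :=
    Continuous.continuousOn (by fun_prop)
  have hmaps : MapsTo (fun p : ℝ × ℝ => (τ p.1, p.2)) (Icc (0 : ℝ) 1 ×ˢ univ)
      (Icc (0 : ℝ) 1 ×ˢ univ) := fun p hp => ⟨hm _ hp.1, mem_univ _⟩
  exact ⟨fun t ht => hH.immersion _ (hm t ht), hH.continuousOn.comp hc hmaps,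
    hH.continuousOn_deriv.comp hc hmaps⟩

/-- The concatenation of two paths of curves, each run through at double speed. -/
noncomputable def concat (H G : ℝ → ℝ → ℂ) (t : ℝ) : ℝ → ℂ :=
  if t ≤ 1 / 2 then H (2 * t) else G (2 * t - 1)

lemma continuousOn_concat {H G : ℝ → ℝ → ℂ}
    (hH : ContinuousOn (fun p : ℝ × ℝ => H p.1 p.2) (Icc (0 : ℝ) 1 ×ˢ univ))
    (hG : ContinuousOn (fun p : ℝ × ℝ => G p.1 p.2) (Icc (0 : ℝ) 1 ×ˢ univ)) (h : H 1 = G 0) :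
    ContinuousOn (fun p : ℝ × ℝ => concat H G p.1 p.2) (Icc (0 : ℝ) 1 ×ˢ univ) := by
  have hu : (Icc (0 : ℝ) 1 ×ˢ univ : Set (ℝ × ℝ)) =
      Icc (0 : ℝ) (1 / 2) ×ˢ univ ∪ Icc (1 / 2 : ℝ) 1 ×ˢ univ := by
    rw [← union_prod, Icc_union_Icc_eq_Icc (by norm_num) (by norm_num)]
  rw [hu]
  refine ContinuousOn.union_of_isClosed ?_ ?_ (isClosed_Icc.prod isClosed_univ)
    (isClosed_Icc.prod isClosed_univ)
  · refine ContinuousOn.congr (f := fun p : ℝ × ℝ => H (2 * p.1) p.2) ?_ fun p hp => ?_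
    · exact hH.comp (f := fun p : ℝ × ℝ => (2 * p.1, p.2)) (Continuous.continuousOn (by fun_prop))
        fun p hp => ⟨⟨by linarith [hp.1.1], by linarith [hp.1.2]⟩, mem_univ _⟩
    · simp only [concat, if_pos hp.1.2]
  · refine ContinuousOn.congr (f := fun p : ℝ × ℝ => G (2 * p.1 - 1) p.2) ?_ fun p hp => ?_
    · exact hG.comp (f := fun p : ℝ × ℝ => (2 * p.1 - 1, p.2))
        (Continuous.continuousOn (by fun_prop))
        fun p hp => ⟨⟨by linarith [hp.1.1], by linarith [hp.1.2]⟩, mem_univ _⟩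
    · rcases hp.1.1.eq_or_lt with he | hlt
      · simp only [concat, ← he]; norm_num [h]
      · simp only [concat, if_neg (not_le.2 hlt)]

lemma concat_mem {P : (ℝ → ℂ) → Prop} {H G : ℝ → ℝ → ℂ} (hH : ∀ t ∈ Icc (0 : ℝ) 1, P (H t))
    (hG : ∀ t ∈ Icc (0 : ℝ) 1, P (G t)) {t : ℝ} (ht : t ∈ Icc (0 : ℝ) 1) : P (concat H G t) := by
  unfold concat
  split_ifs with h
  · exact hH _ ⟨by linarith [ht.1], by linarith⟩
  · exact hG _ ⟨by push Not at h; linarith, by linarith [ht.2]⟩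

lemma IsRegularHomotopy.concat {H G : ℝ → ℝ → ℂ} (hH : IsRegularHomotopy H)
    (hG : IsRegularHomotopy G) (h : H 1 = G 0) : IsRegularHomotopy (concat H G) := by
  refine ⟨fun t ht => concat_mem hH.immersion hG.immersion ht,
    continuousOn_concat hH.continuousOn hG.continuousOn h, ?_⟩
  have e : (fun p : ℝ × ℝ => deriv (PlaneCurve.concat H G p.1) p.2) = fun p : ℝ × ℝ =>
      PlaneCurve.concat (fun t => deriv (H t)) (fun t => deriv (G t)) p.1 p.2 := by
    funext p; unfold PlaneCurve.concat; split_ifs <;> rfl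
  rw [e]
  exact continuousOn_concat hH.continuousOn_deriv hG.continuousOn_deriv (by rw [h])

lemma concat_zero (H G : ℝ → ℝ → ℂ) : concat H G 0 = H 0 := by
  unfold concat; norm_num

lemma concat_one (H G : ℝ → ℝ → ℂ) : concat H G 1 = G 1 := by
  unfold concat; norm_num

lemma JoinedWithin.trans {S : Set (ℝ → ℂ)} {α β γ : ℝ → ℂ} (h₁ : JoinedWithin S α β)
    (h₂ : JoinedWithin S β γ) : JoinedWithin S α γ := by
  obtain ⟨H, hH, hHS, H0, H1⟩ := h₁
  obtain ⟨G, hG, hGS, G0, G1⟩ := h₂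
  exact ⟨concat H G, hH.concat hG (H1.trans G0.symm),
    fun t ht => concat_mem (P := (· ∈ S)) hHS hGS ht, by rw [concat_zero, H0],
    by rw [concat_one, G1]⟩

lemma JoinedWithin.symm {S : Set (ℝ → ℂ)} {α β : ℝ → ℂ} (h : JoinedWithin S α β) :
    JoinedWithin S β α := by
  obtain ⟨H, hH, hHS, H0, H1⟩ := h
  have hm : ∀ t ∈ Icc (0 : ℝ) 1, 1 - t ∈ Icc (0 : ℝ) 1 := fun t ht =>
    ⟨by linarith [ht.2], by linarith [ht.1]⟩
  exact ⟨fun t => H (1 - t), hH.comp (by fun_prop) hm, fun t ht => hHS _ (hm t ht),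
    by simpa using H1, by simpa using H0⟩

lemma IsImmersion.regularHomotopy_const {γ : ℝ → ℂ} (h : IsImmersion γ) :
    IsRegularHomotopy fun _ => γ :=
  ⟨fun _ _ => h, (h.contDiff.continuous.comp continuous_snd).continuousOn,
    (h.continuous_deriv.comp continuous_snd).continuousOn⟩

/-- If the tangents of two curves never form an angle of `π/2` or more, then the curves have
the same winding number. -/
lemma HasWindingNumber.of_re_pos {β γ : ℝ → ℂ} {ω : ℤ} (hγ : IsImmersion γ) (hβ : IsImmersion β)
    (h : ∀ x, 0 < (deriv β x * (starRingEnd ℂ) (deriv γ x)).re) (hw : HasWindingNumber γ ω) :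
    HasWindingNumber β ω := by
  obtain ⟨θ, hθ, hexp, hdiff⟩ := hw
  set z : ℝ → ℂ := fun x => deriv β x * (starRingEnd ℂ) (deriv γ x) with hz
  have hzc : Continuous z :=
    hβ.continuous_deriv.mul (Complex.continuous_conj.comp hγ.continuous_deriv)
  -- the angle between the tangents is a continuous periodic function
  refine ⟨fun x => θ x + Complex.arg (z x), ?_, fun x => ?_, ?_⟩
  · refine hθ.add (continuous_iff_continuousAt.2 fun x => ?_)
    exact ContinuousAt.comp (f := z) (Complex.continuousAt_arg (Or.inl (h x))) hzc.continuousAt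
  · have hb : (‖deriv β x‖ : ℂ) ≠ 0 := by
      exact_mod_cast norm_ne_zero_iff.2 (hβ.deriv_ne_zero x)
    have hg : (‖deriv γ x‖ : ℂ) ≠ 0 := by
      exact_mod_cast norm_ne_zero_iff.2 (hγ.deriv_ne_zero x)
    have h1 := Complex.norm_mul_exp_arg_mul_I (z x)
    have h2 := hexp x
    have hn : ‖z x‖ = ‖deriv β x‖ * ‖deriv γ x‖ := by simp [hz]
    have h3 : deriv γ x * (starRingEnd ℂ) (deriv γ x) = (‖deriv γ x‖ : ℂ) ^ 2 := by
      rw [Complex.mul_conj, Complex.normSq_eq_norm_sq]; push_cast; rfl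
    push_cast
    rw [add_mul, Complex.exp_add]
    rw [hn] at h1; push_cast at h1
    refine mul_left_cancel₀ (pow_ne_zero 2 hg) ?_
    calc (‖deriv γ x‖ : ℂ) ^ 2 * deriv β x = deriv γ x * z x := by rw [← h3, hz]; ring
      _ = ((‖deriv γ x‖ : ℂ) * Complex.exp (θ x * Complex.I)) *
          ((‖deriv β x‖ : ℂ) * ‖deriv γ x‖ * Complex.exp (Complex.arg (z x) * Complex.I)) := by
        rw [h1, ← h2]
      _ = _ := by ring
  · have e : z 1 = z 0 := by
      have a1 := periodic_deriv hβ.periodic 0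
      have a2 := periodic_deriv hγ.periodic 0
      rw [zero_add] at a1 a2
      simp only [hz, a1, a2]
    simp only [e]; linarith

lemma IsRegularHomotopy.hasWindingNumber_iff {H : ℝ → ℝ → ℂ} (hH : IsRegularHomotopy H) {ω : ℤ}
    {s t : ℝ} (hs : s ∈ Icc (0 : ℝ) 1) (ht : t ∈ Icc (0 : ℝ) 1) :
    HasWindingNumber (H s) ω ↔ HasWindingNumber (H t) ω := by
  refine isPreconnected_Icc.induction₂
    (fun s t => HasWindingNumber (H s) ω ↔ HasWindingNumber (H t) ω) (fun t₀ ht₀ => ?_)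
    (fun _ _ _ _ _ _ h₁ h₂ => h₁.trans h₂) (fun _ _ _ _ h => h.symm) hs ht
  -- nearby times have tangents that form angles below `π/2`
  set F : ℝ × ℝ → ℝ := fun p =>
    (deriv (H p.1) p.2 * (starRingEnd ℂ) (deriv (H t₀) p.2)).re with hF
  have hFc : ContinuousOn F (Icc (0 : ℝ) 1 ×ˢ univ) := by
    refine Complex.continuous_re.comp_continuousOn (hH.continuousOn_deriv.mul ?_)
    exact (Complex.continuous_conj.comp
      ((hH.immersion t₀ ht₀).continuous_deriv.comp continuous_snd)).continuousOn
  have hev : ∀ᶠ t in 𝓝 t₀, ∀ x ∈ Icc (0 : ℝ) 1, t ∈ Icc (0 : ℝ) 1 → 0 < F (t, x) := by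
    refine isCompact_Icc.eventually_forall_of_forall_eventually fun x _ => ?_
    have hpos : 0 < F (t₀, x) := by
      simp only [hF, Complex.mul_conj, Complex.ofReal_re]
      exact Complex.normSq_pos.2 ((hH.immersion t₀ ht₀).deriv_ne_zero x)
    have := (hFc (t₀, x) ⟨ht₀, mem_univ _⟩).eventually (lt_mem_nhds hpos)
    rw [eventually_nhdsWithin_iff] at this
    exact this.mono fun p hp hp1 => hp ⟨hp1, mem_univ _⟩
  rw [eventually_nhdsWithin_iff]
  filter_upwards [hev] with t ht' htI
  have h0 := hH.immersion t₀ ht₀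
  have h1 := hH.immersion t htI
  have hp : ∀ x, 0 < F (t, x) := fun x => by
    have := ht' (Int.fract x) ⟨Int.fract_nonneg x, (Int.fract_lt_one x).le⟩ htI
    simpa only [hF, periodic_fract (periodic_deriv h0.periodic),
      periodic_fract (periodic_deriv h1.periodic)] using this
  refine ⟨HasWindingNumber.of_re_pos h0 h1 hp, HasWindingNumber.of_re_pos h1 h0 fun x => ?_⟩
  have := hp x
  simp only [hF, Complex.mul_re, Complex.conj_re, Complex.conj_im] at this ⊢
  linarith

lemma tendsto_two_mul (t₀ : ℝ) : Tendsto (fun t : ℝ => 2 * t) (𝓝 (t₀ / 2)) (𝓝 t₀) := by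
  have : Tendsto (fun t : ℝ => 2 * t) (𝓝 (t₀ / 2)) (𝓝 (2 * (t₀ / 2))) :=
    (continuous_const_mul 2).tendsto _
  rwa [mul_div_cancel₀ _ (two_ne_zero)] at this

lemma tendsto_two_mul_left (t₀ : ℝ) :
    Tendsto (fun t : ℝ => 2 * t) (𝓝[<] (t₀ / 2)) (𝓝[<] t₀) := by
  refine tendsto_nhdsWithin_iff.2 ⟨(tendsto_two_mul t₀).mono_left nhdsWithin_le_nhds, ?_⟩
  filter_upwards [self_mem_nhdsWithin] with t ht
  simp only [mem_Iio] at ht ⊢; linarith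

lemma tendsto_two_mul_right (t₀ : ℝ) :
    Tendsto (fun t : ℝ => 2 * t) (𝓝[>] (t₀ / 2)) (𝓝[>] t₀) := by
  refine tendsto_nhdsWithin_iff.2 ⟨(tendsto_two_mul t₀).mono_left nhdsWithin_le_nhds, ?_⟩
  filter_upwards [self_mem_nhdsWithin] with t ht
  simp only [mem_Ioi] at ht ⊢; linarith

section Crossings

variable {H K : ℝ → ℝ → ℂ} {t₀ : ℝ} {ε : ℤ}

lemma DoublePointJump.speedup (hK : K =ᶠ[𝓝 (t₀ / 2)] fun t => H (2 * t))
    (h : DoublePointJump H t₀ ε) : DoublePointJump K (t₀ / 2) ε := by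
  obtain ⟨hε, n, h1, h2⟩ := h
  refine ⟨hε, n, ?_, ?_⟩
  · filter_upwards [(tendsto_two_mul_left t₀).eventually h1, hK.filter_mono nhdsWithin_le_nhds]
      with t h3 h4
    rw [h4]; exact h3
  · filter_upwards [(tendsto_two_mul_right t₀).eventually h2, hK.filter_mono nhdsWithin_le_nhds]
      with t h3 h4
    rw [h4]; exact h3

lemma eq_of_speedup (hK : K =ᶠ[𝓝 (t₀ / 2)] fun t => H (2 * t)) : K (t₀ / 2) = H t₀ := by
  have := hK.self_of_nhds
  simp only [mul_div_cancel₀ t₀ (two_ne_zero)] at this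
  exact this

lemma TripleCrossing.speedup (hK : K =ᶠ[𝓝 (t₀ / 2)] fun t => H (2 * t))
    (h : TripleCrossing H t₀ ε) : TripleCrossing K (t₀ / 2) ε := by
  obtain ⟨hε, u₁, u₂, u₃, hu, hr⟩ := h
  refine ⟨hε, u₁, u₂, u₃, by rw [eq_of_speedup hK]; exact hu, fun r hr0 => ⟨?_, ?_⟩⟩
  · filter_upwards [(tendsto_two_mul_left t₀).eventually (hr r hr0).1,
      hK.filter_mono nhdsWithin_le_nhds] with t h3 h4
    rw [h4]; exact h3
  · filter_upwards [(tendsto_two_mul_right t₀).eventually (hr r hr0).2,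
      hK.filter_mono nhdsWithin_le_nhds] with t h3 h4
    rw [h4]; exact h3

end Crossings

/-- The Arnold invariants are constant along regular homotopies of generic immersions: such a
homotopy can be appended to a generic path without adding crossings. -/
theorem HasArnoldInvariants.of_joined {γ γ' : ℝ → ℂ} {jp jm s : ℤ}
    (h : HasArnoldInvariants γ jp jm s) (hj : JoinedWithin {γ | IsGeneric γ} γ γ') :
    HasArnoldInvariants γ' jp jm s := by
  obtain ⟨ω, hω, H, D, I, T, ε, hH, H0, H1, rfl, rfl, rfl⟩ := h
  obtain ⟨G, hG, hGS, G0, G1⟩ := hj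
  have hHG : H 1 = G 0 := H1.trans G0.symm
  have hωG : HasWindingNumber γ' ω := by
    rw [← G1, ← hG.hasWindingNumber_iff (s := 0) (by simp) (by simp), G0]; exact hω
  -- the path `H` is run through at double speed, so its times of crossing are halved
  have hinj : ∀ S : Finset ℝ, Set.InjOn (fun t : ℝ => t / 2) S := fun S x _ y _ hxy => by
    simp only at hxy; linarith
  have hmem : ∀ (S : Finset ℝ) (t : ℝ), t ∈ S.image (fun t : ℝ => t / 2) ↔ 2 * t ∈ S := by
    intro S t
    rw [Finset.mem_image]
    constructor
    · rintro ⟨a, ha, rfl⟩; rwa [mul_div_cancel₀ _ (two_ne_zero)]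
    · intro ht; exact ⟨2 * t, ht, by ring⟩
  have hIoo : ∀ t, 2 * t ∈ D ∪ I ∪ T → 0 < t ∧ t < 1 / 2 := fun t ht => by
    have := hH.times _ ht; exact ⟨by linarith [this.1], by linarith [this.2]⟩
  have hev : ∀ t₀, t₀ ∈ D ∪ I ∪ T → concat H G =ᶠ[𝓝 (t₀ / 2)] fun t => H (2 * t) := by
    intro t₀ ht₀
    have := hH.times _ ht₀
    filter_upwards [gt_mem_nhds (show t₀ / 2 < 1 / 2 by linarith [this.2])] with t ht
    simp only [concat, if_pos ht.le]
  refine ⟨ω, hωG, concat H G, D.image (fun t => t / 2), I.image (fun t => t / 2),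
    T.image (fun t => t / 2), fun t => ε (2 * t), ⟨hH.homotopy.concat hG hHG, ?_, ?_, ?_, ?_, ?_⟩,
    by rw [concat_zero, H0], by rw [concat_one, G1], ?_, ?_, ?_⟩
  · intro t ht
    rw [← Finset.image_union, ← Finset.image_union, hmem] at ht
    exact ⟨(hIoo t ht).1, by linarith [(hIoo t ht).2]⟩
  · intro t ht hnot
    rw [← Finset.image_union, ← Finset.image_union, hmem] at hnot
    unfold concat
    split_ifs with hle
    · exact hH.generic _ ⟨by linarith [ht.1], by linarith⟩ hnot
    · exact hGS _ ⟨by push Not at hle; linarith, by linarith [ht.2]⟩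
  · intro t ht
    obtain ⟨t₀, ht₀, rfl⟩ := Finset.mem_image.1 ht
    have he := hev t₀ (by simp [ht₀])
    have hd := hH.direct t₀ ht₀
    simp only [mul_div_cancel₀ t₀ (two_ne_zero)]
    exact ⟨by rw [eq_of_speedup he]; exact hd.1, hd.2.speedup he⟩
  · intro t ht
    obtain ⟨t₀, ht₀, rfl⟩ := Finset.mem_image.1 ht
    have he := hev t₀ (by simp [ht₀])
    have hd := hH.inverse t₀ ht₀
    simp only [mul_div_cancel₀ t₀ (two_ne_zero)]
    exact ⟨by rw [eq_of_speedup he]; exact hd.1, hd.2.speedup he⟩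
  · intro t ht
    obtain ⟨t₀, ht₀, rfl⟩ := Finset.mem_image.1 ht
    have he := hev t₀ (by simp [ht₀])
    simp only [mul_div_cancel₀ t₀ (two_ne_zero)]
    exact (hH.triple t₀ ht₀).speedup he
  all_goals
    rw [Finset.sum_image (hinj _)]
    simp only [mul_div_cancel₀ _ (two_ne_zero' ℝ)]

/-- The classes of generic immersions with given invariants are closed under homotopies of
generic immersions. -/
theorem joinedWithin_genericClass {γ γ' : ℝ → ℂ} {jp jm s ω : ℤ}
    (hγ : γ ∈ genericClass jp jm s ω) (h : JoinedWithin {γ | IsGeneric γ} γ γ') :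
    JoinedWithin (genericClass jp jm s ω) γ γ' := by
  obtain ⟨G, hG, hGS, G0, G1⟩ := h
  refine ⟨G, hG, fun t ht => ⟨hGS t ht, ?_, ?_⟩, G0, G1⟩
  -- the curve `G t` is joined to `γ` by an initial piece of the homotopy
  · have hm : ∀ r ∈ Icc (0 : ℝ) 1, r * t ∈ Icc (0 : ℝ) 1 := fun r hr =>
      ⟨mul_nonneg hr.1 ht.1, mul_le_one₀ hr.2 ht.1 ht.2⟩
    exact hγ.2.1.of_joined ⟨fun r => G (r * t), hG.comp (by fun_prop) hm,
      fun r hr => hGS _ (hm r hr), by simpa using G0, by simp⟩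
  · rw [← hG.hasWindingNumber_iff (s := 0) (by simp) ht, G0]; exact hγ.2.2

lemma JoinedWithin.right_mem {S : Set (ℝ → ℂ)} {α β : ℝ → ℂ} (h : JoinedWithin S α β) :
    β ∈ S := by
  obtain ⟨H, -, hHS, -, H1⟩ := h
  rw [← H1]; exact hHS 1 (by simp)

lemma IsCompartment.subset {jp jm s ω : ℤ} {C : Set (ℝ → ℂ)} (hC : IsCompartment jp jm s ω C)
    {γ : ℝ → ℂ} (hγ : γ ∈ C) : γ ∈ genericClass jp jm s ω := by
  obtain ⟨γ₀, -, rfl⟩ := hC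
  exact JoinedWithin.right_mem hγ

theorem IsCompartment.mem_of_joined {jp jm s ω : ℤ} {C : Set (ℝ → ℂ)}
    (hC : IsCompartment jp jm s ω C) {γ γ' : ℝ → ℂ} (hγ : γ ∈ C)
    (h : JoinedWithin {γ | IsGeneric γ} γ γ') : γ' ∈ C := by
  have hγc := hC.subset hγ
  obtain ⟨γ₀, -, rfl⟩ := hC
  exact JoinedWithin.trans hγ (joinedWithin_genericClass hγc h)

lemma IsCompartment.nonempty {jp jm s ω : ℤ} {C : Set (ℝ → ℂ)}
    (hC : IsCompartment jp jm s ω C) : C.Nonempty := by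
  obtain ⟨γ₀, h₀, rfl⟩ := hC
  exact ⟨γ₀, fun _ => γ₀, h₀.1.immersion.regularHomotopy_const, fun _ _ => h₀, rfl, rfl⟩

/-- A segment of generic immersions is a regular homotopy. -/
lemma joinedWithin_segment {α β : ℝ → ℂ} (hα : ContDiff ℝ 1 α) (hβ : ContDiff ℝ 1 β)
    (h : ∀ t ∈ Icc (0 : ℝ) 1, IsGeneric (segment α β t)) :
    JoinedWithin {γ | IsGeneric γ} α β := by
  have hd : ∀ t, deriv (segment α β t) = segment (deriv α) (deriv β) t :=
    deriv_segment (hα.differentiable one_ne_zero) (hβ.differentiable one_ne_zero)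
  refine ⟨segment α β, ⟨fun t ht => (h t ht).immersion, ?_, ?_⟩, h, ?_, ?_⟩
  · have h1 := hα.continuous
    have h2 := hβ.continuous
    unfold segment
    exact Continuous.continuousOn (by fun_prop)
  · have h1 := hα.continuous_deriv le_rfl
    have h2 := hβ.continuous_deriv le_rfl
    simp only [hd]
    unfold segment
    exact Continuous.continuousOn (by fun_prop)
  · funext x; simp [segment]
  · funext x; simp [segment]

/-! ### Straightening a generic immersion near its double points -/

lemma abs_circ_sub_circ_le (x y : ℝ) : |circ x - circ y| ≤ |x - y| := by
  have h1 := circ_add_le (x - y) y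
  have h2 := circ_add_le (y - x) x
  have h3 := circ_le_abs (x - y)
  have h4 := circ_sub_comm x y
  simp only [sub_add_cancel] at h1 h2
  rw [abs_le]; constructor <;> linarith

/-- A Lipschitz cut-off on the circle: `1` within distance `ρ` of `u`, and `0` beyond `2 ρ`. -/
noncomputable def cutoff (ρ u x : ℝ) : ℝ := max 0 (min 1 (2 - circ (x - u) / ρ))

section Cutoff

variable {ρ u x : ℝ}

lemma cutoff_nonneg : 0 ≤ cutoff ρ u x := le_max_left _ _

lemma cutoff_le_one : cutoff ρ u x ≤ 1 := max_le zero_le_one (min_le_left _ _)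

lemma cutoff_eq_one (hρ : 0 < ρ) (h : circ (x - u) ≤ ρ) : cutoff ρ u x = 1 := by
  have : circ (x - u) / ρ ≤ 1 := (div_le_one hρ).2 h
  unfold cutoff
  rw [min_eq_left (by linarith), max_eq_right zero_le_one]

lemma cutoff_eq_zero (hρ : 0 < ρ) (h : 2 * ρ ≤ circ (x - u)) : cutoff ρ u x = 0 := by
  have : 2 ≤ circ (x - u) / ρ := (le_div_iff₀ hρ).2 h
  unfold cutoff
  exact max_eq_left ((min_le_right _ _).trans (by linarith))

lemma cutoff_periodic : Function.Periodic (cutoff ρ u) 1 := fun x => by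
  unfold cutoff
  have : circ (x + 1 - u) = circ (x - u) := by
    rw [← circ_add_int (x - u) 1]; congr 1; push_cast; ring
  rw [this]

lemma abs_cutoff_sub_le (hρ : 0 < ρ) (y : ℝ) :
    |cutoff ρ u x - cutoff ρ u y| ≤ ρ⁻¹ * |x - y| := by
  unfold cutoff
  refine (abs_max_sub_max_le_max _ _ _ _).trans (max_le (by simp; positivity) ?_)
  refine (abs_min_sub_min_le_max _ _ _ _).trans (max_le (by simp; positivity) ?_)
  have h : (2 - circ (x - u) / ρ) - (2 - circ (y - u) / ρ)
      = -(ρ⁻¹ * (circ (x - u) - circ (y - u))) := by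
    field_simp; ring
  rw [h, abs_neg, abs_mul, abs_of_pos (inv_pos.2 hρ)]
  have := abs_circ_sub_circ_le (x - u) (y - u)
  rw [sub_sub_sub_cancel_right] at this
  gcongr

lemma continuous_cutoff : Continuous (cutoff ρ u) := by
  unfold cutoff
  have : Continuous fun x : ℝ => circ (x - u) := continuous_circ.comp (by fun_prop)
  fun_prop

lemma integral_cutoff_le (hρ : 0 < ρ) : ∫ x in (0 : ℝ)..1, cutoff ρ u x ≤ 4 * ρ := by
  have h := (cutoff_periodic (ρ := ρ) (u := u)).intervalIntegral_add_eq 0 (u - 1 / 2)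
  rw [zero_add] at h
  rw [h, intervalIntegral.integral_of_le (by linarith)]
  have hle : ∀ x ∈ Ioc (u - 1 / 2) (u - 1 / 2 + 1),
      cutoff ρ u x ≤ (Icc (u - 2 * ρ) (u + 2 * ρ)).indicator (fun _ => (1 : ℝ)) x := by
    intro x hx
    by_cases hm : x ∈ Icc (u - 2 * ρ) (u + 2 * ρ)
    · rw [indicator_of_mem hm]; exact cutoff_le_one
    · rw [indicator_of_notMem hm]
      have h1 : |x - u| ≤ 1 / 2 := by
        rw [abs_le]; constructor <;> linarith [hx.1, hx.2]
      refine (cutoff_eq_zero hρ ?_).le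
      rw [circ_eq_abs h1]
      by_contra hlt
      push Not at hlt
      rw [abs_lt] at hlt
      exact hm ⟨by linarith, by linarith⟩
  have hint : Integrable ((Icc (u - 2 * ρ) (u + 2 * ρ)).indicator fun _ => (1 : ℝ)) :=
    (integrable_indicator_iff measurableSet_Icc).2 (integrableOn_const (by simp))
  calc ∫ x in Ioc (u - 1 / 2) (u - 1 / 2 + 1), cutoff ρ u x
      ≤ ∫ x in Ioc (u - 1 / 2) (u - 1 / 2 + 1),
          (Icc (u - 2 * ρ) (u + 2 * ρ)).indicator (fun _ => (1 : ℝ)) x :=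
        setIntegral_mono_on (continuous_cutoff.integrableOn_Ioc) hint.integrableOn
          measurableSet_Ioc hle
    _ ≤ ∫ x, (Icc (u - 2 * ρ) (u + 2 * ρ)).indicator (fun _ => (1 : ℝ)) x :=
        setIntegral_le_integral hint
          (Eventually.of_forall fun x => indicator_nonneg (fun _ _ => zero_le_one) _)
    _ = 4 * ρ := by
        rw [integral_indicator measurableSet_Icc, setIntegral_const]
        simp [measureReal_def]; rw [ENNReal.toReal_ofReal (by linarith)]; ring

end Cutoff

section Straighten

variable {γ : ℝ → ℂ}

lemma IsGeneric.finite_doubleParams (hγ : IsGeneric γ) : (doubleParams γ).Finite := by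
  obtain ⟨g, hg, hgap⟩ := hγ.exists_gap
  have hp := hγ.immersion.periodic
  refine Set.Finite.of_injOn (f := fun u : ℝ => ⌊u / g⌋) (t := Icc 0 ⌊1 / g⌋) ?_ ?_
    (Set.finite_Icc _ _)
  · intro u hu
    have := ((mem_doubleParams_iff hp).1 hu).1
    exact ⟨Int.floor_nonneg.2 (div_nonneg this.1 hg.le),
      Int.floor_le_floor (div_le_div_of_nonneg_right this.2.le hg.le)⟩
  · intro a ha b hb hab
    obtain ⟨ha1, a', ha'⟩ := (mem_doubleParams_iff hp).1 ha
    obtain ⟨hb1, b', hb'⟩ := (mem_doubleParams_iff hp).1 hb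
    by_contra hne
    have h1 := hgap a b a' b' ha' hb' (sub_ne_int_of_mem_Ico ha1 hb1 hne)
    have h2 := Int.abs_sub_lt_one_of_floor_eq_floor hab
    rw [← sub_div, abs_div, abs_of_pos hg, div_lt_one hg] at h2
    linarith [circ_le_abs (a - b)]

lemma uniformContinuous_of_periodic {f : ℝ → ℂ} (hf : Continuous f)
    (hp : Function.Periodic f 1) {ε : ℝ} (hε : 0 < ε) :
    ∃ r > 0, ∀ x y, |x - y| ≤ r → ‖f x - f y‖ ≤ ε := by
  have hu := (isCompact_Icc (a := (-1 : ℝ)) (b := 2)).uniformContinuousOn_of_continuous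
    hf.continuousOn
  obtain ⟨r, hr, h⟩ := Metric.uniformContinuousOn_iff.1 hu ε hε
  refine ⟨min (r / 2) 1, by positivity, fun x y hxy => ?_⟩
  have e1 : f x = f (Int.fract x) := (periodic_fract hp x).symm
  have e2 : f y = f (Int.fract x + (y - x)) := by
    rw [← periodic_sub_int hp y ⌊x⌋]; congr 1; unfold Int.fract; ring
  have h0 := Int.fract_nonneg x
  have h1 := Int.fract_lt_one x
  have h2 := abs_le.1 (hxy.trans (min_le_right _ _))
  rw [e1, e2, ← dist_eq_norm]
  refine (h _ ⟨by linarith, by linarith⟩ _ ⟨by linarith, by linarith⟩ ?_).le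
  rw [Real.dist_eq, abs_sub_comm]
  have : |x - y| ≤ r / 2 := hxy.trans (min_le_left _ _)
  rw [abs_sub_comm] at this
  have e3 : Int.fract x + (y - x) - Int.fract x = y - x := by ring
  rw [e3]; linarith

lemma exists_norm_le_of_periodic {f : ℝ → ℂ} (hf : Continuous f)
    (hp : Function.Periodic f 1) : ∃ M > 0, ∀ x, ‖f x‖ ≤ M := by
  obtain ⟨M, hM⟩ := (isCompact_Icc (a := (0 : ℝ)) (b := 1)).exists_bound_of_continuousOn
    hf.continuousOn
  refine ⟨max M 1, by positivity, fun x => ?_⟩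
  rw [← periodic_fract hp x]
  exact (hM _ ⟨Int.fract_nonneg _, (Int.fract_lt_one _).le⟩).trans (le_max_left _ _)

lemma norm_sub_le_of_deriv_le {f : ℝ → ℂ} (hf : Differentiable ℝ f) {M : ℝ}
    (hM : ∀ x, ‖deriv f x‖ ≤ M) (x y : ℝ) : ‖f x - f y‖ ≤ M * |x - y| := by
  have := Convex.norm_image_sub_le_of_norm_deriv_le (s := univ) (fun z _ => hf z)
    (fun z _ => hM z) convex_univ (mem_univ y) (mem_univ x)
  simpa [Real.norm_eq_abs] using this

/-- Lipschitz approximation of the derivative of a closed `C¹` curve by difference quotients. -/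
lemma exists_lipschitz_approx (hc : ContDiff ℝ 1 γ) (hp : Function.Periodic γ 1) {ε : ℝ}
    (hε : 0 < ε) : ∃ f : ℝ → ℂ, Function.Periodic f 1 ∧ (∃ K, LipschitzWith K f) ∧
      ∀ x, ‖f x - deriv γ x‖ ≤ ε := by
  have hd := hc.differentiable one_ne_zero
  have hc' := hc.continuous_deriv le_rfl
  obtain ⟨r, hr, hr'⟩ := uniformContinuous_of_periodic hc' (periodic_deriv hp) hε
  obtain ⟨M, hM, hM'⟩ := exists_norm_le_of_periodic hc' (periodic_deriv hp)
  refine ⟨fun x => (r : ℂ)⁻¹ * (γ (x + r) - γ x), fun x => ?_,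
    ⟨Real.toNNReal (r⁻¹ * (2 * M)), ?_⟩, fun x => ?_⟩
  · have : γ (x + 1 + r) = γ (x + r) := by
      rw [show x + 1 + r = x + r + 1 by ring]; exact hp _
    simp only [this, hp x]
  · refine LipschitzWith.of_dist_le_mul fun x y => ?_
    rw [Real.coe_toNNReal _ (by positivity), dist_eq_norm, ← mul_sub, norm_mul, norm_inv,
      Complex.norm_real, Real.norm_eq_abs, abs_of_pos hr, Real.dist_eq, mul_assoc]
    gcongr
    have h1 := norm_sub_le_of_deriv_le hd hM' (x + r) (y + r)
    have h2 := norm_sub_le_of_deriv_le hd hM' x y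
    rw [add_sub_add_right_eq_sub] at h1
    calc ‖γ (x + r) - γ x - (γ (y + r) - γ y)‖
        = ‖(γ (x + r) - γ (y + r)) - (γ x - γ y)‖ := by congr 1; ring
      _ ≤ _ := norm_sub_le _ _
      _ ≤ 2 * M * |x - y| := by linarith
  · have hder : ∀ z ∈ Icc x (x + r), HasDerivWithinAt (fun z : ℝ => γ z - (z : ℂ) * deriv γ x)
        (deriv γ z - 1 * deriv γ x) (Icc x (x + r)) z := fun z _ =>
      ((hd z).hasDerivAt.sub
        ((HasDerivAt.ofReal_comp (hasDerivAt_id z)).mul_const _)).hasDerivWithinAt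
    have hb : ∀ z ∈ Icc x (x + r), ‖deriv γ z - 1 * deriv γ x‖ ≤ ε := fun z hz => by
      rw [one_mul]
      exact hr' _ _ (by rw [abs_of_nonneg (by linarith [hz.1])]; linarith [hz.2])
    have := Convex.norm_image_sub_le_of_norm_hasDerivWithin_le hder hb (convex_Icc _ _)
      (left_mem_Icc.2 (by linarith)) (right_mem_Icc.2 (by linarith))
    rw [add_sub_cancel_left, Real.norm_eq_abs, abs_of_pos hr] at this
    have hr0 : (r : ℂ) ≠ 0 := by exact_mod_cast hr.ne'
    have e : (r : ℂ)⁻¹ * (γ (x + r) - γ x) - deriv γ x = (r : ℂ)⁻¹ *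
        (γ (x + r) - ((x + r : ℝ) : ℂ) * deriv γ x - (γ x - (x : ℂ) * deriv γ x)) := by
      field_simp; push_cast; ring
    rw [e, norm_mul, norm_inv, Complex.norm_real, Real.norm_eq_abs, abs_of_pos hr]
    rw [inv_mul_le_iff₀ hr]; linarith

/-- A closed curve `β` near `γ` in `C¹` whose derivative is Lipschitz and constant within distance
`ρ` of the double parameters of `γ`.  The uniform distance of `β` and `γ` is small compared
with `ρ`, as the tangents are changed substantially on a set of measure `O(ρ)` only. -/
lemma IsGeneric.exists_straight_approx (hγ : IsGeneric γ) {κ : ℝ} (hκ : 0 < κ) :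
    ∃ (β : ℝ → ℂ) (ρ : ℝ), 0 < ρ ∧ ContDiff ℝ 1 β ∧ Function.Periodic β 1 ∧
      (∃ K, LipschitzWith K (deriv β)) ∧ (∀ x, ‖deriv β x - deriv γ x‖ ≤ κ) ∧
      (∀ x, ‖β x - γ x‖ ≤ κ * ρ) ∧ (∀ x, ‖β x - γ x‖ ≤ κ) ∧
      ∀ u v, IsDouble γ u v → ∃ b, ∀ x, |x - u| ≤ ρ → deriv β x = b := by
  obtain ⟨g, hg, hgap⟩ := hγ.exists_gap
  have hp := hγ.immersion.periodic
  have hp' := periodic_deriv hp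
  have hc' := hγ.immersion.continuous_deriv
  have hdγ := hγ.immersion.differentiable
  set T := hγ.finite_doubleParams.toFinset with hT
  set N : ℝ := (T.card : ℝ) with hN
  have hN0 : 0 ≤ N := Nat.cast_nonneg _
  -- the tangents are changed by `O(κ')` near each of the `N` double parameters, and all the errors
  -- together stay below `κ`
  set κ' := κ / (100 * (N + 1)) with hκ'
  have hκ'0 : 0 < κ' := by positivity
  have hκN : κ' * (100 * (N + 1)) = κ := by rw [hκ']; field_simp
  obtain ⟨r, hr, hr'⟩ := uniformContinuous_of_periodic hc' hp' hκ'0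
  -- `2 ρ ≤ r` makes the tangents almost constant on the support of each cut-off, and `4 ρ ≤ g`
  -- keeps the supports away from the plateaus of the other cut-offs
  set ρ := min (min 1 (r / 2)) (g / 4) with hρdef
  have hρ : 0 < ρ := by positivity
  have hρ1 : ρ ≤ 1 := (min_le_left _ _).trans (min_le_left _ _)
  have hρr : ρ ≤ r / 2 := (min_le_left _ _).trans (min_le_right _ _)
  have hρg : ρ ≤ g / 4 := min_le_right _ _
  obtain ⟨f, hfp, ⟨K, hfK⟩, hf⟩ := exists_lipschitz_approx hγ.immersion.contDiff hp
    (ε := κ' * ρ) (by positivity)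
  have hfc := hfK.continuous
  -- on the support of a cut-off the tangents hardly vary
  have hosc : ∀ u x, ‖cutoff ρ u x • (f u - f x)‖ ≤ 3 * κ' * cutoff ρ u x := by
    intro u x
    rw [norm_smul, Real.norm_eq_abs, abs_of_nonneg cutoff_nonneg]
    rcases le_or_gt (2 * ρ) (circ (x - u)) with h | h
    · rw [cutoff_eq_zero hρ h]; simp
    · obtain ⟨k, hk⟩ := exists_circ_eq (x - u)
      rw [mul_comm]
      refine mul_le_mul_of_nonneg_right ?_ cutoff_nonneg
      have h1 : ‖deriv γ u - deriv γ (x - k)‖ ≤ κ' := by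
        refine hr' _ _ ?_
        rw [abs_sub_comm, show x - (k : ℝ) - u = x - u - k by ring, ← hk]; linarith
      rw [periodic_sub_int hp'] at h1
      have e : f u - f x = (f u - deriv γ u) + (deriv γ u - deriv γ x) - (f x - deriv γ x) := by
        ring
      rw [e]
      refine (norm_sub_le _ _).trans ((add_le_add_left (norm_add_le _ _) _).trans ?_)
      have h2 : κ' * ρ ≤ κ' := mul_le_of_le_one_right hκ'0.le hρ1
      linarith [hf u, hf x]
  -- the new tangents, which equal `f u` near a double parameter `u`
  set G : ℝ → ℂ := fun x => f x + ∑ u ∈ T, cutoff ρ u x • (f u - f x) with hG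
  have hGp : Function.Periodic G 1 := fun x => by
    simp only [hG, hfp x, cutoff_periodic x]
  have hGγ : ∀ x, ‖G x - deriv γ x‖ ≤ κ' * ρ + ∑ u ∈ T, 3 * κ' * cutoff ρ u x := fun x => by
    have e : G x - deriv γ x = (f x - deriv γ x) + ∑ u ∈ T, cutoff ρ u x • (f u - f x) := by
      simp only [hG]; ring
    rw [e]
    exact (norm_add_le _ _).trans (add_le_add (hf x)
      ((norm_sum_le _ _).trans (Finset.sum_le_sum fun u _ => hosc u x)))
  obtain ⟨M, hM0, hM⟩ := exists_norm_le_of_periodic hfc hfp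
  have hGlip : ∃ K, LipschitzWith K G := by
    refine ⟨K + ∑ _u ∈ T, Real.toNNReal (ρ⁻¹ * (2 * M) + K), ?_⟩
    refine LipschitzWith.of_dist_le_mul fun x y => ?_
    have hfl := fun x y => hfK.dist_le_mul x y
    simp only [dist_eq_norm] at hfl ⊢
    have e : G x - G y = (f x - f y) +
        ∑ u ∈ T, (cutoff ρ u x • (f u - f x) - cutoff ρ u y • (f u - f y)) := by
      simp only [hG, Finset.sum_sub_distrib]; ring
    rw [e]
    refine (norm_add_le _ _).trans ?_
    push_cast
    rw [add_mul, Finset.sum_mul]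
    refine add_le_add (hfl x y) ((norm_sum_le _ _).trans (Finset.sum_le_sum fun u _ => ?_))
    rw [Real.coe_toNNReal _ (by positivity)]
    have e2 : cutoff ρ u x • (f u - f x) - cutoff ρ u y • (f u - f y)
        = (cutoff ρ u x - cutoff ρ u y) • (f u - f x) - cutoff ρ u y • (f x - f y) := by
      simp only [Complex.real_smul]; push_cast; ring
    rw [e2]
    refine (norm_sub_le _ _).trans ?_
    rw [norm_smul, norm_smul, add_mul, Real.norm_eq_abs, Real.norm_eq_abs,
      abs_of_nonneg (cutoff_nonneg (x := y)), Real.norm_eq_abs]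
    refine add_le_add ?_ ?_
    · have h1 : ‖f u - f x‖ ≤ 2 * M := (norm_sub_le _ _).trans (by linarith [hM u, hM x])
      have h2 := abs_cutoff_sub_le (x := x) (u := u) hρ y
      calc _ ≤ (ρ⁻¹ * |x - y|) * (2 * M) := by gcongr
        _ = _ := by ring
    · refine (mul_le_of_le_one_left (norm_nonneg _) cutoff_le_one).trans ?_
      have := hfl x y
      rwa [Real.norm_eq_abs] at this
  obtain ⟨KG, hKG⟩ := hGlip
  have hGc := hKG.continuous
  -- the total change of the tangents
  have hint : ∫ x in (0 : ℝ)..1, ‖G x - deriv γ x‖ ≤ (1 + 12 * N) * (κ' * ρ) := by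
    have hcs : Continuous fun x => ∑ u ∈ T, 3 * κ' * cutoff ρ u x :=
      continuous_finsetSum _ fun u _ => continuous_const.mul continuous_cutoff
    calc ∫ x in (0 : ℝ)..1, ‖G x - deriv γ x‖
        ≤ ∫ x in (0 : ℝ)..1, (κ' * ρ + ∑ u ∈ T, 3 * κ' * cutoff ρ u x) :=
          intervalIntegral.integral_mono_on zero_le_one
            ((hGc.sub hc').norm.intervalIntegrable _ _)
            ((continuous_const.add hcs).intervalIntegrable _ _) fun x _ => hGγ x
      _ = κ' * ρ + ∑ u ∈ T, 3 * κ' * ∫ x in (0 : ℝ)..1, cutoff ρ u x := by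
          rw [intervalIntegral.integral_add (by simp) (hcs.intervalIntegrable _ _),
            intervalIntegral.integral_finsetSum (f := fun u x => 3 * κ' * cutoff ρ u x) fun u _ =>
              (continuous_const.mul continuous_cutoff).intervalIntegrable _ _]
          simp
      _ ≤ κ' * ρ + ∑ _u ∈ T, 3 * κ' * (4 * ρ) := by
          gcongr; exact integral_cutoff_le hρ
      _ = _ := by rw [Finset.sum_const, nsmul_eq_mul]; ring
  have hγint : ∀ x, ∫ y in (0 : ℝ)..x, deriv γ y = γ x - γ 0 := fun x =>
    intervalIntegral.integral_deriv_eq_sub (fun y _ => hdγ y) (hc'.intervalIntegrable _ _)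
  -- the mean of `G` is subtracted to close the curve
  set m : ℂ := ∫ x in (0 : ℝ)..1, G x with hm
  have hmle : ‖m‖ ≤ (1 + 12 * N) * (κ' * ρ) := by
    have e : m = ∫ x in (0 : ℝ)..1, (G x - deriv γ x) := by
      rw [intervalIntegral.integral_sub (hGc.intervalIntegrable _ _)
        (hc'.intervalIntegrable _ _), hγint]
      have := hp 0; rw [zero_add] at this
      rw [this]; simp [hm]
    rw [e]
    exact (intervalIntegral.norm_integral_le_integral_norm zero_le_one).trans hint
  have hGmc : Continuous fun x => G x - m := hGc.sub continuous_const
  set β : ℝ → ℂ := fun x => γ 0 + ∫ y in (0 : ℝ)..x, (G y - m) with hβ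
  have hβd : ∀ x, HasDerivAt β (G x - m) x := fun x =>
    (intervalIntegral.integral_hasDerivAt_right (hGmc.intervalIntegrable _ _)
      (hGmc.stronglyMeasurableAtFilter _ _) hGmc.continuousAt).const_add _
  have hβd' : deriv β = fun x => G x - m := funext fun x => (hβd x).deriv
  have hβp : Function.Periodic β 1 := fun x => by
    have h1 : Function.Periodic (fun x => G x - m) 1 := fun x => by simp only [hGp x]
    have h2 := h1.intervalIntegral_add_eq x 0
    have h3 : ∫ y in (0 : ℝ)..1, (G y - m) = 0 := by
      rw [intervalIntegral.integral_sub (hGc.intervalIntegrable _ _) (by simp)]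
      simp [hm]
    simp only [hβ]
    rw [← intervalIntegral.integral_add_adjacent_intervals
      (hGmc.intervalIntegrable 0 x) (hGmc.intervalIntegrable x (x + 1)), h2, zero_add, h3,
      add_zero]
  have hN1 : (1 + 12 * N) * (κ' * ρ) ≤ κ' * (12 * (N + 1)) := by
    have : κ' * ρ ≤ κ' := mul_le_of_le_one_right hκ'0.le hρ1
    nlinarith
  have hdist : ∀ x, ‖β x - γ x‖ ≤ κ * ρ := fun x => by
    have e1 : β x - γ x = β (Int.fract x) - γ (Int.fract x) := by
      rw [periodic_fract hβp, periodic_fract hp]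
    have h0 := Int.fract_nonneg x
    have h1 := Int.fract_lt_one x
    set z := Int.fract x
    have e2 : β z - γ z = (∫ y in (0 : ℝ)..z, (G y - deriv γ y)) - (z : ℂ) * m := by
      simp only [hβ]
      rw [intervalIntegral.integral_sub (hGc.intervalIntegrable _ _) (by simp),
        intervalIntegral.integral_sub (hGc.intervalIntegrable _ _)
        (hc'.intervalIntegrable _ _), hγint]
      simp; ring
    have h3 : ‖∫ y in (0 : ℝ)..z, (G y - deriv γ y)‖ ≤ (1 + 12 * N) * (κ' * ρ) := by
      refine (intervalIntegral.norm_integral_le_integral_norm h0).trans (le_trans ?_ hint)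
      exact intervalIntegral.integral_mono_interval le_rfl h0 h1.le
        (Eventually.of_forall fun _ => norm_nonneg _) ((hGc.sub hc').norm.intervalIntegrable _ _)
    have h4 : ‖(z : ℂ) * m‖ ≤ (1 + 12 * N) * (κ' * ρ) := by
      rw [norm_mul, Complex.norm_real, Real.norm_eq_abs, abs_of_nonneg h0]
      exact (mul_le_of_le_one_left (norm_nonneg _) h1.le).trans hmle
    rw [e1, e2]
    refine (norm_sub_le _ _).trans ((add_le_add h3 h4).trans ?_)
    rw [← hκN]
    have : 0 < κ' * ρ := by positivity
    nlinarith
  refine ⟨β, ρ, hρ, contDiff_one_iff_deriv.2 ⟨fun x => (hβd x).differentiableAt,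
    by rw [hβd']; exact hGmc⟩, hβp, ⟨KG, ?_⟩, fun x => ?_, hdist, fun x => ?_, ?_⟩
  · rw [hβd']
    exact LipschitzWith.of_dist_le_mul fun x y => by
      simpa only [dist_sub_right] using hKG.dist_le_mul x y
  · rw [hβd']
    have h1 := hGγ x
    have h2 : ∑ u ∈ T, 3 * κ' * cutoff ρ u x ≤ ∑ _u ∈ T, 3 * κ' :=
      Finset.sum_le_sum fun u _ => mul_le_of_le_one_right (by positivity) cutoff_le_one
    rw [Finset.sum_const, nsmul_eq_mul] at h2
    have e : G x - m - deriv γ x = (G x - deriv γ x) - m := by ring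
    simp only
    rw [e]
    refine (norm_sub_le _ _).trans ?_
    have : κ' * ρ ≤ κ' := mul_le_of_le_one_right hκ'0.le hρ1
    rw [← hκN]
    nlinarith
  · exact (hdist x).trans (mul_le_of_le_one_right hκ.le hρ1)
  · intro u v huv
    have hu0 : Int.fract u ∈ T := by
      rw [hT, Set.Finite.mem_toFinset]
      exact (mem_doubleParams_iff hp).2 ⟨fract_mem_Ico u, _, huv.fract hp⟩
    refine ⟨f (Int.fract u) - m, fun x hx => ?_⟩
    have hxu : circ (x - Int.fract u) ≤ ρ := by
      have : x - Int.fract u = (x - u) + (⌊u⌋ : ℤ) := by unfold Int.fract; ring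
      rw [this, circ_add_int]; exact (circ_le_abs _).trans hx
    have hsum : ∑ w ∈ T, cutoff ρ w x • (f w - f x)
        = cutoff ρ (Int.fract u) x • (f (Int.fract u) - f x) := by
      refine Finset.sum_eq_single_of_mem _ hu0 fun w hw hne => ?_
      rw [hT, Set.Finite.mem_toFinset] at hw
      obtain ⟨hw1, w', hw'⟩ := (mem_doubleParams_iff hp).1 hw
      have h1 := hgap w (Int.fract u) w' _ hw' (huv.fract hp)
        (sub_ne_int_of_mem_Ico hw1 (fract_mem_Ico u) hne)
      have h2 := circ_triangle w x (Int.fract u)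
      rw [circ_sub_comm w x] at h2
      rw [cutoff_eq_zero hρ (by linarith), zero_smul]
    rw [hβd']
    simp only [hG]
    rw [hsum, cutoff_eq_one hρ hxu, one_smul]; ring

/-- Every generic immersion is homotopic, through generic immersions, to one of class `C^{1,1}`
that is straight near its double points. -/
lemma IsGeneric.exists_straight (hγ : IsGeneric γ) : ∃ β, IsGeneric β ∧
    JoinedWithin {γ | IsGeneric γ} γ β ∧ (∃ K, LipschitzWith K (deriv β)) ∧
    ∃ r > 0, ∀ u v, IsDouble β u v → ∀ x, |x - u| ≤ r → deriv β x = deriv β u := by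
  obtain ⟨m, hm, hmle⟩ := hγ.immersion.exists_le_norm_deriv
  choose β ρ hρ hcd hp hlip hd1 hd0 hd2 hconst using fun n : ℕ =>
    hγ.exists_straight_approx (κ := (m / 2) * (1 / ((n : ℝ) + 1))) (by positivity)
  have hκ : Tendsto (fun n : ℕ => (m / 2) * (1 / ((n : ℝ) + 1))) atTop (𝓝 0) := by
    simpa using (tendsto_one_div_add_atTop_nhds_zero_nat (𝕜 := ℝ)).const_mul (m / 2)
  have hunif : ∀ {F : ℕ → ℝ → ℂ} {f : ℝ → ℂ},
      (∀ n x, ‖F n x - f x‖ ≤ (m / 2) * (1 / ((n : ℝ) + 1))) → TendstoUniformly F f atTop := by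
    intro F f h
    refine Metric.tendstoUniformly_iff.2 fun ε hε => ?_
    filter_upwards [hκ.eventually_lt_const hε] with n hn x
    rw [dist_comm, dist_eq_norm]
    exact (h n x).trans_lt hn
  have hC1 : C1Tendsto β γ := ⟨hunif hd2, hunif hd1⟩
  have himm : ∀ n, IsImmersion (β n) := fun n => by
    refine ⟨hcd n, hp n, fun x h0 => ?_⟩
    have h1 := hd1 n x
    rw [h0, zero_sub, norm_neg] at h1
    have h2 : (1 : ℝ) / ((n : ℝ) + 1) ≤ 1 := by
      rw [div_le_one (by positivity)]; linarith [(Nat.cast_nonneg n : (0 : ℝ) ≤ n)]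
    nlinarith [hmle x]
  have hnear := hγ.eventually_near hC1 himm hd0 (R := fun n => ρ n / 2)
    (fun n => half_pos (hρ n)) (by
      have : Tendsto (fun n : ℕ => 2 * ((m / 2) * (1 / ((n : ℝ) + 1)))) atTop (𝓝 0) := by
        simpa using hκ.const_mul 2
      refine this.congr fun n => ?_
      have := (hρ n).ne'
      field_simp)
  obtain ⟨n, h1, h2, h3⟩ := ((hγ.eventually hC1 himm).and
    ((hγ.eventually_segment hC1 hcd hp).and hnear)).exists
  refine ⟨β n, h1, (joinedWithin_segment (hcd n) hγ.immersion.contDiff h2).symm, hlip n,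
    ρ n / 2, half_pos (hρ n), fun u v huv x hx => ?_⟩
  obtain ⟨u₀, v₀, huv₀, hu₀⟩ := h3 u v huv
  obtain ⟨b, hb⟩ := hconst n u₀ v₀ huv₀
  have hpos := hρ n
  rw [hb x, hb u (by linarith)]
  have : x - u₀ = (x - u) + (u - u₀) := by ring
  rw [this]
  exact (abs_add_le _ _).trans (by linarith)

end Straighten

/-! ### Reparametrisation by arclength and admissible curves in a compartment -/

section Arclength

variable {β : ℝ → ℂ}

/-- Genericity is invariant under scaling and orientation preserving reparametrisation. -/
lemma IsGeneric.reparam (hβ : IsGeneric β) {φ : ℝ → ℝ} {c : ℝ} (hc : 0 < c)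
    (hφ : ContDiff ℝ 1 φ) (hφ' : ∀ x, 0 < deriv φ x) (hφ1 : ∀ x, φ (x + 1) = φ x + 1) :
    IsGeneric fun x => (c : ℂ) * β (φ x) := by
  obtain ⟨him, ht, h3⟩ := isGeneric_iff.1 hβ
  have hmono : StrictMono φ := strictMono_of_deriv_pos hφ'
  have hc0 : (c : ℂ) ≠ 0 := by exact_mod_cast hc.ne'
  have hφk : ∀ (k : ℤ) x, φ (x + k) = φ x + k := fun k x => by
    have hq : Function.Periodic (fun x => φ x - x) 1 := fun x => by simp only [hφ1]; ring
    have := hq.int_mul k x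
    simp only [mul_one] at this
    linarith
  have hd : ∀ x, HasDerivAt (fun x => (c : ℂ) * β (φ x)) ((c * deriv φ x : ℝ) * deriv β (φ x)) x :=
    fun x => by
      have := ((him.differentiable (φ x)).hasDerivAt.scomp x
        ((hφ.differentiable one_ne_zero) x).hasDerivAt).const_mul (c : ℂ)
      rw [Complex.real_smul] at this
      exact this.congr_deriv (by push_cast; ring)
  have hd' : ∀ x, deriv (fun x => (c : ℂ) * β (φ x)) x = (c * deriv φ x : ℝ) * deriv β (φ x) :=
    fun x => (hd x).deriv
  have hdbl : ∀ x y, IsDouble (fun x => (c : ℂ) * β (φ x)) x y → IsDouble β (φ x) (φ y) := by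
    rintro x y ⟨h1, h2⟩
    refine ⟨mul_left_cancel₀ hc0 h1, fun k hk => h2 k ?_⟩
    have : φ x = φ (y + k) := by rw [hφk]; linarith
    rw [hmono.injective this]; ring
  refine isGeneric_iff.2 ⟨⟨?_, fun x => ?_, fun x h0 => ?_⟩, fun x y hxy => ?_,
    fun x y z hxy hyz hxz => h3 _ _ _ (hdbl _ _ hxy) (hdbl _ _ hyz) (hdbl _ _ hxz)⟩
  · exact contDiff_const.mul (him.contDiff.comp hφ)
  · simp only [hφ1, him.periodic (φ x)]
  · rw [hd', mul_eq_zero] at h0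
    rcases h0 with h0 | h0
    · have : c * deriv φ x = 0 := by exact_mod_cast h0
      exact (mul_pos hc (hφ' x)).ne' this
    · exact him.deriv_ne_zero _ h0
  · rw [hd', hd']
    have h1 := ht _ _ (hdbl x y hxy)
    have e : cross ((c * deriv φ x : ℝ) * deriv β (φ x)) ((c * deriv φ y : ℝ) * deriv β (φ y))
        = (c * deriv φ x) * (c * deriv φ y) * cross (deriv β (φ x)) (deriv β (φ y)) := by
      unfold cross
      rw [Complex.re_ofReal_mul, Complex.im_ofReal_mul, Complex.re_ofReal_mul,
        Complex.im_ofReal_mul]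
      ring
    rw [e]
    exact mul_ne_zero (mul_pos (mul_pos hc (hφ' x)) (mul_pos hc (hφ' y))).ne' h1

lemma IsGeneric.joinedWithin_reparam (hβ : IsGeneric β) {φ : ℝ → ℝ} {c : ℝ} (hc : 0 < c)
    (hφ : ContDiff ℝ 1 φ) (hφ' : ∀ x, 0 < deriv φ x) (hφ1 : ∀ x, φ (x + 1) = φ x + 1) :
    JoinedWithin {γ | IsGeneric γ} β fun x => (c : ℂ) * β (φ x) := by
  have hφd := hφ.differentiable one_ne_zero
  have hφc := hφ.continuous
  have hφc' := hφ.continuous_deriv le_rfl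
  have hβc := hβ.immersion.contDiff.continuous
  have hβc' := hβ.immersion.continuous_deriv
  have hβd := hβ.immersion.differentiable
  -- interpolation of the parametrisation and of the scale
  set Φ : ℝ → ℝ → ℝ := fun t x => (1 - t) * x + t * φ x with hΦ
  set H : ℝ → ℝ → ℂ := fun t x => ((1 - t + t * c : ℝ) : ℂ) * β (Φ t x) with hH
  have hΦd : ∀ t x, HasDerivAt (Φ t) ((1 - t) + t * deriv φ x) x := fun t x => by
    have := ((hasDerivAt_id x).const_mul (1 - t)).add ((hφd x).hasDerivAt.const_mul t)
    rw [mul_one] at this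
    exact this
  have hHg : ∀ t ∈ Icc (0 : ℝ) 1, IsGeneric (H t) := fun t ht => by
    refine hβ.reparam (c := 1 - t + t * c) (φ := Φ t) ?_ ?_ (fun x => ?_) (fun x => ?_)
    · rcases ht.1.eq_or_lt with h | h
      · rw [← h]; norm_num
      · have := mul_pos h hc; linarith [ht.2]
    · simp only [hΦ]; fun_prop
    · rw [(hΦd t x).deriv]
      rcases ht.1.eq_or_lt with h | h
      · rw [← h]; norm_num
      · have := mul_pos h (hφ' x); linarith [ht.2]
    · simp only [hΦ, hφ1]; ring
  have hHd : ∀ t x, deriv (H t) x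
      = ((1 - t + t * c : ℝ) : ℂ) * (((1 - t) + t * deriv φ x : ℝ) * deriv β (Φ t x)) :=
    fun t x => by
      have := ((hβd (Φ t x)).hasDerivAt.scomp x (hΦd t x)).const_mul ((1 - t + t * c : ℝ) : ℂ)
      rw [Complex.real_smul] at this
      exact this.deriv
  refine ⟨H, ⟨fun t ht => (hHg t ht).immersion, ?_, ?_⟩, hHg, ?_, ?_⟩
  · simp only [hH, hΦ]
    exact Continuous.continuousOn (by fun_prop)
  · simp only [hHd]
    simp only [hΦ]
    exact Continuous.continuousOn (by fun_prop)
  · funext x; simp [hH, hΦ]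
  · funext x; simp [hH, hΦ]

/-- The parameter of a closed immersion as a function of the normalised arclength. -/
lemma IsImmersion.exists_arclength (hβ : IsImmersion β) : ∃ (φ : ℝ → ℝ) (L : ℝ), 0 < L ∧
    ContDiff ℝ 1 φ ∧ (∀ x, deriv φ x = L / ‖deriv β (φ x)‖) ∧ ∀ x, φ (x + 1) = φ x + 1 := by
  have hc := hβ.continuous_deriv.norm
  have hpos : ∀ x, 0 < ‖deriv β x‖ := fun x => norm_pos_iff.2 (hβ.deriv_ne_zero x)
  set L := ∫ x in (0 : ℝ)..1, ‖deriv β x‖ with hL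
  have hLpos : 0 < L := intervalIntegral.intervalIntegral_pos_of_pos
    (hc.intervalIntegrable _ _) hpos zero_lt_one
  set σ : ℝ → ℝ := fun x => L⁻¹ * ∫ y in (0 : ℝ)..x, ‖deriv β y‖ with hσ
  have hσd : ∀ x, HasDerivAt σ (L⁻¹ * ‖deriv β x‖) x := fun x =>
    (intervalIntegral.integral_hasDerivAt_right (hc.intervalIntegrable _ _)
      (hc.stronglyMeasurableAtFilter _ _) hc.continuousAt).const_mul _
  have hmono : StrictMono σ := strictMono_of_deriv_pos fun x => by
    rw [(hσd x).deriv]; exact mul_pos (inv_pos.2 hLpos) (hpos x)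
  have hσ1 : ∀ x, σ (x + 1) = σ x + 1 := fun x => by
    have hp : Function.Periodic (fun x => ‖deriv β x‖) 1 := fun x => by
      simp only [periodic_deriv hβ.periodic x]
    have h2 := hp.intervalIntegral_add_eq x 0
    rw [zero_add, ← hL] at h2
    simp only [hσ]
    rw [← intervalIntegral.integral_add_adjacent_intervals
      (hc.intervalIntegrable 0 x) (hc.intervalIntegrable x (x + 1)), h2]
    field_simp
  have hσc : Continuous σ := continuous_iff_continuousAt.2 fun x => (hσd x).continuousAt
  have hσk : ∀ k : ℤ, σ k = k := fun k => by
    have hq : Function.Periodic (fun x => σ x - x) 1 := fun x => by simp only [hσ1]; ring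
    have := hq.int_mul k 0
    have h0 : σ 0 = 0 := by simp [hσ]
    simp only [mul_one, zero_add, h0] at this
    linarith
  have hsurj : Function.Surjective σ := fun y =>
    mem_range_of_exists_le_of_exists_ge hσc ⟨(⌊y⌋ : ℤ), by rw [hσk]; exact Int.floor_le y⟩
      ⟨((⌊y⌋ + 1 : ℤ) : ℝ), by rw [hσk]; push_cast; exact (Int.lt_floor_add_one y).le⟩
  set e := hmono.orderIsoOfSurjective σ hsurj with he
  have hσe : ∀ y, σ (e.symm y) = y := fun y => hmono.orderIsoOfSurjective_self_symm_apply σ hsurj y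
  have hec : Continuous e.symm := e.symm.continuous
  have hed : ∀ x, HasDerivAt e.symm (L / ‖deriv β (e.symm x)‖) x := fun x => by
    have := HasDerivAt.of_local_left_inverse (f := σ) (g := e.symm) hec.continuousAt
      (hσd (e.symm x)) (mul_pos (inv_pos.2 hLpos) (hpos _)).ne' (Eventually.of_forall hσe)
    rwa [mul_inv, inv_inv, ← div_eq_mul_inv] at this
  have hed' : deriv e.symm = fun x => L / ‖deriv β (e.symm x)‖ := funext fun x => (hed x).deriv
  refine ⟨e.symm, L, hLpos, contDiff_one_iff_deriv.2 ⟨fun x => (hed x).differentiableAt, ?_⟩,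
    fun x => (hed x).deriv, fun x => hmono.injective ?_⟩
  · rw [hed']
    exact continuous_const.div (hc.comp hec) fun x => (hpos _).ne'
  · rw [hσ1, hσe, hσe]

lemma norm_normalize_sub_le {a b : ℂ} {m : ℝ} (hm : 0 < m) (ha : m ≤ ‖a‖) (hb : 0 < ‖b‖) :
    ‖((‖a‖⁻¹ : ℝ) : ℂ) * a - ((‖b‖⁻¹ : ℝ) : ℂ) * b‖ ≤ 2 / m * ‖a - b‖ := by
  have ha0 : 0 < ‖a‖ := hm.trans_le ha
  have e : ((‖a‖⁻¹ : ℝ) : ℂ) * a - ((‖b‖⁻¹ : ℝ) : ℂ) * b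
      = ((‖a‖⁻¹ : ℝ) : ℂ) * (a - b) + ((‖a‖⁻¹ - ‖b‖⁻¹ : ℝ) : ℂ) * b := by push_cast; ring
  have h1 : ‖((‖a‖⁻¹ : ℝ) : ℂ) * (a - b)‖ ≤ 1 / m * ‖a - b‖ := by
    rw [norm_mul, Complex.norm_real, Real.norm_eq_abs, abs_of_pos (inv_pos.2 ha0), ← one_div]
    gcongr
  have h2 : ‖((‖a‖⁻¹ - ‖b‖⁻¹ : ℝ) : ℂ) * b‖ ≤ 1 / m * ‖a - b‖ := by
    rw [norm_mul, Complex.norm_real, Real.norm_eq_abs]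
    have : ‖a‖⁻¹ - ‖b‖⁻¹ = (‖b‖ - ‖a‖) * (‖a‖⁻¹ * ‖b‖⁻¹) := by
      field_simp
    rw [this, abs_mul, abs_of_pos (mul_pos (inv_pos.2 ha0) (inv_pos.2 hb))]
    have h3 : |‖b‖ - ‖a‖| ≤ ‖a - b‖ := by rw [abs_sub_comm]; exact abs_norm_sub_norm_le a b
    calc |‖b‖ - ‖a‖| * (‖a‖⁻¹ * ‖b‖⁻¹) * ‖b‖ = 1 / ‖a‖ * |‖b‖ - ‖a‖| := by field_simp
      _ ≤ _ := by gcongr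
  rw [e]
  refine (norm_add_le _ _).trans ((add_le_add h1 h2).trans (le_of_eq ?_))
  ring

/-- A curve whose derivative is constant near `u` is affine there. -/
lemma affine_of_deriv_eq (hβ : Differentiable ℝ β) {u r : ℝ}
    (h : ∀ x, |x - u| < r → deriv β x = deriv β u) {x : ℝ} (hx : |x - u| < r) :
    β x = β u + ((x - u : ℝ) : ℂ) * deriv β u := by
  have hr : 0 < r := (abs_nonneg _).trans_lt hx
  have hd : ∀ z ∈ Metric.ball u r, HasDerivWithinAt (fun z : ℝ => β z - (z : ℂ) * deriv β u)
      (deriv β z - 1 * deriv β u) (Metric.ball u r) z := fun z _ =>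
    ((hβ z).hasDerivAt.sub
      ((HasDerivAt.ofReal_comp (hasDerivAt_id z)).mul_const _)).hasDerivWithinAt
  have := Convex.norm_image_sub_le_of_norm_hasDerivWithin_le (C := 0) hd
    (fun z hz => by rw [h z (by simpa [Real.dist_eq] using hz)]; simp)
    (convex_ball u r) (Metric.mem_ball_self hr)
    (show x ∈ Metric.ball u r by simpa [Real.dist_eq] using hx)
  rw [zero_mul, norm_le_zero_iff, sub_eq_zero] at this
  push_cast
  linear_combination this

/-- Every generic immersion is homotopic, through generic immersions, to a curve of class
`C^{1,1}` and unit speed that is straight near its double points. -/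
lemma IsGeneric.exists_straight_unit_speed {γ : ℝ → ℂ} (hγ : IsGeneric γ) :
    ∃ α, IsGeneric α ∧ JoinedWithin {γ | IsGeneric γ} γ α ∧
      (∃ K, LipschitzWith K (deriv α)) ∧ (∀ x, ‖deriv α x‖ = 1) ∧
      ∃ r > 0, ∀ u v, IsDouble α u v → ∀ x, |x - u| < r →
        α x = α u + ((x - u : ℝ) : ℂ) * deriv α u := by
  obtain ⟨β, hβ, hj, ⟨K, hK⟩, r, hr, hst⟩ := hγ.exists_straight
  obtain ⟨m, hm, hmle⟩ := hβ.immersion.exists_le_norm_deriv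
  obtain ⟨φ, L, hL, hφ, hφ', hφ1⟩ := hβ.immersion.exists_arclength
  have hpos : ∀ x, 0 < ‖deriv β x‖ := fun x => hm.trans_le (hmle x)
  have hφpos : ∀ x, 0 < deriv φ x := fun x => by rw [hφ']; exact div_pos hL (hpos _)
  have hLi : 0 < L⁻¹ := inv_pos.2 hL
  have hg := hβ.reparam hLi hφ hφpos hφ1
  have hφd := hφ.differentiable one_ne_zero
  have hφlip : ∀ x y, |φ x - φ y| ≤ L / m * |x - y| := fun x y => by
    have := Convex.norm_image_sub_le_of_norm_deriv_le (s := univ) (C := L / m)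
      (fun z _ => hφd z) (fun z _ => by
        rw [Real.norm_eq_abs, abs_of_pos (hφpos z), hφ']
        exact div_le_div_of_nonneg_left hL.le hm (hmle _)) convex_univ (mem_univ y) (mem_univ x)
    simpa [Real.norm_eq_abs] using this
  have hd : ∀ x, deriv (fun x => ((L⁻¹ : ℝ) : ℂ) * β (φ x)) x
      = ((‖deriv β (φ x)‖⁻¹ : ℝ) : ℂ) * deriv β (φ x) := fun x => by
    have := ((hβ.immersion.differentiable (φ x)).hasDerivAt.scomp x
      (hφd x).hasDerivAt).const_mul ((L⁻¹ : ℝ) : ℂ)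
    rw [Complex.real_smul, hφ'] at this
    refine this.deriv.trans ?_
    rw [← mul_assoc, ← Complex.ofReal_mul]
    congr 2
    field_simp
  refine ⟨fun x => ((L⁻¹ : ℝ) : ℂ) * β (φ x), hg,
    hj.trans (hβ.joinedWithin_reparam hLi hφ hφpos hφ1), ?_, fun x => ?_,
    r * m / L, by positivity, fun u v huv x hx => ?_⟩
  · refine ⟨Real.toNNReal (2 / m * (K * (L / m))), LipschitzWith.of_dist_le_mul fun x y => ?_⟩
    rw [Real.coe_toNNReal _ (by positivity), dist_eq_norm, hd, hd, Real.dist_eq]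
    refine (norm_normalize_sub_le hm (hmle _) (hpos _)).trans ?_
    rw [mul_assoc, mul_assoc]
    have h1 := hK.dist_le_mul (φ x) (φ y)
    rw [dist_eq_norm, Real.dist_eq] at h1
    have h2 := hφlip x y
    refine mul_le_mul_of_nonneg_left (h1.trans ?_) (by positivity)
    exact mul_le_mul_of_nonneg_left h2 (by positivity)
  · rw [hd, norm_mul, Complex.norm_real, Real.norm_eq_abs, abs_of_pos (inv_pos.2 (hpos _)),
      inv_mul_cancel₀ (hpos _).ne']
  · refine affine_of_deriv_eq hg.immersion.differentiable (r := r * m / L) (fun y hy => ?_) hx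
    have hφdbl : IsDouble β (φ u) (φ v) := by
      have hL0 : ((L⁻¹ : ℝ) : ℂ) ≠ 0 := by exact_mod_cast hLi.ne'
      refine ⟨mul_left_cancel₀ hL0 huv.1, fun k hk => huv.2 k ?_⟩
      have hq : Function.Periodic (fun x => φ x - x) 1 := fun x => by simp only [hφ1]; ring
      have h3 := hq.int_mul k v
      simp only [mul_one] at h3
      have : φ u = φ (v + k) := by linarith
      rw [(strictMono_of_deriv_pos hφpos).injective this]; ring
    have h1 : |φ y - φ u| ≤ r := (hφlip y u).trans (by
      rw [div_mul_eq_mul_div, div_le_iff₀ hm]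
      rw [lt_div_iff₀ hL] at hy
      linarith)
    rw [hd, hd, hst _ _ hφdbl _ h1]

/-- Every compartment contains admissible curves of class `C^{1,1}` for all small `η`. -/
theorem IsCompartment.exists_threshold {jp jm s ω : ℤ} {C : Set (ℝ → ℂ)}
    (hC : IsCompartment jp jm s ω C) : ∃ η₀, IsThreshold jp jm s ω C η₀ := by
  obtain ⟨γ, hγ⟩ := hC.nonempty
  obtain ⟨α, hα, hj, hlip, hs, r, hr, hst⟩ := (hC.subset hγ).1.exists_straight_unit_speed
  obtain ⟨g, hg, hgap⟩ := hα.exists_gap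
  have hαC := hC.mem_of_joined hγ hj
  refine ⟨min (min r (g / 2)) (1 / 2), by positivity,
    (min_le_right _ _).trans_lt (by norm_num), fun η hη => ⟨α, ⟨⟨hC.subset hαC, hs, ?_, ?_⟩, hαC⟩,
      hα.immersion.contDiff, hlip⟩⟩
  · refine (le_minGap_iff hα.immersion.periodic hs).2 fun a b a' b' ha hb hab => ?_
    have h1 : η ≤ g / 2 := hη.2.trans ((min_le_left _ _).trans (min_le_right _ _))
    linarith [hgap a b a' b' ha hb hab]
  · refine (straight_iff hα.immersion hη.1).2 fun u v huv x hx => hst u v huv x (hx.trans_le ?_)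
    exact hη.2.trans ((min_le_left _ _).trans (min_le_left _ _))

end Arclength

/-! ### The truncated tangent-point energy of curves of unit speed -/

/-- Closed immersed curves of unit speed. -/
structure IsUnitSpeed (γ : ℝ → ℂ) : Prop where
  immersion : IsImmersion γ
  speed : ∀ x, ‖deriv γ x‖ = 1

section Energy

variable {γ : ℝ → ℂ} {q δ : ℝ}

lemma infDist_tangentLine {t : ℝ} (h : ‖deriv γ t‖ = 1) (p : ℂ) :
    Metric.infDist p (tangentLine γ t) = |cross (deriv γ t) (p - γ t)| := by
  set e := deriv γ t
  have hee : e.re ^ 2 + e.im ^ 2 = 1 := by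
    have := Complex.sq_norm e
    rw [h, Complex.normSq_apply] at this; linarith
  refine le_antisymm ?_ ?_
  · have hm : γ t + ((e.re * (p - γ t).re + e.im * (p - γ t).im : ℝ) : ℂ) * e
        ∈ tangentLine γ t := ⟨_, rfl⟩
    refine (Metric.infDist_le_dist_of_mem hm).trans (le_of_eq ?_)
    have e1 : p - (γ t + ((e.re * (p - γ t).re + e.im * (p - γ t).im : ℝ) : ℂ) * e)
        = ((cross e (p - γ t) : ℝ) : ℂ) * (Complex.I * e) := by
      unfold cross
      apply Complex.ext
      · simp
        linear_combination (-(p.re - (γ t).re)) * hee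
      · simp
        linear_combination (-(p.im - (γ t).im)) * hee
    rw [dist_eq_norm, e1, norm_mul, norm_mul, h, Complex.norm_I, Complex.norm_real,
      Real.norm_eq_abs]
    ring
  · refine (Metric.le_infDist (range_nonempty _)).2 ?_
    rintro _ ⟨r, rfl⟩
    have e1 : cross e (p - γ t) = cross e (p - (γ t + (r : ℂ) * e)) := by
      unfold cross; simp; ring
    rw [e1, dist_eq_norm]
    simpa [h] using norm_cross_le e (p - (γ t + (r : ℂ) * e))

lemma invTangentPointRadius_eq (h : IsUnitSpeed γ) (t s : ℝ) : invTangentPointRadius γ t s =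
    2 * |cross (deriv γ t) (γ s - γ t)| / ‖γ t - γ s‖ ^ 2 := by
  unfold invTangentPointRadius
  rw [infDist_tangentLine (h.speed t)]

lemma invTangentPointRadius_nonneg (γ : ℝ → ℂ) (t s : ℝ) : 0 ≤ invTangentPointRadius γ t s :=
  div_nonneg (mul_nonneg zero_le_two Metric.infDist_nonneg) (by positivity)

lemma isOpen_cutOut (h : IsUnitSpeed γ) (δ : ℝ) : IsOpen (cutOut γ δ) := by
  have e : cutOut γ δ = ⋃ u, ⋃ v, ⋃ (_ : IsDouble γ u v),
      {z : ℝ × ℝ | circ (z.1 - u) < δ} ∩ {z | circ (z.2 - v) < δ} := by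
    ext z
    rw [mem_cutOut_iff h.immersion.periodic h.speed]
    simp only [mem_iUnion, exists_prop, mem_inter_iff, mem_ofPred_eq]
  rw [e]
  refine isOpen_iUnion fun u => isOpen_iUnion fun v => isOpen_iUnion fun _ => ?_
  have hc := continuous_circ
  exact (isOpen_lt (hc.comp (by fun_prop)) continuous_const).inter
    (isOpen_lt (hc.comp (by fun_prop)) continuous_const)

/-- The integrand of `truncatedTP` for curves of unit speed, extended by zero to the cut-out
set. -/
noncomputable def density (q δ : ℝ) (γ : ℝ → ℂ) (z : ℝ × ℝ) : ℝ≥0∞ :=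
  (cutOut γ δ)ᶜ.indicator (fun z => ENNReal.ofReal (invTangentPointRadius γ z.2 z.1 ^ q)) z

lemma measurable_invTangentPointRadius (h : IsUnitSpeed γ) :
    Measurable fun z : ℝ × ℝ => invTangentPointRadius γ z.2 z.1 := by
  have hc := h.immersion.contDiff.continuous
  have hc' := h.immersion.continuous_deriv
  simp only [invTangentPointRadius_eq h]
  have h1 : Continuous fun z : ℝ × ℝ => cross (deriv γ z.2) (γ z.1 - γ z.2) :=
    continuous_cross.comp
      (f := fun z : ℝ × ℝ => (deriv γ z.2, γ z.1 - γ z.2)) (by fun_prop)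
  have h2 : Continuous fun z : ℝ × ℝ => ‖γ z.2 - γ z.1‖ ^ 2 := by fun_prop
  exact (continuous_const.mul h1.abs).measurable.div h2.measurable

lemma measurable_density (h : IsUnitSpeed γ) : Measurable (density q δ γ) := by
  unfold density
  exact (((measurable_invTangentPointRadius h).pow_const q).ennreal_ofReal).indicator
    (isOpen_cutOut h δ).measurableSet.compl

lemma truncatedTP_eq (h : IsUnitSpeed γ) :
    truncatedTP q δ γ = ∫⁻ z in Ico (0 : ℝ) 1 ×ˢ Ico (0 : ℝ) 1, density q δ γ z := by
  unfold truncatedTP density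
  rw [lintegral_indicator (isOpen_cutOut h δ).measurableSet.compl,
    Measure.restrict_restrict (isOpen_cutOut h δ).measurableSet.compl, inter_comm, ← sdiff_eq]
  simp only [h.speed, mul_one]

lemma density_add_int (h : IsUnitSpeed γ) (x y : ℝ) (k l : ℤ) :
    density q δ γ (x + k, y + l) = density q δ γ (x, y) := by
  have hp := h.immersion.periodic
  have hp' := periodic_deriv hp
  have hm : (x + k, y + l) ∈ (cutOut γ δ)ᶜ ↔ (x, y) ∈ (cutOut γ δ)ᶜ := by
    rw [mem_compl_iff, mem_compl_iff, not_iff_not, mem_cutOut_iff hp h.speed,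
      mem_cutOut_iff hp h.speed]
    have e : ∀ (x u : ℝ) (k : ℤ), circ (x + k - u) = circ (x - u) := fun x u k => by
      rw [← circ_add_int (x - u) k]; congr 1; ring
    simp only [e]
  unfold density
  by_cases hz : (x, y) ∈ (cutOut γ δ)ᶜ
  · rw [indicator_of_mem hz, indicator_of_mem (hm.2 hz)]
    simp only [invTangentPointRadius_eq h, periodic_add_int hp, periodic_add_int hp']
  · rw [indicator_of_notMem hz, indicator_of_notMem (mt hm.1 hz)]

lemma density_of_notMem {z : ℝ × ℝ} (h : z ∉ cutOut γ δ) :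
    density q δ γ z = ENNReal.ofReal (invTangentPointRadius γ z.2 z.1 ^ q) :=
  indicator_of_mem h _

lemma lintegral_Ioc_of_periodic {f : ℝ → ℝ≥0∞} (hf : ∀ (x : ℝ) (k : ℤ), f (x + k) = f x)
    (a b : ℝ) : ∫⁻ x in Ioc a (a + 1), f x = ∫⁻ x in Ioc b (b + 1), f x := by
  refine (isAddFundamentalDomain_Ioc zero_lt_one a).setLIntegral_eq
    (isAddFundamentalDomain_Ioc zero_lt_one b) f ?_
  rintro ⟨g, hg⟩ x
  obtain ⟨k, rfl⟩ := AddSubgroup.mem_zmultiples_iff.1 hg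
  have : (⟨k • (1 : ℝ), hg⟩ : AddSubgroup.zmultiples (1 : ℝ)) +ᵥ x = x + k := by
    rw [AddSubgroup.vadd_def]; simp [add_comm]
  rw [this, hf]

/-- The energy as an integral over an arbitrary unit square. -/
lemma truncatedTP_eq_unit_square (h : IsUnitSpeed γ) (a b : ℝ) : truncatedTP q δ γ =
    ∫⁻ z in Ioc a (a + 1) ×ˢ Ioc b (b + 1), density q δ γ z := by
  have hm := measurable_density (q := q) (δ := δ) h
  have hy : ∀ x, ∫⁻ y in Ioc (0 : ℝ) (0 + 1), density q δ γ (x, y)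
      = ∫⁻ y in Ioc b (b + 1), density q δ γ (x, y) := fun x =>
    lintegral_Ioc_of_periodic (fun y k => by
      have := density_add_int (q := q) (δ := δ) h x y 0 k
      simpa using this) 0 b
  rw [truncatedTP_eq h, setLIntegral_congr (t := Ioc (0 : ℝ) (0 + 1) ×ˢ Ioc (0 : ℝ) (0 + 1))]
  · rw [Measure.volume_eq_prod, setLIntegral_prod _ hm.aemeasurable,
      setLIntegral_prod _ hm.aemeasurable]
    simp only [hy]
    refine lintegral_Ioc_of_periodic (fun x k => ?_) 0 a
    refine lintegral_congr fun y => ?_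
    have := density_add_int (q := q) (δ := δ) h x y k 0
    simpa using this
  · rw [zero_add, Measure.volume_eq_prod]
    exact Measure.set_prod_ae_eq Ico_ae_eq_Ioc Ico_ae_eq_Ioc

lemma lintegral_density_le (h : IsUnitSpeed γ) {a b : ℝ} {S : Set (ℝ × ℝ)}
    (hS : S ⊆ Ioc a (a + 1) ×ˢ Ioc b (b + 1)) :
    ∫⁻ z in S, density q δ γ z ≤ truncatedTP q δ γ := by
  rw [truncatedTP_eq_unit_square h a b]
  exact lintegral_mono_set hS

lemma lintegral_density_swap_le (h : IsUnitSpeed γ) {a b c d : ℝ} (hab : b ≤ a + 1)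
    (hcd : d ≤ c + 1) :
    ∫⁻ z in Ioc a b ×ˢ Ioc c d, density q δ γ z.swap ≤ truncatedTP q δ γ := by
  rw [Measure.volume_eq_prod, ← Measure.prod_restrict, lintegral_prod_swap,
    Measure.prod_restrict, ← Measure.volume_eq_prod]
  exact lintegral_density_le h (prod_mono (Ioc_subset_Ioc_right hcd) (Ioc_subset_Ioc_right hab))

/-- Two unit vectors that form acute angles with `c` differ by at most the sum of the angles. -/
lemma norm_sub_mul_le_cross {e f c : ℂ} (he : ‖e‖ = 1) (hf : ‖f‖ = 1) {d : ℝ} (hd : 0 < d)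
    (hec : d / 2 ≤ e.re * c.re + e.im * c.im) (hfc : d / 2 ≤ f.re * c.re + f.im * c.im) :
    ‖e - f‖ * d ≤ 2 * (|cross e c| + |cross f c|) := by
  have he2 : e.re * e.re + e.im * e.im = 1 := by
    rw [← Complex.normSq_apply, ← Complex.sq_norm, he]; norm_num
  have hf2 : f.re * f.re + f.im * f.im = 1 := by
    rw [← Complex.normSq_apply, ← Complex.sq_norm, hf]; norm_num
  set v := e - f with hv
  set w := e + f with hw
  have hwc : d ≤ w.re * c.re + w.im * c.im := by
    simp only [hw, Complex.add_re, Complex.add_im]; linarith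
  have hw2 : ‖w‖ ≤ 2 := (norm_add_le e f).trans (by rw [he, hf]; norm_num)
  have hw0 : 0 < ‖w‖ := by
    refine norm_pos_iff.2 fun h0 => ?_
    rw [h0] at hwc; simp at hwc; linarith
  have hvw : v.re * w.re + v.im * w.im = 0 := by
    simp only [hv, hw, Complex.add_re, Complex.add_im, Complex.sub_re, Complex.sub_im]
    linear_combination he2 - hf2
  have hwn : ‖w‖ ^ 2 = w.re * w.re + w.im * w.im := by
    rw [Complex.sq_norm, Complex.normSq_apply]
  have hvn : ‖v‖ ^ 2 = v.re * v.re + v.im * v.im := by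
    rw [Complex.sq_norm, Complex.normSq_apply]
  have h1 : cross v c * ‖w‖ ^ 2 = (w.re * c.re + w.im * c.im) * cross v w := by
    rw [hwn]; unfold cross
    linear_combination (w.re * c.im - w.im * c.re) * hvw
  have h2 : |cross v w| = ‖v‖ * ‖w‖ := by
    rw [← abs_of_nonneg (by positivity : 0 ≤ ‖v‖ * ‖w‖)]
    refine (sq_eq_sq_iff_abs_eq_abs _ _).1 ?_
    rw [mul_pow, hvn, hwn]; unfold cross
    linear_combination (-(v.re * w.re + v.im * w.im)) * hvw
  have h3 : |cross v c| * ‖w‖ ^ 2 = (w.re * c.re + w.im * c.im) * (‖v‖ * ‖w‖) := by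
    rw [← h2, ← abs_of_nonneg (hd.le.trans hwc), ← abs_mul, ← h1, abs_mul,
      abs_of_nonneg (by positivity : 0 ≤ ‖w‖ ^ 2)]
  have h4 : |cross v c| * ‖w‖ = (w.re * c.re + w.im * c.im) * ‖v‖ := by
    refine mul_right_cancel₀ hw0.ne' ?_
    linear_combination h3
  have h5 : |cross v c| ≤ |cross e c| + |cross f c| := by
    have : cross v c = cross e c - cross f c := by simp only [hv]; unfold cross; simp; ring
    rw [this]; exact abs_sub _ _
  have h6 : ‖v‖ * d ≤ |cross v c| * ‖w‖ := by
    rw [h4, mul_comm]; exact mul_le_mul_of_nonneg_right hwc (norm_nonneg _)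
  have h7 : |cross v c| * ‖w‖ ≤ |cross v c| * 2 := by gcongr
  linarith

lemma norm_chord_sub_le (h : IsUnitSpeed γ) {s t ε : ℝ} {e : ℂ}
    (hosc : ∀ x ∈ uIcc s t, ‖deriv γ x - e‖ ≤ ε) :
    ‖γ t - γ s - ((t - s : ℝ) : ℂ) * e‖ ≤ ε * |t - s| := by
  have hd : ∀ z ∈ uIcc s t, HasDerivWithinAt (fun z : ℝ => γ z - (z : ℂ) * e)
      (deriv γ z - 1 * e) (uIcc s t) z := fun z _ =>
    ((h.immersion.differentiable z).hasDerivAt.sub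
      ((HasDerivAt.ofReal_comp (hasDerivAt_id z)).mul_const _)).hasDerivWithinAt
  have := Convex.norm_image_sub_le_of_norm_hasDerivWithin_le hd
    (fun z hz => by rw [one_mul]; exact hosc z hz) (convex_uIcc s t) left_mem_uIcc right_mem_uIcc
  rw [Real.norm_eq_abs] at this
  refine le_trans (le_of_eq ?_) this
  congr 1; push_cast; ring

lemma IsUnitSpeed.norm_sub_le (h : IsUnitSpeed γ) (s t : ℝ) : ‖γ s - γ t‖ ≤ |s - t| := by
  simpa using norm_sub_le_of_deriv_le h.immersion.differentiable (fun x => (h.speed x).le) s t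

lemma half_le_chord (h : IsUnitSpeed γ) {s t : ℝ} (hst : s < t) {e : ℂ} (he : ‖e‖ = 1)
    (hosc : ∀ x ∈ uIcc s t, ‖deriv γ x - e‖ ≤ 1 / 2) :
    (t - s) / 2 ≤ e.re * (γ t - γ s).re + e.im * (γ t - γ s).im := by
  have h1 := norm_chord_sub_le h hosc
  rw [abs_of_pos (sub_pos.2 hst)] at h1
  have hee : e.re * e.re + e.im * e.im = 1 := by
    rw [← Complex.normSq_apply, ← Complex.sq_norm, he]; norm_num
  set w := γ t - γ s - ((t - s : ℝ) : ℂ) * e with hw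
  have h2 : |((starRingEnd ℂ) e * w).re| ≤ ‖w‖ := by
    refine (Complex.abs_re_le_norm _).trans (le_of_eq ?_)
    rw [norm_mul, Complex.norm_conj, he, one_mul]
  have h3 : ((starRingEnd ℂ) e * w).re
      = e.re * (γ t - γ s).re + e.im * (γ t - γ s).im - (t - s) := by
    have a1 : w.re = (γ t - γ s).re - (t - s) * e.re := by
      rw [hw, Complex.sub_re, Complex.re_ofReal_mul]
    have a2 : w.im = (γ t - γ s).im - (t - s) * e.im := by
      rw [hw, Complex.sub_im, Complex.im_ofReal_mul]
    rw [Complex.mul_re, Complex.conj_re, Complex.conj_im, a1, a2]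
    linear_combination (-(t - s)) * hee
  rw [h3] at h2
  linarith [(abs_le.1 h2).1]

/-- On arcs where the tangent turns little, the difference quotient of the tangent is controlled
by the two tangent-point radii. -/
lemma norm_deriv_sub_le (h : IsUnitSpeed γ) {s t : ℝ}
    (hosc : ∀ x ∈ uIcc s t, ∀ y ∈ uIcc s t, ‖deriv γ x - deriv γ y‖ ≤ 1 / 2) :
    ‖deriv γ s - deriv γ t‖ / |s - t| ≤
      invTangentPointRadius γ t s + invTangentPointRadius γ s t := by
  wlog hst : s ≤ t generalizing s t
  · rw [norm_sub_rev, abs_sub_comm, add_comm]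
    exact this (by rwa [uIcc_comm]) (le_of_not_ge hst)
  rcases hst.eq_or_lt with rfl | hst
  · simpa using add_nonneg (invTangentPointRadius_nonneg γ s s) (invTangentPointRadius_nonneg γ s s)
  have hd : 0 < t - s := sub_pos.2 hst
  have h1 := half_le_chord h hst (h.speed s) fun x hx => hosc x hx s left_mem_uIcc
  have h2 := half_le_chord h hst (h.speed t) fun x hx => hosc x hx t right_mem_uIcc
  have h3 := norm_sub_mul_le_cross (h.speed s) (h.speed t) hd h1 h2
  have h4 : ‖γ t - γ s‖ ≤ t - s := by
    have := h.norm_sub_le t s; rwa [abs_of_pos hd] at this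
  have h5 : 0 < ‖γ t - γ s‖ := by
    refine norm_pos_iff.2 fun h0 => ?_
    rw [h0] at h1; simp at h1; linarith
  rw [invTangentPointRadius_eq h, invTangentPointRadius_eq h, abs_sub_comm, abs_of_pos hd]
  have e1 : |cross (deriv γ t) (γ s - γ t)| = |cross (deriv γ t) (γ t - γ s)| := by
    rw [← abs_neg]; congr 1; unfold cross; simp; ring
  rw [e1, norm_sub_rev (γ s) (γ t), ← add_div, ← mul_add, div_le_div_iff₀ hd (by positivity)]
  have h6 : ‖γ t - γ s‖ ^ 2 ≤ (t - s) * (t - s) := by rw [← sq]; gcongr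
  calc ‖deriv γ s - deriv γ t‖ * ‖γ t - γ s‖ ^ 2
      ≤ ‖deriv γ s - deriv γ t‖ * ((t - s) * (t - s)) := by gcongr
    _ = (‖deriv γ s - deriv γ t‖ * (t - s)) * (t - s) := by ring
    _ ≤ (2 * (|cross (deriv γ s) (γ t - γ s)| + |cross (deriv γ t) (γ t - γ s)|)) * (t - s) := by
        gcongr
    _ = _ := by ring

lemma rpow_quotient_le (h : IsUnitSpeed γ) (hq : 0 < q) {s t : ℝ}
    (hosc : ∀ x ∈ uIcc s t, ∀ y ∈ uIcc s t, ‖deriv γ x - deriv γ y‖ ≤ 1 / 2) :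
    (‖deriv γ s - deriv γ t‖ / |s - t|) ^ q ≤
      2 ^ q * (invTangentPointRadius γ t s ^ q + invTangentPointRadius γ s t ^ q) := by
  have ha := invTangentPointRadius_nonneg γ t s
  have hb := invTangentPointRadius_nonneg γ s t
  have h1 := norm_deriv_sub_le h hosc
  set a := invTangentPointRadius γ t s
  set b := invTangentPointRadius γ s t
  have h2 : a + b ≤ 2 * max a b := by linarith [le_max_left a b, le_max_right a b]
  refine (Real.rpow_le_rpow (by positivity) (h1.trans h2) hq.le).trans ?_
  rw [Real.mul_rpow zero_le_two (ha.trans (le_max_left _ _))]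
  refine mul_le_mul_of_nonneg_left ?_ (by positivity)
  rcases max_choice a b with hm | hm <;> rw [hm]
  · linarith [Real.rpow_nonneg hb q]
  · linarith [Real.rpow_nonneg ha q]

/-- The pointwise estimate behind the regularity theory, in terms of the energy density. -/
lemma ofReal_quotient_le (h : IsUnitSpeed γ) (hq : 0 < q) {s t : ℝ}
    (hosc : ∀ x ∈ uIcc s t, ∀ y ∈ uIcc s t, ‖deriv γ x - deriv γ y‖ ≤ 1 / 2)
    (h1 : (s, t) ∉ cutOut γ δ) (h2 : (t, s) ∉ cutOut γ δ) :
    ENNReal.ofReal ((‖deriv γ s - deriv γ t‖ / |s - t|) ^ q) ≤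
      ENNReal.ofReal (2 ^ q) * (density q δ γ (s, t) + density q δ γ (t, s)) := by
  rw [density_of_notMem h1, density_of_notMem h2]
  have ha := invTangentPointRadius_nonneg γ t s
  have hb := invTangentPointRadius_nonneg γ s t
  rw [← ENNReal.ofReal_add (Real.rpow_nonneg ha q) (Real.rpow_nonneg hb q),
    ← ENNReal.ofReal_mul (by positivity)]
  exact ENNReal.ofReal_le_ofReal (rpow_quotient_le h hq hosc)

end Energy

/-! ### A Morrey estimate and the modulus of continuity of the tangent -/

lemma le_add_rpow_mul {a l q : ℝ} (ha : 0 ≤ a) (hl : 0 < l) (hq : 1 ≤ q) :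
    a ≤ l + l ^ (1 - q) * a ^ q := by
  rcases le_or_gt a l with h | h
  · have : 0 ≤ l ^ (1 - q) * a ^ q := by positivity
    linarith
  · have ha0 : 0 < a := hl.trans h
    have h1 : a ^ (1 - q) ≤ l ^ (1 - q) := Real.rpow_le_rpow_of_nonpos hl h.le (by linarith)
    have h2 : a = a ^ (1 - q) * a ^ q := by
      rw [← Real.rpow_add ha0]; simp
    have h3 : a ^ (1 - q) * a ^ q ≤ l ^ (1 - q) * a ^ q := by gcongr
    linarith

lemma integral_const_add_const_mul {g : ℝ → ℝ} (hg : Continuous g) (k m a b : ℝ) :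
    ∫ x in a..b, (k + m * g x) = k * (b - a) + m * ∫ x in a..b, g x := by
  rw [intervalIntegral.integral_add (by simp)
    ((hg.intervalIntegrable a b).const_mul m), intervalIntegral.integral_const,
    intervalIntegral.integral_const_mul, smul_eq_mul, mul_comm k]

section Morrey

variable {f : ℝ → ℂ} {q M : ℝ}

/-- Averages over an interval and over a half of it are close. -/
lemma norm_average_sub_average_le (hf : Continuous f) (hq : 2 < q) {c d c' d' : ℝ}
    (hcd : c < d) (hc : c ≤ c') (hd : d' ≤ d) (hhalf : d' - c' = (d - c) / 2)
    (hM : ∫ s in c..d, ∫ t in c..d, ‖f s - f t‖ ^ q ≤ M * (d - c) ^ q) :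
    ‖(d - c)⁻¹ • (∫ x in c..d, f x) - (d' - c')⁻¹ • (∫ x in c'..d', f x)‖ ≤
      2 * (1 + M) * (d - c) ^ (1 - 2 / q) := by
  have hl : 0 < d - c := sub_pos.2 hcd
  have hcd' : c' ≤ d' := by linarith
  set l := d - c with hldef
  set β := 1 - 2 / q with hβ
  have hint : ∀ a b, IntervalIntegrable f volume a b := fun a b => hf.intervalIntegrable a b
  have hcont : Continuous (Function.uncurry fun s t => ‖f s - f t‖) := by
    simp only [Function.uncurry_def]; fun_prop
  have hcontq : Continuous (Function.uncurry fun s t => ‖f s - f t‖ ^ q) := by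
    simp only [Function.uncurry_def]
    exact Continuous.rpow_const (by fun_prop) fun _ => Or.inr (by linarith)
  have hc1 : ∀ s, Continuous fun t => ‖f s - f t‖ := fun s => by fun_prop
  have hcq : ∀ s, Continuous fun t => ‖f s - f t‖ ^ q := fun s =>
    (hc1 s).rpow_const fun _ => Or.inr (by linarith)
  have hC1 : Continuous fun s => ∫ t in c..d, ‖f s - f t‖ :=
    intervalIntegral.continuous_parametric_intervalIntegral_of_continuous' hcont _ _
  have hCq : Continuous fun s => ∫ t in c..d, ‖f s - f t‖ ^ q :=
    intervalIntegral.continuous_parametric_intervalIntegral_of_continuous' hcontq _ _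
  have hC' : Continuous fun s => ∫ t in c'..d', (f s - f t) :=
    intervalIntegral.continuous_parametric_intervalIntegral_of_continuous'
      (f := fun s t => f s - f t) (by simp only [Function.uncurry_def]; fun_prop) _ _
  -- the difference of the averages is an average of differences
  have e1 : l⁻¹ • (∫ x in c..d, f x) - (d' - c')⁻¹ • (∫ x in c'..d', f x)
      = (l⁻¹ * (l / 2)⁻¹) • ∫ s in c..d, ∫ t in c'..d', (f s - f t) := by
    have e2 : ∀ s, ∫ t in c'..d', (f s - f t) = (l / 2) • f s - ∫ t in c'..d', f t := fun s => by
      rw [intervalIntegral.integral_sub (by simp) (hint _ _), intervalIntegral.integral_const,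
        hhalf]
    simp only [e2]
    rw [intervalIntegral.integral_sub (f := fun s => (l / 2) • f s)
      ((hf.const_smul (l / 2)).intervalIntegrable _ _) intervalIntegrable_const,
      intervalIntegral.integral_const, intervalIntegral.integral_smul, hhalf, ← hldef]
    have hl0 : (l : ℂ) ≠ 0 := by exact_mod_cast hl.ne'
    simp only [Complex.real_smul]
    push_cast
    field_simp
  have h1 : ‖∫ s in c..d, ∫ t in c'..d', (f s - f t)‖ ≤
      ∫ s in c..d, ∫ t in c..d, ‖f s - f t‖ := by
    refine (intervalIntegral.norm_integral_le_integral_norm hcd.le).trans ?_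
    refine intervalIntegral.integral_mono_on hcd.le (hC'.norm.intervalIntegrable _ _)
      (hC1.intervalIntegrable _ _) fun s _ => ?_
    refine (intervalIntegral.norm_integral_le_integral_norm hcd').trans ?_
    exact intervalIntegral.integral_mono_interval hc hcd' hd
      (Eventually.of_forall fun _ => norm_nonneg _) ((hc1 s).intervalIntegrable _ _)
  -- `a ≤ λ + λ ^ (1 - q) * a ^ q` with `λ = l ^ β` replaces Hölder's inequality; this choice of `λ`
  -- balances the two terms
  have hlam : 0 < l ^ β := Real.rpow_pos_of_pos hl _
  have h2 : ∫ s in c..d, ∫ t in c..d, ‖f s - f t‖ ≤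
      l ^ β * l ^ 2 + (l ^ β) ^ (1 - q) * (M * l ^ q) := by
    calc ∫ s in c..d, ∫ t in c..d, ‖f s - f t‖
        ≤ ∫ s in c..d, (l ^ β * l + (l ^ β) ^ (1 - q) * ∫ t in c..d, ‖f s - f t‖ ^ q) := by
          refine intervalIntegral.integral_mono_on hcd.le (hC1.intervalIntegrable _ _)
            ((continuous_const.add (continuous_const.mul hCq)).intervalIntegrable _ _) fun s _ => ?_
          calc ∫ t in c..d, ‖f s - f t‖
              ≤ ∫ t in c..d, (l ^ β + (l ^ β) ^ (1 - q) * ‖f s - f t‖ ^ q) :=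
                intervalIntegral.integral_mono_on hcd.le ((hc1 s).intervalIntegrable _ _)
                  ((continuous_const.add (continuous_const.mul (hcq s))).intervalIntegrable _ _)
                  fun t _ => le_add_rpow_mul (norm_nonneg _) hlam (by linarith)
            _ = _ := integral_const_add_const_mul (hcq s) _ _ _ _
      _ = l ^ β * l ^ 2 + (l ^ β) ^ (1 - q) *
            ∫ s in c..d, ∫ t in c..d, ‖f s - f t‖ ^ q := by
          rw [integral_const_add_const_mul hCq, ← hldef]; ring
      _ ≤ _ := by gcongr
  have h3 : (l ^ β) ^ (1 - q) * l ^ q = l ^ β * l ^ 2 := by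
    rw [← Real.rpow_mul hl.le, ← Real.rpow_add hl, ← Real.rpow_natCast l 2, ← Real.rpow_add hl]
    congr 1
    rw [hβ]; push_cast
    field_simp
    ring
  rw [e1, norm_smul, Real.norm_eq_abs, abs_of_pos (by positivity)]
  calc l⁻¹ * (l / 2)⁻¹ * ‖∫ s in c..d, ∫ t in c'..d', (f s - f t)‖
      ≤ l⁻¹ * (l / 2)⁻¹ * (l ^ β * l ^ 2 + (l ^ β) ^ (1 - q) * (M * l ^ q)) := by
        gcongr; exact h1.trans h2
    _ = l⁻¹ * (l / 2)⁻¹ * (l ^ β * l ^ 2 + M * ((l ^ β) ^ (1 - q) * l ^ q)) := by ring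
    _ = _ := by rw [h3]; field_simp

/-- The constant in the Morrey estimate. -/
noncomputable def morreyConst (q M : ℝ) : ℝ := 2 * (2 * (1 + M) / (1 - (1 / 2) ^ (1 - 2 / q)))

lemma half_rpow_lt_one (hq : 2 < q) : ((1 : ℝ) / 2) ^ (1 - 2 / q) < 1 := by
  refine Real.rpow_lt_one (by norm_num) (by norm_num) ?_
  rw [sub_pos, div_lt_one (by linarith)]; exact hq

lemma morreyConst_pos (hq : 2 < q) (hM : 0 ≤ M) : 0 < morreyConst q M := by
  have := half_rpow_lt_one hq
  unfold morreyConst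
  have h2 : 0 < 1 - ((1 : ℝ) / 2) ^ (1 - 2 / q) := by linarith
  positivity

lemma norm_average_sub_le (hf : Continuous f) (hq : 2 < q) {a b p : ℝ} (hab : a < b)
    (hp : p ∈ Icc a b) (h : ∀ c d, a ≤ c → c < d → d ≤ b →
      ∫ s in c..d, ∫ t in c..d, ‖f s - f t‖ ^ q ≤ M * (d - c) ^ q) :
    ‖(b - a)⁻¹ • (∫ x in a..b, f x) - f p‖ ≤
      2 * (1 + M) * (b - a) ^ (1 - 2 / q) / (1 - (1 / 2) ^ (1 - 2 / q)) := by
  set β := 1 - 2 / q with hβ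
  have hba : 0 < b - a := sub_pos.2 hab
  -- intervals around `p` shrinking by the factor `1/2`
  set c : ℕ → ℝ := fun k => p + (a - p) * (1 / 2) ^ k with hc
  set d : ℕ → ℝ := fun k => p + (b - p) * (1 / 2) ^ k with hd
  set A : ℕ → ℂ := fun k => (d k - c k)⁻¹ • ∫ x in c k..d k, f x with hA
  have hlen : ∀ k, d k - c k = (b - a) * (1 / 2) ^ k := fun k => by simp only [hc, hd]; ring
  have hpow : ∀ k : ℕ, (0 : ℝ) < (1 / 2) ^ k := fun k => by positivity
  have hpow1 : ∀ k : ℕ, ((1 : ℝ) / 2) ^ k ≤ 1 := fun k => pow_le_one₀ (by norm_num) (by norm_num)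
  have hcd : ∀ k, c k < d k := fun k => by
    have := hlen k; have := mul_pos hba (hpow k); linarith
  have hac : ∀ k, a ≤ c k := fun k => by
    simp only [hc]; nlinarith [hpow1 k, hpow k, hp.1]
  have hdb : ∀ k, d k ≤ b := fun k => by
    simp only [hd]; nlinarith [hpow1 k, hpow k, hp.2]
  have hstep : ∀ k, dist (A k) (A (k + 1)) ≤
      2 * (1 + M) * (b - a) ^ β * ((1 / 2) ^ β) ^ k := fun k => by
    have hcc : c k ≤ c (k + 1) := by
      simp only [hc, pow_succ]; nlinarith [hpow k, hp.1]
    have hdd : d (k + 1) ≤ d k := by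
      simp only [hd, pow_succ]; nlinarith [hpow k, hp.2]
    have := norm_average_sub_average_le hf hq (hcd k) hcc hdd
      (by rw [hlen, hlen, pow_succ]; ring) (h _ _ (hac k) (hcd k) (hdb k))
    rw [dist_eq_norm]
    refine this.trans (le_of_eq ?_)
    rw [hlen, Real.mul_rpow hba.le (hpow k).le, ← Real.rpow_natCast, ← Real.rpow_mul (by norm_num),
      ← Real.rpow_natCast, ← Real.rpow_mul (by norm_num), mul_comm (k : ℝ)]
    ring
  have hlim0 : Tendsto (fun k : ℕ => ((1 : ℝ) / 2) ^ k) atTop (𝓝 0) :=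
    tendsto_pow_atTop_nhds_zero_of_lt_one (by norm_num) (by norm_num)
  have hclim : Tendsto c atTop (𝓝 p) := by
    simpa only [mul_zero, add_zero] using (hlim0.const_mul (a - p)).const_add p
  have hdlim : Tendsto d atTop (𝓝 p) := by
    simpa only [mul_zero, add_zero] using (hlim0.const_mul (b - p)).const_add p
  have hlim : Tendsto A atTop (𝓝 (f p)) := by
    refine Metric.tendsto_atTop'.2 fun ε hε => ?_
    obtain ⟨r, hr, hr'⟩ := Metric.continuousAt_iff.1 (hf.continuousAt (x := p)) (ε / 2)
      (by positivity)
    have hev := (hclim.eventually (Metric.ball_mem_nhds p hr)).and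
      (hdlim.eventually (Metric.ball_mem_nhds p hr))
    obtain ⟨N, hN⟩ := eventually_atTop.1 hev
    refine ⟨N, fun k hk => ?_⟩
    obtain ⟨h1, h2⟩ := hN k hk.le
    have hl := sub_pos.2 (hcd k)
    have e : A k - f p = (d k - c k)⁻¹ • ∫ x in c k..d k, (f x - f p) := by
      rw [intervalIntegral.integral_sub (hf.intervalIntegrable _ _) (by simp),
        intervalIntegral.integral_const, smul_sub, smul_smul, inv_mul_cancel₀ hl.ne', one_smul]
    have hb : ‖∫ x in c k..d k, (f x - f p)‖ ≤ ε / 2 * |d k - c k| := by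
      refine intervalIntegral.norm_integral_le_of_norm_le_const fun x hx => ?_
      rw [uIoc_of_le (hcd k).le] at hx
      rw [← dist_eq_norm]
      refine (hr' ?_).le
      rw [Real.dist_eq, abs_lt] at h1 h2 ⊢
      constructor <;> linarith [hx.1, hx.2]
    rw [dist_eq_norm, e, norm_smul, norm_inv, Real.norm_eq_abs]
    rw [abs_of_pos hl] at hb ⊢
    calc (d k - c k)⁻¹ * ‖∫ x in c k..d k, (f x - f p)‖
        ≤ (d k - c k)⁻¹ * (ε / 2 * (d k - c k)) := by gcongr
      _ = ε / 2 := by field_simp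
      _ < ε := by linarith
  have := dist_le_of_le_geometric_of_tendsto₀ _ _ (half_rpow_lt_one hq) hstep hlim
  have e0 : A 0 = (b - a)⁻¹ • ∫ x in a..b, f x := by simp [hA, hc, hd]
  rwa [e0, dist_eq_norm] at this

/-- A scale invariant Morrey estimate for continuous functions. -/
lemma norm_sub_le_morrey (hf : Continuous f) (hq : 2 < q) {a b : ℝ} (hab : a < b)
    (h : ∀ c d, a ≤ c → c < d → d ≤ b →
      ∫ s in c..d, ∫ t in c..d, ‖f s - f t‖ ^ q ≤ M * (d - c) ^ q) :
    ‖f a - f b‖ ≤ morreyConst q M * (b - a) ^ (1 - 2 / q) := by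
  have h1 := norm_average_sub_le hf hq hab (left_mem_Icc.2 hab.le) h
  have h2 := norm_average_sub_le hf hq hab (right_mem_Icc.2 hab.le) h
  set Z := (b - a)⁻¹ • ∫ x in a..b, f x
  have e : f a - f b = (Z - f b) - (Z - f a) := by ring
  rw [e]
  refine (norm_sub_le _ _).trans ((add_le_add h2 h1).trans (le_of_eq ?_))
  unfold morreyConst; ring

end Morrey

section Modulus

variable {γ : ℝ → ℂ} {q δ : ℝ}

/-- The energy controls the mean oscillation of the tangent on arcs where it turns little. -/
lemma integral_oscillation_le (h : IsUnitSpeed γ) (hq : 0 < q) {c d K : ℝ} (hcd : c ≤ d)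
    (hd1 : d ≤ c + 1) (hK : 0 ≤ K)
    (hosc : ∀ x ∈ Icc c d, ∀ y ∈ Icc c d, ‖deriv γ x - deriv γ y‖ ≤ 1 / 2)
    (hY : ∀ x ∈ Icc c d, ∀ y ∈ Icc c d, (x, y) ∉ cutOut γ δ)
    (hE : truncatedTP q δ γ ≤ ENNReal.ofReal K) :
    ∫ s in c..d, ∫ t in c..d, ‖deriv γ s - deriv γ t‖ ^ q ≤
      2 ^ q * (2 * K) * (d - c) ^ q := by
  set F : ℝ × ℝ → ℝ := fun z => ‖deriv γ z.1 - deriv γ z.2‖ ^ q with hF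
  have hc' := h.immersion.continuous_deriv
  have hFc : Continuous F := Continuous.rpow_const (by fun_prop) fun _ => Or.inr hq.le
  have hFi : IntegrableOn F (Ioc c d ×ˢ Ioc c d) :=
    (hFc.continuousOn.integrableOn_compact (isCompact_Icc.prod isCompact_Icc)).mono_set
      (prod_mono Ioc_subset_Icc_self Ioc_subset_Icc_self)
  have e1 : ∫ s in c..d, ∫ t in c..d, ‖deriv γ s - deriv γ t‖ ^ q
      = ∫ z in Ioc c d ×ˢ Ioc c d, F z := by
    rw [intervalIntegral.integral_of_le hcd]
    simp only [intervalIntegral.integral_of_le hcd]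
    rw [Measure.volume_eq_prod] at hFi ⊢
    rw [setIntegral_prod _ hFi]
  have hF0 : ∀ z, 0 ≤ F z := fun z => by simp only [hF]; positivity
  have hdc : 0 ≤ d - c := sub_nonneg.2 hcd
  rw [e1, ← ENNReal.ofReal_le_ofReal_iff (by positivity),
    ofReal_integral_eq_lintegral_ofReal hFi (Eventually.of_forall hF0)]
  have hpt : ∀ z ∈ Ioc c d ×ˢ Ioc c d, ENNReal.ofReal (F z) ≤
      ENNReal.ofReal ((d - c) ^ q) *
        (ENNReal.ofReal (2 ^ q) * (density q δ γ z + density q δ γ z.swap)) := by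
    rintro ⟨s, t⟩ ⟨hs, ht⟩
    have hs' := Ioc_subset_Icc_self hs
    have ht' := Ioc_subset_Icc_self ht
    have hsub : uIcc s t ⊆ Icc c d := uIcc_subset_Icc hs' ht'
    have h1 := ofReal_quotient_le (δ := δ) h hq
      (fun x hx y hy => hosc x (hsub hx) y (hsub hy)) (hY s hs' t ht') (hY t ht' s hs')
    refine le_trans ?_ (mul_le_mul_right h1 _)
    rw [← ENNReal.ofReal_mul (by positivity), ← Real.mul_rpow hdc (by positivity)]
    refine ENNReal.ofReal_le_ofReal (Real.rpow_le_rpow (norm_nonneg _) ?_ hq.le)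
    rcases eq_or_ne s t with rfl | hne
    · simp
    · have h2 : 0 < |s - t| := abs_pos.2 (sub_ne_zero.2 hne)
      have h3 : |s - t| ≤ d - c := by
        rw [abs_le]; constructor <;> linarith [hs.1, hs.2, ht.1, ht.2]
      simp only
      calc ‖deriv γ s - deriv γ t‖ = |s - t| * (‖deriv γ s - deriv γ t‖ / |s - t|) := by
            field_simp
        _ ≤ _ := by gcongr
  have hm := measurable_density (q := q) (δ := δ) h
  calc ∫⁻ z in Ioc c d ×ˢ Ioc c d, ENNReal.ofReal (F z)
      ≤ ∫⁻ z in Ioc c d ×ˢ Ioc c d, ENNReal.ofReal ((d - c) ^ q) *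
        (ENNReal.ofReal (2 ^ q) * (density q δ γ z + density q δ γ z.swap)) :=
        setLIntegral_mono' (measurableSet_Ioc.prod measurableSet_Ioc) hpt
    _ = ENNReal.ofReal ((d - c) ^ q) * (ENNReal.ofReal (2 ^ q) *
        ((∫⁻ z in Ioc c d ×ˢ Ioc c d, density q δ γ z) +
          ∫⁻ z in Ioc c d ×ˢ Ioc c d, density q δ γ z.swap)) := by
        rw [lintegral_const_mul' _ _ ENNReal.ofReal_ne_top,
          lintegral_const_mul' _ _ ENNReal.ofReal_ne_top, lintegral_add_left hm]
    _ ≤ ENNReal.ofReal ((d - c) ^ q) * (ENNReal.ofReal (2 ^ q) *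
        (ENNReal.ofReal K + ENNReal.ofReal K)) := by
        gcongr
        · exact (lintegral_density_le h (prod_mono (Ioc_subset_Ioc_right hd1)
            (Ioc_subset_Ioc_right hd1))).trans hE
        · exact (lintegral_density_swap_le h hd1 hd1).trans hE
    _ = _ := by
        rw [← ENNReal.ofReal_add hK hK, ← ENNReal.ofReal_mul (by positivity),
          ← ENNReal.ofReal_mul (by positivity)]
        congr 1; ring

/-- An energy bound yields a uniform modulus of continuity of the tangent.  The scale on which
the tangent turns by a small angle only is found by a continuity argument. -/
theorem exists_modulus (hq : 2 < q) {η K : ℝ} (hη : 0 < η) (hK : 0 ≤ K) :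
    ∃ r > 0, ∃ C, ∀ (γ : ℝ → ℂ) (δ : ℝ), IsUnitSpeed γ →
      (∀ s t, |s - t| ≤ η → (s, t) ∉ cutOut γ δ) → truncatedTP q δ γ ≤ ENNReal.ofReal K →
      ∀ s t, |s - t| ≤ r → ‖deriv γ s - deriv γ t‖ ≤ C * |s - t| ^ (1 - 2 / q) := by
  set β := 1 - 2 / q with hβ
  have hβ0 : 0 < β := by rw [hβ, sub_pos, div_lt_one (by linarith)]; exact hq
  set C := morreyConst q (2 ^ q * (2 * K)) with hC
  have hC0 : 0 < C := morreyConst_pos hq (by positivity)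
  obtain ⟨r₁, hr₁, hr₁C⟩ : ∃ r₁ > 0, ∀ x, 0 ≤ x → x ≤ r₁ → C * x ^ β < 1 / 4 := by
    refine ⟨(1 / (8 * C)) ^ β⁻¹, by positivity, fun x hx0 hx => ?_⟩
    have h1 : x ^ β ≤ 1 / (8 * C) := by
      calc x ^ β ≤ ((1 / (8 * C)) ^ β⁻¹) ^ β := Real.rpow_le_rpow hx0 hx hβ0.le
        _ = 1 / (8 * C) := by
          rw [← Real.rpow_mul (by positivity), inv_mul_cancel₀ hβ0.ne', Real.rpow_one]
    calc C * x ^ β ≤ C * (1 / (8 * C)) := by gcongr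
      _ = 1 / 8 := by field_simp
      _ < 1 / 4 := by norm_num
  refine ⟨min (min η 1) r₁, by positivity, C, fun γ δ h hY hE => ?_⟩
  have hc' := h.immersion.continuous_deriv
  -- the Morrey estimate holds wherever the tangent turns little
  have key : ∀ a b, a < b → b - a ≤ min (min η 1) r₁ →
      (∀ x ∈ Icc a b, ‖deriv γ x - deriv γ a‖ ≤ 1 / 4) →
      ‖deriv γ a - deriv γ b‖ ≤ C * (b - a) ^ β := fun a b hab hr hosc => by
    have hbη : b - a ≤ η := hr.trans ((min_le_left _ _).trans (min_le_left _ _))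
    have hb1 : b - a ≤ 1 := hr.trans ((min_le_left _ _).trans (min_le_right _ _))
    refine norm_sub_le_morrey hc' hq hab fun c d hac hcd hdb => ?_
    have hsub : Icc c d ⊆ Icc a b := Icc_subset_Icc hac hdb
    refine integral_oscillation_le h (by linarith) hcd.le (by linarith) hK (fun x hx y hy => ?_)
      (fun x hx y hy => hY x y ?_) hE
    · have e : deriv γ x - deriv γ y
          = (deriv γ x - deriv γ a) - (deriv γ y - deriv γ a) := by ring
      rw [e]
      exact (norm_sub_le _ _).trans (by linarith [hosc x (hsub hx), hosc y (hsub hy)])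
    · rw [abs_le]; constructor <;> linarith [hx.1, hx.2, hy.1, hy.2]
  have osc : ∀ a b, a ≤ b → b - a ≤ min (min η 1) r₁ →
      ∀ x ∈ Icc a b, ‖deriv γ x - deriv γ a‖ ≤ 1 / 4 := by
    intro a b hab hr
    by_contra hcon
    push Not at hcon
    obtain ⟨x₀, hx₀, hlt⟩ := hcon
    set g : ℝ → ℝ := fun x => ‖deriv γ x - deriv γ a‖ with hg
    have hgc : Continuous g := by simp only [hg]; fun_prop
    have hcomp : IsCompact (Icc a b ∩ {x | 1 / 4 ≤ g x}) :=
      isCompact_Icc.inter_right (isClosed_le continuous_const hgc)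
    -- the first parameter `y` at which the tangent has turned by `1/4`; up to `y` the Morrey
    -- estimate applies and gives strictly less
    obtain ⟨y, ⟨hyI, hy⟩, hleast⟩ := hcomp.exists_isLeast ⟨x₀, hx₀, hlt.le⟩
    have hy4 : 1 / 4 ≤ g y := hy
    have hay : a < y := by
      rcases hyI.1.eq_or_lt with he | hlt
      · rw [← he] at hy4; simp [hg] at hy4; norm_num at hy4
      · exact hlt
    have hbefore : ∀ x ∈ Ico a y, g x ≤ 1 / 4 := fun x hx => by
      by_contra hx4
      push Not at hx4
      have := hleast ⟨⟨hx.1, hx.2.le.trans hyI.2⟩, hx4.le⟩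
      linarith [hx.2]
    have hy' : g y ≤ 1 / 4 := by
      refine le_of_tendsto (hgc.continuousAt.mono_left (nhdsWithin_le_nhds (s := Iio y))) ?_
      filter_upwards [Ioo_mem_nhdsLT hay] with x hx
      exact hbefore x ⟨hx.1.le, hx.2⟩
    have hall : ∀ x ∈ Icc a y, ‖deriv γ x - deriv γ a‖ ≤ 1 / 4 := fun x hx => by
      rcases hx.2.eq_or_lt with rfl | hlt
      · exact hy'
      · exact hbefore x ⟨hx.1, hlt⟩
    have hyr : y - a ≤ min (min η 1) r₁ := by linarith [hyI.2]
    have h1 := key a y hay hyr hall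
    have h2 := hr₁C (y - a) (by linarith) (hyr.trans (min_le_right _ _))
    rw [norm_sub_rev] at h1
    linarith
  intro s t hst
  wlog hle : s ≤ t generalizing s t
  · rw [norm_sub_rev, abs_sub_comm]
    exact this t s (by rwa [abs_sub_comm]) (le_of_not_ge hle)
  rcases hle.eq_or_lt with rfl | hlt
  · simp [Real.zero_rpow hβ0.ne']
  · rw [abs_sub_comm, abs_of_pos (sub_pos.2 hlt)] at hst ⊢
    exact key s t hlt hst (osc s t hle hst)

end Modulus

/-! ### Membership in the fractional Sobolev space -/

section Sobolev

variable {γ : ℝ → ℂ} {q δ η : ℝ}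

lemma memLp_of_periodic {f : ℝ → ℂ} (hf : Continuous f) (hp : Function.Periodic f 1)
    (p : ℝ≥0∞) : MemLp f p (volume.restrict (Ioc (0 : ℝ) 1)) := by
  obtain ⟨M, -, hM⟩ := exists_norm_le_of_periodic hf hp
  exact MemLp.of_bound hf.aestronglyMeasurable M (Eventually.of_forall hM)

lemma IsImmersion.isWeakDeriv (h : IsImmersion γ) : IsWeakDeriv γ (deriv γ) := by
  intro φ hφ hφp
  have hφd : Differentiable ℝ φ := hφ.differentiable (by simp)
  have hφc' : Continuous (deriv φ) := hφ.continuous_deriv (by simp)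
  have hγc := h.contDiff.continuous
  have hγc' := h.continuous_deriv
  have hφc := hφd.continuous
  have hd : ∀ x ∈ uIcc (0 : ℝ) 1, HasDerivAt (fun x => φ x • γ x)
      (φ x • deriv γ x + deriv φ x • γ x) x := fun x _ =>
    (hφd x).hasDerivAt.smul (h.differentiable x).hasDerivAt
  have c1 : Continuous fun x => φ x • deriv γ x := by fun_prop
  have c2 : Continuous fun x => deriv φ x • γ x := by fun_prop
  have h1 := intervalIntegral.integral_eq_sub_of_hasDerivAt hd
    ((c1.add c2).intervalIntegrable _ _)
  rw [intervalIntegral.integral_add (c1.intervalIntegrable _ _) (c2.intervalIntegrable _ _)] at h1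
  have e1 := hφp 0
  have e2 := h.periodic 0
  rw [zero_add] at e1 e2
  rw [e1, e2, sub_self] at h1
  exact eq_neg_of_add_eq_zero_right h1

lemma IsImmersion.mem_fractionalSobolev (h : IsImmersion γ) {σ : ℝ}
    (hg : gagliardo σ q (deriv γ) < ∞) : γ ∈ fractionalSobolev σ q :=
  ⟨h.periodic, memLp_of_periodic h.contDiff.continuous h.periodic _, deriv γ,
    periodic_deriv h.periodic, memLp_of_periodic h.continuous_deriv (periodic_deriv h.periodic) _,
    h.isWeakDeriv, hg⟩

lemma gagliardo_eq (hq : 0 < q) (g : ℝ → ℂ) : gagliardo (1 - 1 / q) q g =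
    ∫⁻ x in Ioc (0 : ℝ) 1, ∫⁻ w in Ioc (-(1 / 2) : ℝ) (1 / 2),
      ENNReal.ofReal ((‖g (x + w) - g x‖ / |w|) ^ q) := by
  unfold gagliardo
  have e : 1 + (1 - 1 / q) * q = q := by field_simp; ring
  simp only [e, Real.div_rpow (norm_nonneg _) (abs_nonneg _)]

lemma lintegral_lintegral_const (c : ℝ≥0∞) :
    ∫⁻ _x in Ioc (0 : ℝ) 1, ∫⁻ _w in Ioc (-(1 / 2) : ℝ) (1 / 2), c = c := by
  simp only [setLIntegral_const, Real.volume_Ioc]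
  norm_num

lemma mem_fractionalSobolev_of_lipschitz (h : IsImmersion γ) (hq : 0 < q)
    (hl : ∃ K, LipschitzWith K (deriv γ)) : γ ∈ fractionalSobolev (1 - 1 / q) q := by
  obtain ⟨K, hK⟩ := hl
  refine h.mem_fractionalSobolev ?_
  rw [gagliardo_eq hq]
  refine lt_of_le_of_lt ?_ (ENNReal.ofReal_lt_top (r := (K : ℝ) ^ q))
  rw [← lintegral_lintegral_const (ENNReal.ofReal ((K : ℝ) ^ q))]
  refine lintegral_mono fun x => lintegral_mono fun w => ?_
  refine ENNReal.ofReal_le_ofReal (Real.rpow_le_rpow (by positivity) ?_ hq.le)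
  have := hK.dist_le_mul (x + w) x
  rw [dist_eq_norm, Real.dist_eq, add_sub_cancel_left] at this
  exact div_le_of_le_mul₀ (abs_nonneg _) K.2 this

lemma lintegral_shift {F : ℝ → ℝ≥0∞} (hF : ∀ (x : ℝ) (k : ℤ), F (x + k) = F x) (x : ℝ) :
    ∫⁻ w in Ioc (-(1 / 2) : ℝ) (1 / 2), F (x + w) = ∫⁻ y in Ioc (0 : ℝ) (0 + 1), F y := by
  have h := (measurePreserving_add_left volume x).setLIntegral_comp_preimage_emb
    (measurableEmbedding_addLeft x) F (Ioc (x - 1 / 2) (x - 1 / 2 + 1))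
  rw [preimage_const_add_Ioc] at h
  have e1 : x - 1 / 2 - x = -(1 / 2) := by ring
  have e2 : x - 1 / 2 + 1 - x = 1 / 2 := by ring
  rw [e1, e2] at h
  rw [h]
  exact lintegral_Ioc_of_periodic hF _ _

/-- A closed curve of finite energy and unit speed whose cut-out set stays away from the diagonal
belongs to `W^{2-1/q,q}`. -/
theorem mem_fractionalSobolev_of_energy (h : IsUnitSpeed γ) (hq : 0 < q) (hη : 0 < η)
    (hY : ∀ s t, |s - t| ≤ η → (s, t) ∉ cutOut γ δ) (hE : truncatedTP q δ γ ≠ ∞) :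
    γ ∈ fractionalSobolev (1 - 1 / q) q := by
  have hc' := h.immersion.continuous_deriv
  refine h.immersion.mem_fractionalSobolev ?_
  obtain ⟨r, hr, hosc⟩ := uniformContinuous_of_periodic hc' (periodic_deriv h.immersion.periodic)
    (ε := 1 / 2) (by norm_num)
  set r₁ := min r η with hr₁
  have hr₁0 : 0 < r₁ := by positivity
  have hm := measurable_density (q := q) (δ := δ) h
  rw [gagliardo_eq hq]
  set c := ENNReal.ofReal ((2 / r₁) ^ q) with hc
  have hpt : ∀ x w, ENNReal.ofReal ((‖deriv γ (x + w) - deriv γ x‖ / |w|) ^ q) ≤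
      c + ENNReal.ofReal (2 ^ q) * (density q δ γ (x + w, x) + density q δ γ (x, x + w)) := by
    intro x w
    -- for small `|w|` the tangents turn little and the energy density controls the quotient;
    -- otherwise the quotient is bounded
    rcases le_or_gt |w| r₁ with hw | hw
    · refine le_add_left ?_
      have hw' : |x + w - x| ≤ r₁ := by rwa [add_sub_cancel_left]
      have hw'' : |x - (x + w)| ≤ r₁ := by rwa [abs_sub_comm]
      have := ofReal_quotient_le (q := q) (δ := δ) h hq (s := x + w) (t := x) (fun a ha b hb => ?_)
        (hY _ _ (hw'.trans (min_le_right _ _))) (hY _ _ (hw''.trans (min_le_right _ _)))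
      · rwa [add_sub_cancel_left] at this
      · refine hosc a b ?_
        rw [abs_sub_comm a b]
        exact (abs_sub_le_of_uIcc_subset_uIcc (uIcc_subset_uIcc ha hb)).trans
          (hw''.trans (min_le_left _ _))
    · refine le_add_right (ENNReal.ofReal_le_ofReal (Real.rpow_le_rpow (by positivity) ?_ hq.le))
      have : ‖deriv γ (x + w) - deriv γ x‖ ≤ 2 := (norm_sub_le _ _).trans (by
        rw [h.speed, h.speed]; norm_num)
      gcongr
  have e1 : ∀ x, ∫⁻ w in Ioc (-(1 / 2) : ℝ) (1 / 2), density q δ γ (x + w, x)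
      = ∫⁻ y in Ioc (0 : ℝ) (0 + 1), density q δ γ (y, x) := fun x =>
    lintegral_shift (F := fun y => density q δ γ (y, x)) (fun y k => by
      simpa using density_add_int (q := q) (δ := δ) h y x k 0) x
  have e2 : ∀ x, ∫⁻ w in Ioc (-(1 / 2) : ℝ) (1 / 2), density q δ γ (x, x + w)
      = ∫⁻ y in Ioc (0 : ℝ) (0 + 1), density q δ γ (x, y) := fun x =>
    lintegral_shift (F := fun y => density q δ γ (x, y)) (fun y k => by
      simpa using density_add_int (q := q) (δ := δ) h x y 0 k) x
  have hm2 : Measurable fun z : ℝ × ℝ => density q δ γ z.swap := hm.comp measurable_swap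
  have i1 : ∫⁻ x in Ioc (0 : ℝ) 1, ∫⁻ y in Ioc (0 : ℝ) (0 + 1), density q δ γ (y, x)
      ≤ truncatedTP q δ γ := by
    have := lintegral_density_swap_le (q := q) (δ := δ) h (a := 0) (b := 1) (c := 0) (d := 0 + 1)
      (by norm_num) le_rfl
    rwa [Measure.volume_eq_prod, setLIntegral_prod _ hm2.aemeasurable] at this
  have i2 : ∫⁻ x in Ioc (0 : ℝ) 1, ∫⁻ y in Ioc (0 : ℝ) (0 + 1), density q δ γ (x, y)
      ≤ truncatedTP q δ γ := by
    have := lintegral_density_le (q := q) (δ := δ) h (a := 0) (b := 0)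
      (S := Ioc (0 : ℝ) 1 ×ˢ Ioc (0 : ℝ) (0 + 1))
      (prod_mono (Ioc_subset_Ioc_right (by norm_num)) le_rfl)
    rwa [Measure.volume_eq_prod, setLIntegral_prod _ hm.aemeasurable] at this
  have mm1 : ∀ x, Measurable fun w => density q δ γ (x + w, x) := fun x =>
    hm.comp (by fun_prop)
  have mm2 : ∀ x, Measurable fun w => density q δ γ (x, x + w) := fun x =>
    hm.comp (by fun_prop)
  have mi1 : Measurable fun x => ∫⁻ y in Ioc (0 : ℝ) (0 + 1), density q δ γ (y, x) :=
    hm2.lintegral_prod_right' (ν := volume.restrict (Ioc (0 : ℝ) (0 + 1)))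
  calc ∫⁻ x in Ioc (0 : ℝ) 1, ∫⁻ w in Ioc (-(1 / 2) : ℝ) (1 / 2),
        ENNReal.ofReal ((‖deriv γ (x + w) - deriv γ x‖ / |w|) ^ q)
      ≤ ∫⁻ x in Ioc (0 : ℝ) 1, ∫⁻ w in Ioc (-(1 / 2) : ℝ) (1 / 2), (c + ENNReal.ofReal (2 ^ q) *
          (density q δ γ (x + w, x) + density q δ γ (x, x + w))) :=
        lintegral_mono fun x => lintegral_mono fun w => hpt x w
    _ = ∫⁻ x in Ioc (0 : ℝ) 1, (c + ENNReal.ofReal (2 ^ q) *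
          ((∫⁻ y in Ioc (0 : ℝ) (0 + 1), density q δ γ (y, x)) +
            ∫⁻ y in Ioc (0 : ℝ) (0 + 1), density q δ γ (x, y))) := by
        refine lintegral_congr fun x => ?_
        rw [lintegral_add_left measurable_const, lintegral_const_mul' _ _ ENNReal.ofReal_ne_top,
          lintegral_add_left (mm1 x), e1, e2, setLIntegral_const, Real.volume_Ioc]
        norm_num
    _ = c + ENNReal.ofReal (2 ^ q) *
          ((∫⁻ x in Ioc (0 : ℝ) 1, ∫⁻ y in Ioc (0 : ℝ) (0 + 1), density q δ γ (y, x)) +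
            ∫⁻ x in Ioc (0 : ℝ) 1, ∫⁻ y in Ioc (0 : ℝ) (0 + 1), density q δ γ (x, y)) := by
        rw [lintegral_add_left measurable_const, lintegral_const_mul' _ _ ENNReal.ofReal_ne_top,
          lintegral_add_left mi1, setLIntegral_const, Real.volume_Ioc]
        norm_num
    _ ≤ c + ENNReal.ofReal (2 ^ q) * (truncatedTP q δ γ + truncatedTP q δ γ) := by
        gcongr
    _ < ∞ := by
        refine ENNReal.add_lt_top.2 ⟨ENNReal.ofReal_lt_top, ENNReal.mul_lt_top
          ENNReal.ofReal_lt_top (ENNReal.add_lt_top.2 ⟨hE.lt_top, hE.lt_top⟩)⟩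

/-! ### Separation of branches away from the cut-out set -/

/-- For separated double parameters the cut-out set stays away from the diagonal. -/
lemma notMem_cutOut_of_abs_le (h : IsUnitSpeed γ) (hδη : δ ≤ η / 2)
    (hgap : ∀ a b a' b', IsDouble γ a a' → IsDouble γ b b' →
      (∀ k : ℤ, a - b ≠ k) → 2 * η ≤ circ (a - b)) {s t : ℝ} (hst : |s - t| ≤ η) :
    (s, t) ∉ cutOut γ δ := by
  rw [mem_cutOut_iff h.immersion.periodic h.speed]
  rintro ⟨u, v, huv, h1, h2⟩
  simp only at h1 h2
  have h3 := hgap u v v u huv huv.symm huv.2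
  have h4 := circ_triangle u s v
  have h5 := circ_triangle s t v
  have h6 := circ_le_abs (s - t)
  rw [circ_sub_comm] at h1
  linarith

lemma hasDerivAt_normSq_sub (h : IsImmersion γ) (p : ℂ) (y : ℝ) :
    HasDerivAt (fun y => Complex.normSq (p - γ y))
      (-2 * ((p - γ y).re * (deriv γ y).re + (p - γ y).im * (deriv γ y).im)) y := by
  have hd := (h.differentiable y).hasDerivAt
  have h1 : HasDerivAt (fun y => (p - γ y).re) (-(deriv γ y).re) y := by
    have := Complex.reCLM.hasFDerivAt.comp_hasDerivAt y (hd.const_sub p)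
    simpa [Function.comp_def] using this
  have h2 : HasDerivAt (fun y => (p - γ y).im) (-(deriv γ y).im) y := by
    have := Complex.imCLM.hasFDerivAt.comp_hasDerivAt y (hd.const_sub p)
    simpa [Function.comp_def] using this
  simp only [Complex.normSq_apply]
  exact ((h1.mul h1).add (h2.mul h2)).congr_deriv (by ring)

/-- A chord that is minimal with respect to its second end point is perpendicular to the tangent
there, and this persists approximately for all neighbouring chords. -/
lemma inv_le_invTangentPointRadius (h : IsUnitSpeed γ) {x y s t l : ℝ} (hl : 0 < l)
    (hxy : ‖γ x - γ y‖ = l)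
    (hperp : (γ x - γ y).re * (deriv γ y).re + (γ x - γ y).im * (deriv γ y).im = 0)
    (hosc : ‖deriv γ t - deriv γ y‖ ≤ 1 / 4) (hs : |s - x| ≤ l / 10) (ht : |t - y| ≤ l / 10) :
    1 / (4 * l) ≤ invTangentPointRadius γ t s := by
  rw [invTangentPointRadius_eq h]
  set c := γ x - γ y with hc
  set e := deriv γ y with he
  have hee : e.re * e.re + e.im * e.im = 1 := by
    rw [← Complex.normSq_apply, ← Complex.sq_norm, he, h.speed]; norm_num
  have hcc : c.re * c.re + c.im * c.im = l ^ 2 := by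
    rw [← Complex.normSq_apply, ← Complex.sq_norm, hxy]
  have h1 : |cross e c| = l := by
    rw [← abs_of_pos hl]
    refine (sq_eq_sq_iff_abs_eq_abs _ _).1 ?_
    rw [← hcc]; unfold cross
    linear_combination (c.re * c.re + c.im * c.im) * hee
      - (c.re * e.re + c.im * e.im) * hperp
  have a1 := h.norm_sub_le s x
  have a2 := h.norm_sub_le y t
  rw [abs_sub_comm y t] at a2
  set R := (γ s - γ x) + (γ y - γ t) with hR
  have hRn : ‖R‖ ≤ l / 5 := (norm_add_le _ _).trans (by linarith)
  have e1 : γ s - γ t = c + R := by rw [hc, hR]; ring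
  have hn : ‖γ t - γ s‖ ≤ 6 / 5 * l := by
    rw [norm_sub_rev, e1]; exact (norm_add_le _ _).trans (by linarith)
  have e2 : cross (deriv γ t) (γ s - γ t)
      = cross e c + cross (deriv γ t - e) c + cross (deriv γ t) R := by
    rw [e1]; unfold cross; simp; ring
  have h2 : |cross (deriv γ t - e) c| ≤ 1 / 4 * l := by
    refine (norm_cross_le _ _).trans ?_
    rw [hxy]; gcongr
  have h3 : |cross (deriv γ t) R| ≤ l / 5 := by
    refine (norm_cross_le _ _).trans ?_
    rw [h.speed, one_mul]; exact hRn
  have h4 : l / 2 ≤ |cross (deriv γ t) (γ s - γ t)| := by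
    rw [e2]
    have b1 := abs_sub_abs_le_abs_add (cross e c) (cross (deriv γ t - e) c + cross (deriv γ t) R)
    have b2 := abs_add_le (cross (deriv γ t - e) c) (cross (deriv γ t) R)
    rw [← add_assoc] at b1
    linarith
  have h5 : 0 < ‖γ t - γ s‖ := by
    rw [norm_sub_rev]
    refine norm_pos_iff.2 fun h0 => ?_
    rw [h0] at h4; simp [cross] at h4; linarith
  rw [div_le_div_iff₀ (by positivity) (by positivity)]
  nlinarith

/-- Two points of the curve whose parameters are away from the cut-out set and from the diagonal
cannot be close, in terms of the energy: the energy of two branches at distance `l` is at least of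
the order `l ^ (2 - q)`. -/
theorem exists_separation (hq : 2 < q) (K : ℝ) : ∃ l₀ > 0, ∀ (γ : ℝ → ℂ) (δ : ℝ),
    IsUnitSpeed γ → 0 < δ → truncatedTP q δ γ ≤ ENNReal.ofReal K → ∀ (x y ρ : ℝ), ρ ≤ 1 →
      (∀ s t, |s - x| ≤ ρ → |t - y| ≤ ρ → (s, t) ∉ cutOut γ δ) → ρ < circ (x - y) →
      (∀ s t, |s - y| ≤ ρ → |t - y| ≤ ρ → ‖deriv γ s - deriv γ t‖ ≤ 1 / 4) →
      min (ρ / 8) l₀ ≤ ‖γ x - γ y‖ := by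
  obtain ⟨l₀, hl₀, hl₀'⟩ : ∃ l₀ > 0, ∀ l, 0 < l → l < l₀ →
      K < (1 / (4 * l)) ^ q * (l / 5) ^ 2 := by
    have h1 : Tendsto (fun l : ℝ => (1 / (4 * l)) ^ q * (l / 5) ^ 2) (𝓝[>] 0) atTop := by
      have h2 : Tendsto (fun l : ℝ => ((1 / 4) ^ q / 25) * (l⁻¹) ^ (q - 2)) (𝓝[>] 0) atTop :=
        ((tendsto_rpow_atTop (by linarith)).comp tendsto_inv_nhdsGT_zero).const_mul_atTop
          (by positivity)
      refine h2.congr' ?_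
      filter_upwards [self_mem_nhdsWithin] with l hl
      have hl' : (0 : ℝ) < l := hl
      rw [Real.rpow_sub (inv_pos.2 hl'), show 1 / (4 * l) = 1 / 4 * l⁻¹ by field_simp,
        Real.mul_rpow (by norm_num) (by positivity)]
      rw [show (2 : ℝ) = ((2 : ℕ) : ℝ) by norm_num, Real.rpow_natCast]
      field_simp
      norm_num
    have h3 := h1.eventually_gt_atTop K
    rw [eventually_nhdsWithin_iff, Metric.eventually_nhds_iff] at h3
    obtain ⟨ε, hε, h4⟩ := h3
    exact ⟨ε, hε, fun l hl hlε => h4 (by simpa [abs_of_pos hl] using hlε) hl⟩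
  refine ⟨l₀, hl₀, fun γ δ h hδ hE x y ρ hρ1 hY hxy hosc => ?_⟩
  by_contra hcon
  push Not at hcon
  obtain ⟨hcρ, hcl⟩ := lt_min_iff.1 hcon
  set l := ‖γ x - γ y‖ with hl
  have hp := h.immersion.periodic
  -- there is no double point nearby
  have hne : ∀ t, |t - y| ≤ ρ → γ x ≠ γ t := by
    intro t ht he
    have hρ0 : 0 ≤ ρ := (abs_nonneg _).trans ht
    refine hY x t (by simpa using hρ0) ht ((mem_cutOut_iff hp h.speed).2
      ⟨x, t, ⟨he, ?_⟩, ?_, ?_⟩)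
    · refine ne_int_of_circ_pos ?_
      have h1 := circ_triangle x t y
      have h2 := circ_le_abs (t - y)
      linarith
    · simpa [circ_zero] using hδ
    · simpa [circ_zero] using hδ
  have hρ0 : 0 < ρ := by
    have : 0 ≤ l := norm_nonneg _
    linarith
  have hl0 : 0 < l := norm_pos_iff.2 (sub_ne_zero.2 (hne y (by simpa using hρ0.le)))
  -- the point of the second branch next to `γ x`
  have hyc := h.immersion.contDiff.continuous
  obtain ⟨z, hz, hmin⟩ := (isCompact_Icc (a := y - 3 * l) (b := y + 3 * l)).exists_isMinOn
    ⟨y, by constructor <;> linarith⟩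
    (f := fun y => Complex.normSq (γ x - γ y))
    (Complex.continuous_normSq.comp (continuous_const.sub hyc)).continuousOn
  have hzy : |z - y| ≤ 3 * l := by rw [abs_le]; constructor <;> linarith [hz.1, hz.2]
  have hzl : ‖γ x - γ z‖ ≤ l := by
    have := hmin (show y ∈ Icc (y - 3 * l) (y + 3 * l) by constructor <;> linarith)
    simp only [mem_ofPred_eq, ← Complex.sq_norm] at this
    exact (pow_le_pow_iff_left₀ (norm_nonneg _) (norm_nonneg _) two_ne_zero).1 this
  -- the tangent turns little, so after length `3 l` the branch has moved away by more than `2 l`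
  have hfar : ∀ w, |w - y| = 3 * l → l < ‖γ x - γ w‖ := by
    intro w hw
    have h1 := norm_chord_sub_le h (s := y) (t := w) (e := deriv γ y) (ε := 1 / 4) fun a ha => by
      have h2 : |a - y| ≤ |w - y| := abs_sub_left_of_mem_uIcc ha
      exact hosc a y (by rw [hw] at h2; linarith) (by simpa using hρ0.le)
    have h3 : ‖((w - y : ℝ) : ℂ) * deriv γ y‖ = 3 * l := by
      rw [norm_mul, h.speed, mul_one, Complex.norm_real, Real.norm_eq_abs, hw]
    have h4 : ‖((w - y : ℝ) : ℂ) * deriv γ y‖ ≤ ‖γ w - γ y - ((w - y : ℝ) : ℂ) * deriv γ y‖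
        + ‖γ x - γ y‖ + ‖γ x - γ w‖ := by
      have e : ((w - y : ℝ) : ℂ) * deriv γ y =
          -(γ w - γ y - ((w - y : ℝ) : ℂ) * deriv γ y) + (γ x - γ y) - (γ x - γ w) := by ring
      nth_rw 1 [e]
      refine (norm_sub_le _ _).trans (add_le_add_left ((norm_add_le _ _).trans ?_) _)
      rw [norm_neg]
    rw [hw] at h1
    linarith
  have hzI : z ∈ Ioo (y - 3 * l) (y + 3 * l) := by
    refine ⟨lt_of_le_of_ne hz.1 fun he => ?_, lt_of_le_of_ne hz.2 fun he => ?_⟩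
    · have := hfar z (by rw [← he, sub_sub_cancel_left, abs_neg, abs_of_pos (by linarith)])
      linarith
    · have := hfar z (by rw [he, add_sub_cancel_left, abs_of_pos (by linarith)])
      linarith
  have hloc : IsLocalMin (fun y => Complex.normSq (γ x - γ y)) z :=
    hmin.isLocalMin (Icc_mem_nhds hzI.1 hzI.2)
  have hperp := hloc.hasDerivAt_eq_zero (hasDerivAt_normSq_sub h.immersion (γ x) z)
  have hzρ : |z - y| ≤ ρ := by linarith
  set m := ‖γ x - γ z‖ with hm
  have hm0 : 0 < m := norm_pos_iff.2 (sub_ne_zero.2 (hne z hzρ))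
  -- the energy density is at least `(4 m) ^ (-q)` on a square of side length `m / 5`
  set S := Ioc (x - m / 10) (x + m / 10) ×ˢ Ioc (z - m / 10) (z + m / 10) with hS
  have hSbd : ∀ p ∈ S, ENNReal.ofReal ((1 / (4 * m)) ^ q) ≤ density q δ γ p := by
    rintro ⟨s, t⟩ ⟨hs, ht⟩
    simp only at hs ht
    have hs' : |s - x| ≤ m / 10 := by rw [abs_le]; constructor <;> linarith [hs.1, hs.2]
    have ht' : |t - z| ≤ m / 10 := by rw [abs_le]; constructor <;> linarith [ht.1, ht.2]
    have hty : |t - y| ≤ ρ := by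
      have := abs_sub_le t z y; linarith
    rw [density_of_notMem (hY s t (by linarith) hty)]
    refine ENNReal.ofReal_le_ofReal (Real.rpow_le_rpow (by positivity) ?_ (by linarith))
    exact inv_le_invTangentPointRadius h hm0 rfl (by linarith) (hosc t z hty hzρ) hs' ht'
  have hvol : volume S = ENNReal.ofReal ((m / 5) ^ 2) := by
    rw [hS, Measure.volume_eq_prod, Measure.prod_prod, Real.volume_Ioc, Real.volume_Ioc,
      ← ENNReal.ofReal_mul (by linarith)]
    congr 1; ring
  have hlow : ENNReal.ofReal ((1 / (4 * m)) ^ q * (m / 5) ^ 2) ≤ ENNReal.ofReal K := by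
    calc ENNReal.ofReal ((1 / (4 * m)) ^ q * (m / 5) ^ 2)
        = ∫⁻ _p in S, ENNReal.ofReal ((1 / (4 * m)) ^ q) := by
          rw [setLIntegral_const, hvol, ENNReal.ofReal_mul (by positivity)]
      _ ≤ ∫⁻ p in S, density q δ γ p :=
          setLIntegral_mono' (measurableSet_Ioc.prod measurableSet_Ioc) hSbd
      _ ≤ truncatedTP q δ γ := lintegral_density_le h (a := x - m / 10) (b := z - m / 10)
          (prod_mono (Ioc_subset_Ioc_right (by linarith)) (Ioc_subset_Ioc_right (by linarith)))
      _ ≤ _ := hE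
  have h1 := hl₀' m hm0 (by linarith)
  have h2 : 0 < (1 / (4 * m)) ^ q * (m / 5) ^ 2 := by positivity
  rcases le_or_gt K 0 with hK | hK
  · rw [ENNReal.ofReal_of_nonpos hK, nonpos_iff_eq_zero, ENNReal.ofReal_eq_zero] at hlow
    linarith
  · rw [ENNReal.ofReal_le_ofReal_iff hK.le] at hlow
    linarith

end Sobolev

/-! ### Compactness of sequences with bounded energy -/

/-- Unit speed curves whose double parameters have distance at least `2 η` and which are straight
within distance `η` of them. -/
structure IsStraight (η : ℝ) (γ : ℝ → ℂ) : Prop where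
  unit : IsUnitSpeed γ
  gap : ∀ a b a' b', IsDouble γ a a' → IsDouble γ b b' →
    (∀ k : ℤ, a - b ≠ k) → 2 * η ≤ circ (a - b)
  straight : ∀ u v, IsDouble γ u v → ∀ x, |x - u| < η →
    γ x = γ u + ((x - u : ℝ) : ℂ) * deriv γ u

lemma isAdmissible_iff {η : ℝ} (hη : 0 < η) {jp jm s ω : ℤ} {γ : ℝ → ℂ} :
    IsAdmissible η jp jm s ω γ ↔ γ ∈ genericClass jp jm s ω ∧ IsStraight η γ := by
  constructor
  · intro h
    have hi := h.mem_class.1.immersion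
    exact ⟨h.mem_class, ⟨hi, h.arclength⟩, (le_minGap_iff hi.periodic h.arclength).1 h.gap,
      (straight_iff hi hη).1 h.straight⟩
  · rintro ⟨hc, h⟩
    exact ⟨hc, h.unit.speed, (le_minGap_iff h.unit.immersion.periodic h.unit.speed).2 h.gap,
      (straight_iff h.unit.immersion hη).2 h.straight⟩

/-- Arzelà–Ascoli for closed curves of unit speed starting at the origin. -/
theorem exists_C1_limit {β : ℕ → ℝ → ℂ} (hβ : ∀ n, IsUnitSpeed (β n)) (h0 : ∀ n, β n 0 = 0)
    {r C a : ℝ} (hr : 0 < r) (ha : 0 < a)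
    (hmod : ∀ n s t, |s - t| ≤ r → ‖deriv (β n) s - deriv (β n) t‖ ≤ C * |s - t| ^ a) :
    ∃ γ, ∃ φ : ℕ → ℕ, StrictMono φ ∧ IsUnitSpeed γ ∧ C1Tendsto (fun n => β (φ n)) γ := by
  have hper : ∀ n, Function.Periodic (deriv (β n)) 1 := fun n =>
    periodic_deriv (hβ n).immersion.periodic
  have hcont : ∀ n, Continuous (deriv (β n)) := fun n => (hβ n).immersion.continuous_deriv
  have hliftc : ∀ n, Continuous (hper n).lift := fun n =>
    isQuotientMap_quotient_mk'.continuous_iff.2 (hcont n)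
  -- the tangents as functions on the circle
  set F : ℕ → BoundedContinuousFunction UnitAddCircle ℂ := fun n =>
    BoundedContinuousFunction.mkOfCompact ⟨(hper n).lift, hliftc n⟩ with hF
  set C' := |C| + 2 / r ^ a with hC'
  have hra : 0 < r ^ a := Real.rpow_pos_of_pos hr a
  have hFmod : ∀ x y n, dist (F n x) (F n y) ≤ C' * dist x y ^ a := by
    intro x y n
    obtain ⟨x, rfl⟩ := QuotientAddGroup.mk_surjective x
    obtain ⟨y, rfl⟩ := QuotientAddGroup.mk_surjective y
    obtain ⟨k, hk⟩ := exists_circ_eq (x - y)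
    have e1 : dist (QuotientAddGroup.mk x : UnitAddCircle) (QuotientAddGroup.mk y)
        = circ (x - y) := by
      rw [dist_eq_norm]; rfl
    have e2 : dist (F n (QuotientAddGroup.mk x)) (F n (QuotientAddGroup.mk y))
        = ‖deriv (β n) x - deriv (β n) (y + k)‖ := by
      rw [periodic_add_int (hper n), dist_eq_norm]; rfl
    rw [e1, e2]
    have hd0 := circ_nonneg (x - y)
    have e3 : circ (x - y) = |x - (y + k)| := by rw [hk, sub_sub]
    have hp0 : 0 ≤ circ (x - y) ^ a := Real.rpow_nonneg hd0 a
    rcases le_or_gt (circ (x - y)) r with hle | hgt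
    · have h1 := hmod n x (y + k) (by rwa [← e3])
      rw [← e3] at h1
      refine h1.trans (mul_le_mul_of_nonneg_right ?_ hp0)
      rw [hC']
      have : 0 < 2 / r ^ a := by positivity
      linarith [le_abs_self C]
    · have h1 : ‖deriv (β n) x - deriv (β n) (y + k)‖ ≤ 2 := (norm_sub_le _ _).trans (by
        rw [(hβ n).speed, (hβ n).speed]; norm_num)
      have h2 : r ^ a ≤ circ (x - y) ^ a := Real.rpow_le_rpow hr.le hgt.le ha.le
      have h3 : 2 / r ^ a * r ^ a ≤ C' * circ (x - y) ^ a := by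
        rw [hC']
        refine mul_le_mul ?_ h2 hra.le (by positivity)
        linarith [abs_nonneg C]
      rw [div_mul_cancel₀ _ hra.ne'] at h3
      linarith
  have hequi : Equicontinuous (fun x : range F => (x : UnitAddCircle → ℂ)) := by
    refine Metric.equicontinuous_of_continuity_modulus (fun d => C' * d ^ a) ?_ _ ?_
    · have : ContinuousAt (fun d : ℝ => C' * d ^ a) 0 :=
        (continuousAt_id.rpow_const (Or.inr ha.le)).const_mul C'
      simpa [ContinuousAt, Real.zero_rpow ha.ne'] using this
    · rintro x y ⟨_, n, rfl⟩
      exact hFmod x y n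
  have hcomp := BoundedContinuousFunction.arzela_ascoli (Metric.closedBall (0 : ℂ) 1)
    (isCompact_closedBall _ _) (range F) (by
      rintro _ x ⟨n, rfl⟩
      obtain ⟨x, rfl⟩ := QuotientAddGroup.mk_surjective x
      rw [mem_closedBall_zero_iff]
      exact ((hβ n).speed x).le) hequi
  obtain ⟨G, -, φ, hφ, hG⟩ := hcomp.tendsto_subseq (x := F) fun n => subset_closure ⟨n, rfl⟩
  rw [BoundedContinuousFunction.tendsto_iff_tendstoUniformly] at hG
  set g : ℝ → ℂ := fun x => G (x : UnitAddCircle) with hg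
  have hgc : Continuous g := G.continuous.comp (AddCircle.continuous_mk' 1)
  have hgp : Function.Periodic g 1 := fun x => by
    simp only [hg]; congr 1; exact AddCircle.coe_add_period 1 x
  have hconv : TendstoUniformly (fun n => deriv (β (φ n))) g atTop :=
    hG.comp (fun x : ℝ => (x : UnitAddCircle))
  set γ : ℝ → ℂ := fun x => ∫ y in (0 : ℝ)..x, g y with hγ
  have hγd : ∀ x, HasDerivAt γ (g x) x := fun x =>
    intervalIntegral.integral_hasDerivAt_right (hgc.intervalIntegrable _ _)
      (hgc.stronglyMeasurableAtFilter _ _) hgc.continuousAt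
  have hγd' : deriv γ = g := funext fun x => (hγd x).deriv
  have hβint : ∀ n x, ∫ y in (0 : ℝ)..x, deriv (β n) y = β n x := fun n x => by
    rw [intervalIntegral.integral_deriv_eq_sub
      (fun y _ => (hβ n).immersion.differentiable y) ((hcont n).intervalIntegrable _ _), h0,
      sub_zero]
  have hclose : ∀ ε > 0, ∀ᶠ n in atTop, ∀ x ∈ Icc (0 : ℝ) 1, ‖β (φ n) x - γ x‖ ≤ ε := by
    intro ε hε
    filter_upwards [Metric.tendstoUniformly_iff.1 hconv ε hε] with n hn x hx
    rw [← hβint, hγ]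
    simp only
    rw [← intervalIntegral.integral_sub ((hcont _).intervalIntegrable _ _)
      (hgc.intervalIntegrable _ _)]
    refine (intervalIntegral.norm_integral_le_of_norm_le_const (C := ε) fun y _ => ?_).trans ?_
    · rw [← dist_eq_norm, dist_comm]; exact (hn y).le
    · rw [sub_zero, abs_of_nonneg hx.1]; exact mul_le_of_le_one_right hε.le hx.2
  have hγ1 : γ 1 = 0 := by
    refine norm_le_zero_iff.1 (le_of_forall_pos_le_add fun ε hε => ?_)
    obtain ⟨n, hn⟩ := (hclose ε hε).exists
    have h1 := hn 1 (by simp)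
    have h2 : β (φ n) 1 = 0 := by
      have := (hβ (φ n)).immersion.periodic 0; rwa [zero_add, h0] at this
    rw [h2, zero_sub, norm_neg] at h1
    linarith
  have hγp : Function.Periodic γ 1 := fun x => by
    have h2 := hgp.intervalIntegral_add_eq x 0
    rw [zero_add] at h2
    have h3 : ∫ y in (0 : ℝ)..1, g y = 0 := hγ1
    simp only [hγ]
    rw [← intervalIntegral.integral_add_adjacent_intervals
      (hgc.intervalIntegrable 0 x) (hgc.intervalIntegrable x (x + 1)), h2, h3, add_zero]
  have hspeed : ∀ x, ‖deriv γ x‖ = 1 := fun x => by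
    rw [hγd']
    refine tendsto_nhds_unique (hconv.tendsto_at x).norm (tendsto_const_nhds.congr fun n => ?_)
    exact ((hβ _).speed x).symm
  refine ⟨γ, φ, hφ, ⟨⟨contDiff_one_iff_deriv.2 ⟨fun x => (hγd x).differentiableAt,
    by rw [hγd']; exact hgc⟩, hγp, fun x h => ?_⟩, hspeed⟩, ?_, by rwa [hγd']⟩
  · have := hspeed x; rw [h, norm_zero] at this; norm_num at this
  · refine Metric.tendstoUniformly_iff.2 fun ε hε => ?_
    filter_upwards [hclose (ε / 2) (half_pos hε)] with n hn x
    rw [dist_comm, dist_eq_norm, ← periodic_fract (hβ (φ n)).immersion.periodic x,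
      ← periodic_fract hγp x]
    linarith [hn _ ⟨Int.fract_nonneg x, (Int.fract_lt_one x).le⟩]

/-! ### Limits of straightened curves with bounded energy -/

/-- A sequence of straightened generic curves with bounded energies that converges in `C¹` to a
curve of unit speed. -/
structure IsEnergyBoundedLimit (q δ η K : ℝ) (β : ℕ → ℝ → ℂ) (γ : ℝ → ℂ) : Prop where
  two_lt : 2 < q
  delta_pos : 0 < δ
  delta_le : δ ≤ η / 2
  generic : ∀ n, IsGeneric (β n)
  straight : ∀ n, IsStraight η (β n)
  energy : ∀ n, truncatedTP q δ (β n) ≤ ENNReal.ofReal K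
  conv : C1Tendsto β γ
  unit : IsUnitSpeed γ

section Limit

variable {q δ η K : ℝ} {β : ℕ → ℝ → ℂ} {γ : ℝ → ℂ}

lemma IsEnergyBoundedLimit.subseq (h : IsEnergyBoundedLimit q δ η K β γ) {φ : ℕ → ℕ}
    (hφ : StrictMono φ) : IsEnergyBoundedLimit q δ η K (fun n => β (φ n)) γ :=
  ⟨h.two_lt, h.delta_pos, h.delta_le, fun _ => h.generic _, fun _ => h.straight _,
    fun _ => h.energy _, h.conv.subseq hφ.tendsto_atTop, h.unit⟩

lemma IsEnergyBoundedLimit.eta_pos (h : IsEnergyBoundedLimit q δ η K β γ) : 0 < η := by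
  linarith [h.delta_pos, h.delta_le]

/-- By the energy bound a double point of the limit cannot be away from all cut-out sets. -/
lemma IsEnergyBoundedLimit.eventually_cutOut (h : IsEnergyBoundedLimit q δ η K β γ) {x y ρ : ℝ}
    (hxy : IsDouble γ x y) (hρ : 0 < ρ) : ∀ᶠ n in atTop, ∃ s t, |s - x| ≤ ρ ∧ |t - y| ≤ ρ ∧
      (s, t) ∈ cutOut (β n) δ := by
  obtain ⟨l₀, hl₀, hsep⟩ := exists_separation h.two_lt K
  have hc' := h.unit.immersion.continuous_deriv
  obtain ⟨r, hr, hosc⟩ := uniformContinuous_of_periodic hc'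
    (periodic_deriv h.unit.immersion.periodic) (ε := 1 / 8) (by norm_num)
  have hcirc := circ_pos hxy.2
  set ρ' := min (min ρ 1) (min (circ (x - y) / 2) (r / 2)) with hρ'
  have hρ'0 : 0 < ρ' := by positivity
  have hρ'1 : ρ' ≤ ρ := (min_le_left _ _).trans (min_le_left _ _)
  have hρ'2 : ρ' ≤ 1 := (min_le_left _ _).trans (min_le_right _ _)
  have hρ'3 : ρ' ≤ circ (x - y) / 2 := (min_le_right _ _).trans (min_le_left _ _)
  have hρ'4 : ρ' ≤ r / 2 := (min_le_right _ _).trans (min_le_right _ _)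
  have hlim : Tendsto (fun n => ‖β n x - β n y‖) atTop (𝓝 0) := by
    have := ((h.conv.unif.tendsto_at x).sub (h.conv.unif.tendsto_at y)).norm
    rwa [hxy.1, sub_self, norm_zero] at this
  filter_upwards [hlim.eventually_lt_const (show 0 < min (ρ' / 8) l₀ by positivity),
    Metric.tendstoUniformly_iff.1 h.conv.unif_deriv (1 / 16) (by norm_num)] with n hn1 hn2
  by_contra hcon
  push Not at hcon
  refine absurd (hsep (β n) δ (h.straight n).unit h.delta_pos (h.energy n) x y ρ' hρ'2
    (fun s t hs ht => hcon s t (hs.trans hρ'1) (ht.trans hρ'1)) (by linarith)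
    fun s t hs ht => ?_) (not_le.2 hn1)
  have h1 := hn2 s
  have h2 := hn2 t
  rw [dist_comm, dist_eq_norm] at h1 h2
  have h3 : ‖deriv γ s - deriv γ t‖ ≤ 1 / 8 := by
    refine hosc s t ?_
    have := abs_sub_le s y t
    rw [abs_sub_comm y t] at this
    linarith
  have e : deriv (β n) s - deriv (β n) t = (deriv (β n) s - deriv γ s)
      + (deriv γ s - deriv γ t) - (deriv (β n) t - deriv γ t) := by ring
  rw [e]
  refine (norm_sub_le _ _).trans ((add_le_add_left (norm_add_le _ _) _).trans ?_)
  linarith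

lemma IsEnergyBoundedLimit.straight_of_tendsto (h : IsEnergyBoundedLimit q δ η K β γ)
    {U V : ℕ → ℝ} {u : ℝ} (hU : Tendsto U atTop (𝓝 u)) (hd : ∀ n, IsDouble (β n) (U n) (V n))
    {x : ℝ} (hx : |x - u| < η) : γ x = γ u + ((x - u : ℝ) : ℂ) * deriv γ u := by
  have hi := h.unit.immersion
  have hcont := hi.contDiff.continuous
  refine tendsto_nhds_unique (h.conv.unif.tendsto_at x) ?_
  have l1 := h.conv.unif.tendsto_comp hcont.continuousAt hU
  have l2 := h.conv.unif_deriv.tendsto_comp hi.continuous_deriv.continuousAt hU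
  have l3 : Tendsto (fun n => ((x - U n : ℝ) : ℂ)) atTop (𝓝 ((x - u : ℝ) : ℂ)) :=
    (Complex.continuous_ofReal.tendsto _).comp (tendsto_const_nhds.sub hU)
  refine (l1.add (l3.mul l2)).congr' ?_
  have l4 : Tendsto (fun n => |x - U n|) atTop (𝓝 |x - u|) := (tendsto_const_nhds.sub hU).abs
  filter_upwards [l4.eventually_lt_const hx] with n hn
  exact ((h.straight n).straight _ _ (hd n) x hn).symm

/-- The angles at the double points do not degenerate: otherwise the limit would contain two
overlapping segments, which extend beyond the cut-out set as `δ < η`. -/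
lemma IsEnergyBoundedLimit.cross_ne (h : IsEnergyBoundedLimit q δ η K β γ) {U V : ℕ → ℝ}
    {u v : ℝ} (hU : Tendsto U atTop (𝓝 u)) (hV : Tendsto V atTop (𝓝 v))
    (hd : ∀ n, IsDouble (β n) (U n) (V n)) : cross (deriv γ u) (deriv γ v) ≠ 0 := by
  intro hcr
  have hη := h.eta_pos
  have hi := h.unit.immersion
  have hδη := h.delta_le
  have huv : IsDouble γ u v :=
    h.conv.isDouble_of_tendsto (fun n => (h.straight n).unit.immersion) hi hU hV hd
  have hgapn : ∀ n, 2 * η ≤ circ (U n - V n) := fun n =>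
    (h.straight n).gap _ _ _ _ (hd n) (hd n).symm (hd n).2
  have hgap : 2 * η ≤ circ (u - v) :=
    ge_of_tendsto' (tendsto_circ (hU.sub hV)) hgapn
  have hη4 : η ≤ 1 / 4 := by linarith [circ_le_half (u - v)]
  -- parallel unit tangents agree up to a sign `σ`
  obtain ⟨σ, hσ, hpar⟩ : ∃ σ : ℝ, |σ| = 1 ∧ deriv γ u = (σ : ℂ) * deriv γ v := by
    set e := deriv γ u with he
    set f := deriv γ v with hf
    have he2 : e.re * e.re + e.im * e.im = 1 := by
      rw [← Complex.normSq_apply, ← Complex.sq_norm, he, h.unit.speed]; norm_num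
    have hf2 : f.re * f.re + f.im * f.im = 1 := by
      rw [← Complex.normSq_apply, ← Complex.sq_norm, hf, h.unit.speed]; norm_num
    unfold cross at hcr
    have hpar : e = ((e.re * f.re + e.im * f.im : ℝ) : ℂ) * f := by
      apply Complex.ext
      · rw [Complex.re_ofReal_mul]; linear_combination (-e.re) * hf2 + f.im * hcr
      · rw [Complex.im_ofReal_mul]; linear_combination (-e.im) * hf2 - f.re * hcr
    refine ⟨e.re * f.re + e.im * f.im, ?_, hpar⟩
    have := congrArg norm hpar
    rw [norm_mul, Complex.norm_real, Real.norm_eq_abs, he, hf, h.unit.speed, h.unit.speed,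
      mul_one] at this
    exact this.symm
  have hσ2 : σ * σ = 1 := by rw [← abs_mul_abs_self, hσ, mul_one]
  -- a common point of the overlapping segments at distance `3 η / 4 > δ` from `u` and `v`;
  -- it is a limit of cut-out parameters, which is impossible as the only double parameters in reach
  -- are close to `u`
  set x := u + 3 * η / 4 with hx
  set y := v + σ * (3 * η / 4) with hy
  have hxu : |x - u| = 3 * η / 4 := by
    rw [hx, add_sub_cancel_left, abs_of_pos (by linarith)]
  have hyv : |y - v| = 3 * η / 4 := by
    rw [hy, add_sub_cancel_left, abs_mul, hσ, one_mul, abs_of_pos (by linarith)]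
  have hxy : IsDouble γ x y := by
    refine ⟨?_, ne_int_of_circ_pos ?_⟩
    · rw [h.straight_of_tendsto hU hd (x := x) (by linarith),
        h.straight_of_tendsto hV (fun n => (hd n).symm) (x := y) (by linarith), huv.1, hpar]
      have hx' : x - u = 3 * η / 4 := by rw [hx]; ring
      have hy' : y - v = σ * (3 * η / 4) := by rw [hy]; ring
      rw [hx', hy']
      push_cast
      ring
    · have h1 := circ_triangle u x v
      have h2 := circ_triangle x y v
      have h3 := circ_le_abs (y - v)
      have h4 := circ_le_abs (x - u)
      rw [circ_sub_comm] at h4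
      linarith
  have hUn : ∀ᶠ n in atTop, |U n - u| < η / 16 := by
    have : Tendsto (fun n => |U n - u|) atTop (𝓝 0) := by
      simpa using (hU.sub_const u).abs
    exact this.eventually_lt_const (by positivity)
  obtain ⟨n, ⟨s, t, hs, -, hst⟩, hn⟩ :=
    ((h.eventually_cutOut hxy (show 0 < η / 8 by positivity)).and hUn).exists
  have hsn := h.straight n
  obtain ⟨u', v', hd', h1, -⟩ :=
    (mem_cutOut_iff hsn.unit.immersion.periodic hsn.unit.speed).1 hst
  simp only at h1
  have hsU1 : |s - U n| ≤ 15 * η / 16 := by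
    have a1 := abs_sub_le s x (U n)
    have a2 := abs_sub_le x u (U n)
    rw [abs_sub_comm u (U n)] at a2
    linarith
  have hsU2 : 9 * η / 16 ≤ |s - U n| := by
    have a1 := abs_sub_le x s u
    have a2 := abs_sub_le s (U n) u
    rw [abs_sub_comm x s] at a1
    linarith
  have hcs : circ (s - U n) = |s - U n| := circ_eq_abs (by linarith)
  have hint : ∃ k : ℤ, u' - U n = k := by
    by_contra hk
    push Not at hk
    have a1 := hsn.gap _ _ _ _ hd' (hd n) hk
    have a2 := circ_triangle u' s (U n)
    rw [circ_sub_comm u' s] at a2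
    linarith
  obtain ⟨k, hk⟩ := hint
  have : circ (s - u') = circ (s - U n) := by
    rw [← circ_add_int (s - u') k, ← hk]; congr 1; ring
  linarith

/-- Every double point of the limit is a limit of double points. -/
lemma IsEnergyBoundedLimit.exists_seq (h : IsEnergyBoundedLimit q δ η K β γ) {x y : ℝ}
    (hxy : IsDouble γ x y) : ∃ φ : ℕ → ℕ, StrictMono φ ∧ ∃ U V : ℕ → ℝ,
      (∀ n, IsDouble (β (φ n)) (U n) (V n)) ∧ Tendsto U atTop (𝓝 x) ∧ Tendsto V atTop (𝓝 y) := by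
  have hη := h.eta_pos
  have hδη := h.delta_le
  have hnear : ∀ᶠ n in atTop, ∃ u v, IsDouble (β n) u v ∧ |u - x| ≤ 3 * η / 4 ∧
      |v - y| ≤ 3 * η / 4 := by
    filter_upwards [h.eventually_cutOut hxy (show 0 < η / 4 by positivity)] with n hn
    obtain ⟨s, t, hs, ht, hst⟩ := hn
    have hsn := h.straight n
    obtain ⟨u, v, hd, h1, h2⟩ :=
      (mem_cutOut_iff hsn.unit.immersion.periodic hsn.unit.speed).1 hst
    simp only at h1 h2
    obtain ⟨k, hk⟩ := exists_circ_eq (s - u)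
    obtain ⟨l, hl⟩ := exists_circ_eq (t - v)
    rw [hk, sub_sub] at h1
    rw [hl, sub_sub] at h2
    refine ⟨u + k, v + l, hd.add_int hsn.unit.immersion.periodic k l, ?_, ?_⟩
    · have := abs_sub_le (u + k) s x
      rw [abs_sub_comm _ s] at this
      linarith
    · have := abs_sub_le (v + l) t y
      rw [abs_sub_comm _ t] at this
      linarith
  obtain ⟨φ, hφ, hφn⟩ := extraction_of_eventually_atTop hnear
  choose U V hd hUx hVy using hφn
  obtain ⟨u, hu, ψ, hψ, hUlim⟩ := (isCompact_closedBall x (3 * η / 4)).tendsto_subseq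
    (x := U) fun n => by rw [Metric.mem_closedBall, Real.dist_eq]; exact hUx n
  obtain ⟨v, hv, χ, hχ, hVlim⟩ := (isCompact_closedBall y (3 * η / 4)).tendsto_subseq
    (x := fun n => V (ψ n)) fun n => by rw [Metric.mem_closedBall, Real.dist_eq]; exact hVy _
  have hUlim' := hUlim.comp hχ.tendsto_atTop
  have hmono : StrictMono fun n => φ (ψ (χ n)) := hφ.comp (hψ.comp hχ)
  have hs := h.subseq hmono
  have hd' : ∀ n, IsDouble (β (φ (ψ (χ n)))) (U (ψ (χ n))) (V (ψ (χ n))) := fun n => hd _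
  have hcr := hs.cross_ne hUlim' hVlim hd'
  have huv : IsDouble γ u v := hs.conv.isDouble_of_tendsto
    (fun n => (hs.straight n).unit.immersion) hs.unit.immersion hUlim' hVlim hd'
  rw [Metric.mem_closedBall, Real.dist_eq, abs_sub_comm] at hu hv
  have e1 := hs.straight_of_tendsto hUlim' hd' (x := x) (by linarith)
  have e2 := hs.straight_of_tendsto hVlim (fun n => (hd' n).symm) (x := y) (by linarith)
  -- `(x, y)` and `(u, v)` both lie on the straight pieces, and two transverse lines meet only once
  obtain ⟨c, hc, hcb⟩ := exists_le_norm_sub_of_cross_ne hcr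
  have h1 := hcb (x - u) (y - v)
  have h2 : ((x - u : ℝ) : ℂ) * deriv γ u - ((y - v : ℝ) : ℂ) * deriv γ v = 0 := by
    linear_combination e2 - e1 + hxy.1 - huv.1
  rw [h2, norm_zero] at h1
  have hx0 : |x - u| = 0 := by nlinarith [abs_nonneg (x - u), abs_nonneg (y - v)]
  have hy0 : |y - v| = 0 := by nlinarith [abs_nonneg (x - u), abs_nonneg (y - v)]
  rw [abs_eq_zero, sub_eq_zero] at hx0 hy0
  subst hx0 hy0
  exact ⟨_, hmono, _, _, hd', hUlim', hVlim⟩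

/-- The limit is straightened. -/
theorem IsEnergyBoundedLimit.isStraight (h : IsEnergyBoundedLimit q δ η K β γ) :
    IsStraight η γ := by
  refine ⟨h.unit, fun a b a' b' ha hb hab => ?_, fun u v huv x hx => ?_⟩
  · obtain ⟨φ, hφ, U, V, hd, hU, -⟩ := h.exists_seq ha
    obtain ⟨ψ, hψ, U', V', hd', hU', -⟩ := (h.subseq hφ).exists_seq hb
    have hlim : Tendsto (fun n => circ (U (ψ n) - U' n)) atTop (𝓝 (circ (a - b))) :=
      tendsto_circ ((hU.comp hψ.tendsto_atTop).sub hU')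
    refine ge_of_tendsto hlim ?_
    filter_upwards [hlim.eventually_const_lt (circ_pos hab)] with n hn
    exact (h.straight _).gap _ _ _ _ (hd (ψ n)) (hd' n) (ne_int_of_circ_pos hn)
  · obtain ⟨φ, hφ, U, V, hd, hU, -⟩ := h.exists_seq huv
    exact (h.subseq hφ).straight_of_tendsto hU hd hx

/-- The limit is generic. -/
theorem IsEnergyBoundedLimit.isGeneric (h : IsEnergyBoundedLimit q δ η K β γ) : IsGeneric γ := by
  refine isGeneric_iff.2 ⟨h.unit.immersion, fun x y hxy => ?_, fun x y z hxy hyz hxz => ?_⟩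
  · obtain ⟨φ, hφ, U, V, hd, hU, hV⟩ := h.exists_seq hxy
    exact (h.subseq hφ).cross_ne hU hV hd
  · obtain ⟨φ, hφ, U, V, hd, hU, hV⟩ := h.exists_seq hxy
    obtain ⟨ψ, hψ, V', Z, hd', hV', hZ⟩ := (h.subseq hφ).exists_seq hyz
    have hη := h.eta_pos
    have hlim : Tendsto (fun n => circ (V (ψ n) - V' n)) atTop (𝓝 0) := by
      have := tendsto_circ ((hV.comp hψ.tendsto_atTop).sub hV')
      rwa [sub_self, circ_zero] at this
    have hlim2 : Tendsto (fun n => circ (U (ψ n) - Z n)) atTop (𝓝 (circ (x - z))) :=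
      tendsto_circ ((hU.comp hψ.tendsto_atTop).sub hZ)
    obtain ⟨n, hn1, hn2⟩ := ((hlim.eventually_lt_const (show 0 < 2 * η by linarith)).and
      (hlim2.eventually_const_lt (circ_pos hxz.2))).exists
    have hsn := h.straight (φ (ψ n))
    have hp := hsn.unit.immersion.periodic
    have hk : ∃ k : ℤ, V (ψ n) - V' n = k := by
      by_contra hk
      push Not at hk
      linarith [hsn.gap _ _ _ _ (hd (ψ n)).symm (hd' n) hk]
    obtain ⟨k, hk⟩ := hk
    have d1 := hd (ψ n)
    have d2 := (hd' n).add_int hp k k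
    rw [show V' n + (k : ℝ) = V (ψ n) by linarith] at d2
    refine (h.generic (φ (ψ n))).not_isDouble d1 d2 ⟨d1.1.trans d2.1, ne_int_of_circ_pos ?_⟩
    rwa [← sub_sub, circ_sub_int]

/-- Parameter pairs off the closure of the cut-out set of the limit are eventually off the cut-out
sets of the sequence. -/
lemma IsEnergyBoundedLimit.eventually_notMem_cutOut (h : IsEnergyBoundedLimit q δ η K β γ)
    {x y : ℝ} (hz : (x, y) ∉ cutOut γ δ) (hx : ∀ u v, IsDouble γ u v → circ (x - u) ≠ δ)
    (hy : ∀ u v, IsDouble γ u v → circ (y - u) ≠ δ) :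
    ∀ᶠ n in atTop, (x, y) ∉ cutOut (β n) δ := by
  have hu : ∀ n, IsUnitSpeed (β n) := fun n => (h.straight n).unit
  by_contra hcon
  obtain ⟨φ, hφ, hbad⟩ := extraction_of_frequently_atTop (not_eventually.1 hcon)
  have hbad' : ∀ n, ∃ u v, IsDouble (β (φ n)) u v ∧ circ (x - u) < δ ∧ circ (y - v) < δ := by
    intro n
    have h1 := not_not.1 (hbad n)
    rw [mem_cutOut_iff (hu _).immersion.periodic (hu _).speed] at h1
    exact h1
  choose U V hd hU hV using hbad'
  have hsub := h.conv.subseq hφ.tendsto_atTop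
  obtain ⟨u, v, ψ, hψ, huv, hUu, hVv⟩ := hsub.exists_subseq
    (fun n => (hu (φ n)).immersion) h.unit.immersion hd
  have h1 : circ (x - u) ≤ δ := by
    have l1 := tendsto_circ (hUu.const_sub x)
    refine le_of_tendsto' l1 fun n => ?_
    rw [circ_sub_fract]
    exact (hU _).le
  have h2 : circ (y - v) ≤ δ := by
    have l1 := tendsto_circ (hVv.const_sub y)
    refine le_of_tendsto' l1 fun n => ?_
    rw [circ_sub_fract]
    exact (hV _).le
  refine hz ((mem_cutOut_iff h.unit.immersion.periodic h.unit.speed).2 ⟨u, v, huv, ?_, ?_⟩)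
  · exact lt_of_le_of_ne h1 (hx u v huv)
  · exact lt_of_le_of_ne h2 (hy v u huv.symm)

lemma IsEnergyBoundedLimit.tendsto_radius (h : IsEnergyBoundedLimit q δ η K β γ) {x y : ℝ}
    (hxy : γ x ≠ γ y) : Tendsto (fun n => invTangentPointRadius (β n) y x) atTop
      (𝓝 (invTangentPointRadius γ y x)) := by
  simp only [fun n => invTangentPointRadius_eq (h.straight n).unit,
    invTangentPointRadius_eq h.unit]
  have l1 := h.conv.unif.tendsto_at x
  have l2 := h.conv.unif.tendsto_at y
  have l3 := h.conv.unif_deriv.tendsto_at y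
  have l4 : Tendsto (fun n => cross (deriv (β n) y) (β n x - β n y)) atTop
      (𝓝 (cross (deriv γ y) (γ x - γ y))) :=
    (continuous_cross.tendsto (deriv γ y, γ x - γ y)).comp (l3.prodMk_nhds (l1.sub l2))
  refine (l4.abs.const_mul 2).div ((l2.sub l1).norm.pow 2) ?_
  exact pow_ne_zero 2 (norm_ne_zero_iff.2 (sub_ne_zero.2 hxy.symm))

lemma IsEnergyBoundedLimit.density_le_liminf (h : IsEnergyBoundedLimit q δ η K β γ) {x y : ℝ}
    (hx : ∀ u v, IsDouble γ u v → circ (x - u) ≠ δ)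
    (hy : ∀ u v, IsDouble γ u v → circ (y - u) ≠ δ) :
    density q δ γ (x, y) ≤ liminf (fun n => density q δ (β n) (x, y)) atTop := by
  have hq : 0 < q := by linarith [h.two_lt]
  by_cases hz : (x, y) ∈ cutOut γ δ
  · unfold density; rw [indicator_of_notMem (by simpa using hz)]; exact zero_le
  by_cases hxy : γ x = γ y
  · rw [density_of_notMem hz, invTangentPointRadius_eq h.unit]
    -- at a common point of two branches the quotient is `0 / 0 = 0`
    simp [hxy, Real.zero_rpow hq.ne']
  have hlim : Tendsto (fun n => density q δ (β n) (x, y)) atTop (𝓝 (density q δ γ (x, y))) := by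
    rw [density_of_notMem hz]
    have hl : Tendsto (fun n => ENNReal.ofReal (invTangentPointRadius (β n) y x ^ q)) atTop
        (𝓝 (ENNReal.ofReal (invTangentPointRadius γ y x ^ q))) :=
      ENNReal.tendsto_ofReal ((h.tendsto_radius hxy).rpow_const (Or.inr hq.le))
    refine hl.congr' ?_
    filter_upwards [h.eventually_notMem_cutOut hz hx hy] with n hn
    rw [density_of_notMem hn]
  exact hlim.liminf_eq.ge

/-- The coordinates of boundary points of the cut-out set form a countable set. -/
lemma IsGeneric.countable_boundary (hγ : IsGeneric γ) (hδ : 0 < δ) :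
    {x | ∃ u v, IsDouble γ u v ∧ circ (x - u) = δ}.Countable := by
  have hp := hγ.immersion.periodic
  have hsub : {x | ∃ u v, IsDouble γ u v ∧ circ (x - u) = δ} ⊆
      ⋃ u ∈ doubleParams γ, ⋃ k : ℤ, ({u + k + δ, u + k - δ} : Set ℝ) := by
    rintro x ⟨u, v, huv, hx⟩
    obtain ⟨k, hk⟩ := exists_circ_eq (x - u)
    rw [hk] at hx
    simp only [mem_iUnion]
    refine ⟨Int.fract u, (mem_doubleParams_iff hp).2 ⟨fract_mem_Ico u, _, huv.fract hp⟩,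
      ⌊u⌋ + k, ?_⟩
    have e : Int.fract u + ((⌊u⌋ + k : ℤ) : ℝ) = u + k := by
      push_cast; unfold Int.fract; ring
    rw [e]
    rcases abs_eq hδ.le |>.1 hx with hx | hx
    · left; linarith
    · right; simp only [mem_singleton_iff]; linarith
  exact (hγ.finite_doubleParams.countable.biUnion fun u _ =>
    countable_iUnion fun k => (Set.toFinite _).countable).mono hsub

/-- Lower semicontinuity of the truncated energy. -/
theorem IsEnergyBoundedLimit.truncatedTP_le (h : IsEnergyBoundedLimit q δ η K β γ) :
    truncatedTP q δ γ ≤ liminf (fun n => truncatedTP q δ (β n)) atTop := by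
  have hu : ∀ n, IsUnitSpeed (β n) := fun n => (h.straight n).unit
  have hN := h.isGeneric.countable_boundary h.delta_pos
  set N := {x | ∃ u v, IsDouble γ u v ∧ circ (x - u) = δ}
  rw [truncatedTP_eq h.unit]
  simp only [fun n => truncatedTP_eq (q := q) (δ := δ) (hu n)]
  refine le_trans (lintegral_mono_ae ?_) (lintegral_liminf_le fun n => measurable_density (hu n))
  refine ae_restrict_of_ae ?_
  rw [Measure.volume_eq_prod]
  have a1 : ∀ᵐ z : ℝ × ℝ ∂(volume.prod volume), z.1 ∉ N :=
    Measure.quasiMeasurePreserving_fst.ae (hN.ae_notMem volume)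
  have a2 : ∀ᵐ z : ℝ × ℝ ∂(volume.prod volume), z.2 ∉ N :=
    Measure.quasiMeasurePreserving_snd.ae (hN.ae_notMem volume)
  filter_upwards [a1, a2] with z h1 h2
  exact h.density_le_liminf (fun u v huv he => h1 ⟨u, v, huv, he⟩)
    fun u v huv he => h2 ⟨u, v, huv, he⟩

end Limit

/-! ### Minimization -/

section Translate

variable {γ : ℝ → ℂ} {q δ η : ℝ} (c : ℂ)

lemma deriv_translate : deriv (fun x => γ x - c) = deriv γ := funext fun _ => deriv_sub_const c

lemma isDouble_translate {x y : ℝ} : IsDouble (fun x => γ x - c) x y ↔ IsDouble γ x y := by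
  unfold IsDouble
  rw [sub_left_inj]

lemma IsImmersion.translate (h : IsImmersion γ) : IsImmersion fun x => γ x - c :=
  ⟨h.contDiff.sub contDiff_const, fun x => by simp only [h.periodic x],
    fun x => by rw [deriv_translate]; exact h.deriv_ne_zero x⟩

lemma IsGeneric.translate (h : IsGeneric γ) : IsGeneric fun x => γ x - c := by
  rw [isGeneric_iff] at h ⊢
  simp only [isDouble_translate, deriv_translate]
  exact ⟨h.1.translate c, h.2⟩

lemma IsUnitSpeed.translate (h : IsUnitSpeed γ) : IsUnitSpeed fun x => γ x - c :=
  ⟨h.immersion.translate c, fun x => by rw [deriv_translate]; exact h.speed x⟩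

lemma IsStraight.translate (h : IsStraight η γ) : IsStraight η fun x => γ x - c := by
  refine ⟨h.unit.translate c, ?_, ?_⟩
  · simp only [isDouble_translate]
    exact h.gap
  · simp only [isDouble_translate, deriv_translate]
    intro u v huv x hx
    rw [h.straight u v huv x hx]
    ring

lemma IsUnitSpeed.truncatedTP_translate (h : IsUnitSpeed γ) :
    truncatedTP q δ (fun x => γ x - c) = truncatedTP q δ γ := by
  have e : cutOut (fun x => γ x - c) δ = cutOut γ δ := by
    ext z
    rw [mem_cutOut_iff (h.translate c).immersion.periodic (h.translate c).speed,
      mem_cutOut_iff h.immersion.periodic h.speed]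
    simp only [isDouble_translate]
  rw [truncatedTP_eq h, truncatedTP_eq (h.translate c)]
  unfold density
  simp only [e, invTangentPointRadius_eq h, invTangentPointRadius_eq (h.translate c),
    deriv_translate, sub_sub_sub_cancel_right]

lemma IsGeneric.joinedWithin_translate (h : IsGeneric γ) :
    JoinedWithin {γ | IsGeneric γ} γ fun x => γ x - c := by
  have e : ∀ t : ℝ, segment γ (fun x => γ x - c) t = fun x => γ x - t * c := fun t => by
    funext x
    unfold segment
    simp only [Complex.real_smul]
    push_cast
    ring
  refine joinedWithin_segment h.immersion.contDiff (h.translate c).immersion.contDiff fun t _ => ?_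
  rw [e]
  exact h.translate _

end Translate

/-- A compartment that contains curves straightened at scale `η` contains one of least energy.
Minimizing sequences are normalized by translations. -/
theorem IsCompartment.exists_minimizer {jp jm s ω : ℤ} {C : Set (ℝ → ℂ)}
    (hC : IsCompartment jp jm s ω C) {η δ q : ℝ} (hη : 0 < η) (hδ : 0 < δ) (hδη : δ ≤ η / 2)
    (hq : 2 < q) (hne : (admissible η jp jm s ω ∩ C ∩ C11).Nonempty) :
    ∃ γ ∈ admissible η jp jm s ω ∩ fractionalSobolev (1 - 1 / q) q ∩ C,
      ∀ γ' ∈ admissible η jp jm s ω ∩ C, truncatedTP q δ γ ≤ truncatedTP q δ γ' := by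
  obtain ⟨α, ⟨hαa, hαC⟩, hα⟩ := hne
  have hq0 : 0 < q := by linarith
  set m := sInf (truncatedTP q δ '' (admissible η jp jm s ω ∩ C)) with hm
  have hle : ∀ γ' ∈ admissible η jp jm s ω ∩ C, m ≤ truncatedTP q δ γ' := fun γ' h =>
    sInf_le (mem_image_of_mem _ h)
  -- if all energies are infinite, then every competitor is a minimizer, in particular the one of
  -- class `C^{1,1}`
  by_cases hfin : m = ∞
  · refine ⟨α, ⟨⟨hαa, mem_fractionalSobolev_of_lipschitz hαa.mem_class.1.immersion hq0 hα.2⟩,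
      hαC⟩, fun γ' hγ' => ?_⟩
    rw [show truncatedTP q δ γ' = ∞ from top_le_iff.1 (hfin.symm.trans_le (hle γ' hγ'))]
    exact le_top
  obtain ⟨E, -, hE, hEmem⟩ := exists_seq_tendsto_sInf
    (show (truncatedTP q δ '' (admissible η jp jm s ω ∩ C)).Nonempty from
      ⟨_, mem_image_of_mem _ ⟨hαa, hαC⟩⟩) (OrderBot.bddBelow _)
  rw [← hm] at hE
  have hlt : m < m + 1 := ENNReal.lt_add_right hfin one_ne_zero
  obtain ⟨N, hN⟩ := eventually_atTop.1 (hE.eventually_lt_const hlt)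
  choose A hA hAE using hEmem
  set K := (m + 1).toReal with hK
  have hKm : ENNReal.ofReal K = m + 1 :=
    ENNReal.ofReal_toReal (ENNReal.add_ne_top.2 ⟨hfin, ENNReal.one_ne_top⟩)
  -- a tail of the minimizing sequence, on which the energy is bounded, translated to start at `0`
  set β : ℕ → ℝ → ℂ := fun n x => A (n + N) x - A (n + N) 0 with hβ
  have hAs : ∀ n, IsStraight η (A n) := fun n => ((isAdmissible_iff hη).1 (hA n).1).2
  have hAg : ∀ n, IsGeneric (A n) := fun n => (hA n).1.mem_class.1
  have hβs : ∀ n, IsStraight η (β n) := fun n => (hAs _).translate _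
  have hβg : ∀ n, IsGeneric (β n) := fun n => (hAg _).translate _
  have hβC : ∀ n, β n ∈ C := fun n =>
    hC.mem_of_joined (hA _).2 ((hAg _).joinedWithin_translate _)
  have hβE : ∀ n, truncatedTP q δ (β n) = E (n + N) := fun n =>
    ((hAs _).unit.truncatedTP_translate _).trans (hAE _)
  have hβK : ∀ n, truncatedTP q δ (β n) ≤ ENNReal.ofReal K := fun n => by
    rw [hβE, hKm]
    exact (hN _ (by omega)).le
  obtain ⟨r, hr, D, hmod⟩ := exists_modulus hq hη (K := K) ENNReal.toReal_nonneg
  have ha : 0 < 1 - 2 / q := by rw [sub_pos, div_lt_one hq0]; exact hq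
  obtain ⟨γ, φ, hφ, hγ, hlim⟩ := exists_C1_limit (fun n => (hβs n).unit)
    (fun n => sub_self _) hr ha fun n => hmod (β n) δ (hβs n).unit
      (fun s t => notMem_cutOut_of_abs_le (hβs n).unit hδη (hβs n).gap) (hβK n)
  have hL : IsEnergyBoundedLimit q δ η K (fun n => β (φ n)) γ :=
    ⟨hq, hδ, hδη, fun _ => hβg _, fun _ => hβs _, fun _ => hβK _, hlim, hγ⟩
  have hγC : γ ∈ C := by
    obtain ⟨n, hn⟩ := (hL.isGeneric.eventually_segment hlim
      (fun n => (hβg _).immersion.contDiff) fun n => (hβg _).immersion.periodic).exists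
    exact hC.mem_of_joined (hβC _)
      (joinedWithin_segment (hβg _).immersion.contDiff hγ.immersion.contDiff hn)
  have hEγ : truncatedTP q δ γ ≤ m := by
    refine hL.truncatedTP_le.trans (Tendsto.liminf_eq ?_).le
    simp only [hβE]
    exact hE.comp ((tendsto_add_atTop_nat N).comp hφ.tendsto_atTop)
  refine ⟨γ, ⟨⟨(isAdmissible_iff hη).2 ⟨hC.subset hγC, hL.isStraight⟩,
    mem_fractionalSobolev_of_energy hγ hq0 hη
      (fun s t => notMem_cutOut_of_abs_le hγ hδη hL.isStraight.gap)
      (ne_top_of_le_ne_top hfin hEγ)⟩, hγC⟩, fun γ' hγ' => hEγ.trans (hle γ' hγ')⟩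

end PlaneCurve

theorem theorem1p3 (jp jm s ω : ℤ) (C : Set (ℝ → ℂ))
    (hC : PlaneCurve.IsCompartment jp jm s ω C) :
    (∃ η₀ : ℝ, PlaneCurve.IsThreshold jp jm s ω C η₀) ∧
    ∀ η₀ : ℝ, PlaneCurve.IsThreshold jp jm s ω C η₀ →
      ∀ η ∈ Set.Ioc 0 η₀, ∀ δ ∈ Set.Ioc 0 (η / 2), ∀ q : ℝ, 2 < q →
        ∃ γ ∈ PlaneCurve.admissible η jp jm s ω ∩
            PlaneCurve.fractionalSobolev (1 - 1 / q) q ∩ C,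
          ∀ γ' ∈ PlaneCurve.admissible η jp jm s ω ∩ C,
            PlaneCurve.truncatedTP q δ γ ≤ PlaneCurve.truncatedTP q δ γ' :=
  ⟨hC.exists_threshold, fun _ h _ hη _ hδ _ hq =>
    hC.exists_minimizer hη.1 hδ.1 hδ.2 hq (h.2.2 _ hη)⟩
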